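/- Let $\Bbbk$ be an algebraically closed field of characteristic $0$ and let $p$ be a positive integer. Let ${\rm Y}_p(\mathfrak{gl}_2)$ be the Yangian of level $p$: the unital associative $\Bbbk$-algebra with generators $t_{ij}^{(1)},\dots,t_{ij}^{(p)}$, $i,j\in\{1,2\}$, and defining relations $$[t^{(r)}_{ij}, t^{(s)}_{kl}] =\sum_{a=1}^{\min(r,s)}\big(t^{(a-1)}_{kj}\, t^{(r+s-a)}_{il}-t^{(r+s-a)}_{kj}\, t^{(a-1)}_{il}\big),\qquad 1\le r,s\le p,$$ where $t^{(0)}_{ij}=\delta_{ij}$ and $t_{ij}^{(r)}=0$ for $r\geq p+1$. Put $T_{ij}(u)=\delta_{ij}u^p+\sum_{k=1}^p t_{ij}^{(k)}u^{p-k}$ and let $D(u)=T_{11}(u)T_{22}(u-1)-T_{21}(u)T_{12}(u-1)$ be the quantum determinant. Let $\Gamma$ be the subalgebra of ${\rm Y}_p(\mathfrak{gl}_2)$ generated by the coefficients of $D(u)$ and of $T_{22}(u)$. Then $\Gamma$ is commutative, and the following hold. 1. ${\rm Y}_p(\mathfrak{gl}_2)$ is free as a left $\Gamma$-module and free as a right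 $\Gamma$-module. Moreover, $\Gamma$ is a direct summand of ${\rm Y}_p(\mathfrak{gl}_2)$, both as a left $\Gamma$-module and as a right $\Gamma$-module. 2. Every maximal ideal $\mathbf m$ of $\Gamma$ extends to an irreducible ${\rm Y}_p(\mathfrak{gl}_2)$-module; that is, there is an irreducible ${\rm Y}_p(\mathfrak{gl}_2)$-module $M$ which is a Harish-Chandra module with respect to $\Gamma$ and satisfies $M(\mathbf m)\neq 0$. Here, for a maximal ideal $\mathbf n$ of $\Gamma$, one sets $M(\mathbf n)=\{x\in M \mid \mathbf n^k x=0 \text{ for some } k\ge 0\}$, and a finitely generated module $M$ is a Harish-Chandra module with respect to $\Gamma$ if $M=\bigoplus_{\mathbf n}M(\mathbf n)$, the sum being over all maximal ideals $\mathbf n$ of $\Gamma$. -/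

import Mathlib

open Polynomial

universe u

noncomputable section

/-! ## The Yangian of level `p` for `gl₂` -/

/-- In the free algebra on the symbols `t_{ij}^{(1)}, …, t_{ij}^{(p)}` (`i, j = 1, 2`; the symbol
`t_{ij}^{(k+1)}` is the letter `(i, j, k)`, and the indices `1, 2` are the elements `0, 1` of
`Fin 2`), the element `t_{ij}^{(r)}` for an arbitrary `r ≥ 0`, with the conventions
`t_{ij}^{(0)} = δ_{ij}` and `t_{ij}^{(r)} = 0` for `r > p`. -/
def freeT (𝕜 : Type u) [Field 𝕜] (p : ℕ) (i j : Fin 2) :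
    ℕ → FreeAlgebra 𝕜 (Fin 2 × Fin 2 × Fin p)
  | 0 => if i = j then 1 else 0
  | r + 1 => if h : r < p then FreeAlgebra.ι 𝕜 (i, j, ⟨r, h⟩) else 0

/-- The defining relations
`[t_{ij}^{(r)}, t_{kl}^{(s)}]
  = ∑_{a=1}^{min(r,s)} (t_{kj}^{(a-1)} t_{il}^{(r+s-a)} - t_{kj}^{(r+s-a)} t_{il}^{(a-1)})`
for `1 ≤ r, s ≤ p`. -/
inductive YangianRel (𝕜 : Type u) [Field 𝕜] (p : ℕ) :
    FreeAlgebra 𝕜 (Fin 2 × Fin 2 × Fin p) → FreeAlgebra 𝕜 (Fin 2 × Fin 2 × Fin p) → Prop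
  | comm (i j k l : Fin 2) (r s : ℕ) (hr : 1 ≤ r) (hrp : r ≤ p) (hs : 1 ≤ s) (hsp : s ≤ p) :
      YangianRel 𝕜 p
        (freeT 𝕜 p i j r * freeT 𝕜 p k l s - freeT 𝕜 p k l s * freeT 𝕜 p i j r)
        (∑ a ∈ Finset.Icc 1 (min r s),
          (freeT 𝕜 p k j (a - 1) * freeT 𝕜 p i l (r + s - a)
            - freeT 𝕜 p k j (r + s - a) * freeT 𝕜 p i l (a - 1)))

/-- The level `p` Yangian `Y_p(gl₂)` over `𝕜`. -/
def LevelYangian (𝕜 : Type u) [Field 𝕜] (p : ℕ) : Type u := RingQuot (YangianRel 𝕜 p)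

instance (𝕜 : Type u) [Field 𝕜] (p : ℕ) : Ring (LevelYangian 𝕜 p) :=
  inferInstanceAs (Ring (RingQuot (YangianRel 𝕜 p)))

instance (𝕜 : Type u) [Field 𝕜] (p : ℕ) : Algebra 𝕜 (LevelYangian 𝕜 p) :=
  inferInstanceAs (Algebra 𝕜 (RingQuot (YangianRel 𝕜 p)))

/-- The quotient map from the free algebra onto `Y_p(gl₂)`. -/
def LevelYangian.mk (𝕜 : Type u) [Field 𝕜] (p : ℕ) :
    FreeAlgebra 𝕜 (Fin 2 × Fin 2 × Fin p) →ₐ[𝕜] LevelYangian 𝕜 p :=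
  RingQuot.mkAlgHom 𝕜 (YangianRel 𝕜 p)

/-- The element `t_{ij}^{(r)}` of `Y_p(gl₂)`, for all `r ≥ 0`. -/
def yangianT (𝕜 : Type u) [Field 𝕜] (p : ℕ) (i j : Fin 2) (r : ℕ) : LevelYangian 𝕜 p :=
  LevelYangian.mk 𝕜 p (freeT 𝕜 p i j r)

/-- The polynomial `T_{ij}(u) = δ_{ij} u^p + ∑_{k=1}^p t_{ij}^{(k)} u^{p-k}`. -/
def yangianTPoly (𝕜 : Type u) [Field 𝕜] (p : ℕ) (i j : Fin 2) : (LevelYangian 𝕜 p)[X] :=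
  (if i = j then X ^ p else 0) + ∑ k ∈ Finset.Icc 1 p, C (yangianT 𝕜 p i j k) * X ^ (p - k)

/-- The quantum determinant `D(u) = T_{11}(u) T_{22}(u-1) - T_{21}(u) T_{12}(u-1)`. -/
def quantumDet (𝕜 : Type u) [Field 𝕜] (p : ℕ) : (LevelYangian 𝕜 p)[X] :=
  yangianTPoly 𝕜 p 0 0 * (yangianTPoly 𝕜 p 1 1).comp (X - 1)
    - yangianTPoly 𝕜 p 1 0 * (yangianTPoly 𝕜 p 0 1).comp (X - 1)

/-- The subalgebra `Γ` of `Y_p(gl₂)` generated by the coefficients of `D(u)` and `T_{22}(u)`. -/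
def yangianGamma (𝕜 : Type u) [Field 𝕜] (p : ℕ) : Subalgebra 𝕜 (LevelYangian 𝕜 p) :=
  Algebra.adjoin 𝕜
    (Set.range (quantumDet 𝕜 p).coeff ∪ Set.range (yangianTPoly 𝕜 p 1 1).coeff)

/-! ## A subalgebra as a left and as a right module over itself -/

section Summand

variable {𝕜 : Type u} [Field 𝕜] {U : Type u} [Ring U] [Algebra 𝕜 U]

/-- A subalgebra `Γ` of `U`, viewed as a left `Γ`-submodule of `U`. -/
def Subalgebra.asLeftSubmodule (Γ : Subalgebra 𝕜 U) : Submodule Γ U where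
  carrier := {x | x ∈ Γ}
  add_mem' := Γ.add_mem
  zero_mem' := Γ.zero_mem
  smul_mem' c _ hx := Γ.mul_mem c.2 hx

/-- A subalgebra `Γ` of `U`, viewed as a right `Γ`-submodule of `U`. Right `Γ`-modules are
modules over `Γ.op`, the subalgebra `Γ` of the opposite algebra `Uᵐᵒᵖ`; the latter acts on `U` by
`MulOpposite.op a • x = x * a`. -/
def Subalgebra.asRightSubmodule (Γ : Subalgebra 𝕜 U) : Submodule Γ.op U where
  carrier := {x | x ∈ Γ}
  add_mem' := Γ.add_mem
  zero_mem' := Γ.zero_mem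
  smul_mem' c _ hx := Γ.mul_mem hx c.2

end Summand

/-! ## Harish-Chandra modules -/

section HarishChandra

variable {𝕜 : Type u} [Field 𝕜] {U : Type u} [Ring U] [Algebra 𝕜 U]

/-- For an ideal `m` of a subalgebra `Γ` of `U` and a `U`-module `M`,
the subgroup `M(m) = {x ∈ M | m ^ n x = 0 for some n ≥ 0}`. -/
def genWeightSpace (Γ : Subalgebra 𝕜 U) (m : Ideal Γ) (M : Type u) [AddCommGroup M]
    [Module U M] : AddSubgroup M where
  carrier := {x | ∃ n : ℕ, ∀ a ∈ m ^ n, a • x = 0}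
  zero_mem' := ⟨0, fun a _ => smul_zero a⟩
  add_mem' := by
    rintro x y ⟨n, hn⟩ ⟨l, hl⟩
    exact ⟨n + l, fun a ha => by
      rw [smul_add, hn a (Ideal.pow_le_pow_right (Nat.le_add_right n l) ha),
        hl a (Ideal.pow_le_pow_right (Nat.le_add_left l n) ha), add_zero]⟩
  neg_mem' := by
    rintro x ⟨n, hn⟩
    exact ⟨n, fun a ha => by rw [smul_neg, hn a ha, neg_zero]⟩

open scoped Classical in
/-- A Harish-Chandra module for the pair `(U, Γ)`, with `Γ` a commutative subalgebra: a finitely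
generated `U`-module `M` which is the direct sum of the `M(m)` over all maximal ideals `m`
of `Γ`. -/
def IsHarishChandraModule (Γ : Subalgebra 𝕜 U) (M : Type u) [AddCommGroup M]
    [Module U M] : Prop :=
  Module.Finite U M ∧
    DirectSum.IsInternal
      (fun m : {m : Ideal Γ // m.IsMaximal} => genWeightSpace Γ m.1 M)

/-- The maximal ideal `m` of `Γ` extends to the `U`-module `M`: `M` is an irreducible
Harish-Chandra module for `(U, Γ)` with `M(m) ≠ 0`. -/
def IsExtendedFrom (Γ : Subalgebra 𝕜 U) (m : Ideal Γ) (M : Type u) [AddCommGroup M]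
    [Module U M] : Prop :=
  IsSimpleModule U M ∧ IsHarishChandraModule Γ M ∧ genWeightSpace Γ m M ≠ ⊥

end HarishChandra

end

/-! # The Yangian of level `p` for `gl₂` is free over its Gelfand-Tsetlin subalgebra

Commutativity of `Γ` comes from the `RTT` form of the relations: after evaluation at scalars `u`,
`v` the commutators in question are killed by a nonzero polynomial in `u - v`, so they vanish at
infinitely many values and hence for the coefficients (`yangianT_commute_same`,
`quantumDet_coeff_central`).

*Ordered monomials.* Filter the Yangian by `deg t_{ij}^{(r)} = r`. The relations show that the
associated graded algebra is commutative and that ordered monomials span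
(`weightFiltration_le_span`). They are independent (`orderedMonomialMap_injective`) because the
Yangian acts through the matrix `(u + E₀)(u + E₁)⋯(u + E_{p-1})`, where the entries of the `E_s`
are commuting copies of the generators of `gl₂` realized by the operators `x_{im} ∂_{jm}`.
Replacing `∂_a` by `∂_a + ξ_a λ^{N_a}` does not change the commutation relations, and when the
exponents `N_a` decrease with the site, the leading term in `λ` of the `r`-th coefficient is the
matrix product `Z₀Z₁⋯Z_{r-1}` of arbitrary matrices `Z_s`. These partial products are generic, so a
polynomial that vanishes on them is zero. Hence the associated graded algebra is a polynomial ring.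

*Regularity.* The symbols of the nontrivial coefficients of `T₂₂(u)` and `D(u)` form a weakly
regular sequence (`isWeaklyRegular_gammaIndices`). The coefficients of `u^p, …, u^{2p-1}` in the
determinant can replace the variables `t₁₁^{(r)}` as coordinates; modulo these and the `t₂₂^{(r)}`,
the remaining coefficients become those of `-t₂₁(u) t₁₂(u)` modulo `u^p`, where `t₁₂(u)` and
`t₂₁(u)` are generic of degree less than `p`. These are the equations of a jet scheme of the node
`ab = 0`, for which regularity follows by induction on the number of equations, through the exact
sequence `0 → M/b₀ → M/a₀b₀ → M/a₀ → 0` (`isWeaklyRegular_convCoeff`).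

*Freeness.* A weakly regular sequence of homogeneous elements makes the polynomial ring free over
them, with a basis of monomials containing `1` (`exists_monomial_basis_of_isWeaklyRegular`). A
family of elements of the Yangian with these symbols is again a basis, whichever way the factors
are multiplied, and so the ordered monomials from this basis form a basis over `Γ` acting on either
side, containing `1` (`exists_basis_over_yangianGamma`). This gives freeness and the direct
summands.

*Extension of maximal ideals.* Let `U` denote the Yangian. As `Γ` is a direct summand of the right
`Γ`-module `U`, a maximal ideal `m` of `Γ` generates a proper left ideal of `U`. A simple quotient
of `U ⧸ U m` has a generator killed by `m`, hence locally finite over `Γ`. Since `D(u)` is central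
and the `t₂₂^{(q)}` can be moved across `t₁₂^{(r)}` and `t₂₁^{(r)}`, the locally finite vectors
form a submodule (`IsLocallyFiniteVector.yangian_smul`), so the quotient is the direct sum of its
generalized weight spaces by the Chinese remainder theorem
(`isInternal_of_isArtinianRing_quotient`). -/

noncomputable section

/-! ### The RTT relation for evaluated matrices -/

section RTT

variable {k : Type*} {A : Type*} [Field k] [Ring A] [Algebra k A]

/-- The defining relation of the Yangian for two evaluated `2 × 2` matrices `T = T(u)` and
`T' = T(v)`, where `z = u - v`. -/
def RTT (z : k) (T T' : Fin 2 → Fin 2 → A) : Prop :=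
  ∀ i j m l, z • (T i j * T' m l - T' m l * T i j) = T m j * T' i l - T' m j * T i l

/-- The `RTT` relation is closed under matrix products with commuting entries. -/
theorem RTT.mul {z : k} {T T' L L' : Fin 2 → Fin 2 → A} (hT : RTT z T T') (hL : RTT z L L')
    (h₁ : ∀ i j m l, Commute (L i j) (T' m l)) (h₂ : ∀ i j m l, Commute (L' i j) (T m l)) :
    RTT z (fun i j => ∑ m, T i m * L m j) (fun i j => ∑ m, T' i m * L' m j) := by
  intro i j m l
  have c₁ : ∀ i j m l x, L i j * (T' m l * x) = T' m l * (L i j * x) :=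
    fun i j m l x => (h₁ i j m l).left_comm x
  have c₂ : ∀ i j m l x, L' i j * (T m l * x) = T m l * (L' i j * x) :=
    fun i j m l x => (h₂ i j m l).left_comm x
  have key : ∀ a b, z • (T i a * (T' m b * (L a j * L' b l)) - T' m b * (T i a * (L' b l * L a j)))
      = (T m a * T' i b - T' m a * T i b) * (L a j * L' b l)
        + T' m b * T i a * (L b j * L' a l - L' b j * L a l) := by
    intro a b
    rw [← hT i a m b, ← hL a j b l, smul_mul_assoc, mul_smul_comm, ← smul_add]
    congr 1
    noncomm_ring
  simp only [Fin.sum_univ_two, mul_add, add_mul, mul_assoc, c₁, c₂]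
  linear_combination (norm := (simp only [mul_sub, sub_mul, mul_assoc]; module))
    key 0 0 + key 0 1 + key 1 0 + key 1 1

/-- The quantum determinant commutes with the entries of `T(v)`, up to a scalar vanishing for at
most two values of `z = u - v`; here `T = T(u)`, `S = T(u - 1)` and `V = T(v)`. -/
theorem RTT.quantumDet_comm {z : k} {T S V : Fin 2 → Fin 2 → A} (hTS : RTT (1 : k) T S)
    (hTV : RTT z T V) (hSV : RTT (z - 1) S V) (m n : Fin 2) :
    (z * (z - 2)) • ((T 0 0 * S 1 1 - T 1 0 * S 0 1) * V m n)
      = (z * (z - 2)) • (V m n * (T 0 0 * S 1 1 - T 1 0 * S 0 1)) := by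
  -- `R₁₃(z) R₂₃(z - 1)` applied to the rows of `T S V`, antisymmetrised over the first two rows
  have step : ∀ i k, z • (T i 0 * ((z - 1) • (S k 1 * V m n) - S m 1 * V k n))
        - T m 0 * ((z - 1) • (S k 1 * V i n) - S i 1 * V k n)
      = (z - 1) • ((z • (V m n * T i 0) - V m 0 * T i n) * S k 1)
        - (z • (V m 1 * T i 0) - V m 0 * T i 1) * S k n := by
    intro i k
    have b₁ := congrArg (fun x => T i 0 * x) (hSV k 1 m n)
    have b₂ := congrArg (fun x => T m 0 * x) (hSV k 1 i n)
    have a₁ := congrArg (fun x => x * S k 1) (hTV i 0 m n)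
    have a₂ := congrArg (fun x => x * S k n) (hTV i 0 m 1)
    simp only [mul_sub, sub_mul, mul_smul_comm, smul_mul_assoc, mul_assoc, smul_sub] at b₁ b₂ a₁ a₂ ⊢
    linear_combination (norm := module) z • b₁ - b₂ + (z - 1) • a₁ - a₂
  have x₀₀ : T 0 0 * S 1 0 - T 1 0 * S 0 0 = 0 := by
    linear_combination (norm := module) hTS 0 0 1 0
  have x₁₁ : T 0 1 * S 1 1 - T 1 1 * S 0 1 = 0 := by
    linear_combination (norm := module) hTS 0 1 1 1
  have x₁₀ : T 0 1 * S 1 0 - T 1 1 * S 0 0 = -(T 0 0 * S 1 1 - T 1 0 * S 0 1) := by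
    linear_combination (norm := module) hTS 0 1 1 0 + hTS 0 0 1 1
  have s := congrArg₂ (fun x y => x - y) (step 0 1) (step 1 0)
  have y₀ := congrArg (fun x => V m 0 * x) x₁₀
  have y₀₀ := congrArg (fun x => V m 1 * x) x₀₀
  have y₁₁ := congrArg (fun x => V m 0 * x) x₁₁
  simp only [mul_sub, sub_mul, mul_smul_comm, smul_mul_assoc, mul_assoc, smul_sub, mul_neg,
    mul_zero] at s y₀ y₀₀ y₁₁ ⊢
  fin_cases n
  · fin_cases m <;> simp only [Fin.zero_eta, Fin.mk_one, Fin.isValue] at *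
    · linear_combination (norm := module) s + y₀ - z • y₀₀
    · linear_combination (norm := module) s + y₀ - z • y₀₀
  · fin_cases m <;> simp only [Fin.zero_eta, Fin.mk_one, Fin.isValue] at *
    · linear_combination (norm := module) s - (z - 2) • y₁₁
    · linear_combination (norm := module) s - (z - 2) • y₁₁

end RTT

/-! ### Coefficients and values of matrix polynomials -/

section Evaluation

variable {k : Type*} {A : Type*} [Field k] [Ring A] [Algebra k A]

/-- A polynomial with coefficients in a `k`-module that vanishes on an infinite set of scalars is
zero. -/
theorem eq_zero_of_sum_pow_smul_eq_zero {n : ℕ} {c : ℕ → A} {S : Set k} (hS : S.Infinite)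
    (h : ∀ u ∈ S, ∑ r ∈ Finset.range (n + 1), u ^ (n - r) • c r = 0) {r : ℕ} (hr : r ≤ n) :
    c r = 0 := by
  rw [← Module.forall_dual_apply_eq_zero_iff k]
  intro φ
  have h0 : (∑ s ∈ Finset.range (n + 1), monomial (n - s) (φ (c s)) : k[X]) = 0 := by
    refine Polynomial.eq_zero_of_infinite_isRoot _ (hS.mono fun u hu => ?_)
    have := congrArg φ (h u hu)
    simp only [map_sum, map_smul, smul_eq_mul, map_zero] at this
    simp only [Set.mem_ofPred_eq, IsRoot, eval_finsetSum, eval_monomial]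
    simpa only [mul_comm] using this
  have h1 := congrArg (fun q => coeff q (n - r)) h0
  simp only [finsetSum_coeff, coeff_monomial, coeff_zero] at h1
  rw [Finset.sum_eq_single_of_mem r (by simp; omega)] at h1
  · simpa using h1
  · intro s hs hsr
    rw [if_neg]
    simp at hs
    omega

/-- The value `∑_{r ≤ n} u^{n-r} t^{(r)}` of a matrix polynomial of degree `n` at the scalar `u`. -/
def evalMatrix (n : ℕ) (t : Fin 2 → Fin 2 → ℕ → A) (u : k) (i j : Fin 2) : A :=
  ∑ r ∈ Finset.range (n + 1), u ^ (n - r) • t i j r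

/-- The defining relations of the Yangian in their recursive form
`[t_{ij}^{(r+1)}, t_{ml}^{(s)}] - [t_{ij}^{(r)}, t_{ml}^{(s+1)}]
  = t_{mj}^{(r)} t_{il}^{(s)} - t_{mj}^{(s)} t_{il}^{(r)}`. -/
def CoeffRTT (t : Fin 2 → Fin 2 → ℕ → A) : Prop :=
  ∀ i j m l r s, t i j (r + 1) * t m l s - t m l s * t i j (r + 1)
    - (t i j r * t m l (s + 1) - t m l (s + 1) * t i j r)
    - (t m j r * t i l s - t m j s * t i l r) = 0

/-- `t` is the coefficient sequence of a matrix polynomial that is monic of degree `n`. -/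
structure IsMonicSeq (n : ℕ) (t : Fin 2 → Fin 2 → ℕ → A) : Prop where
  zero : ∀ i j, t i j 0 = if i = j then 1 else 0
  of_lt : ∀ i j r, n < r → t i j r = 0

/-- Multiplying a polynomial by its variable shifts the coefficient sequence. -/
theorem smul_sum_pow_shift (n : ℕ) (u : k) (c : ℕ → A) (h0 : c 0 = 0) (hn : c (n + 1) = 0) :
    u • ∑ r ∈ Finset.range (n + 1), u ^ (n - r) • c r
      = ∑ r ∈ Finset.range (n + 1), u ^ (n - r) • c (r + 1) := by
  rw [Finset.sum_range_succ', h0, smul_zero, add_zero, Finset.sum_range_succ, hn, smul_zero,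
    add_zero, Finset.smul_sum]
  refine Finset.sum_congr rfl fun r hr => ?_
  rw [smul_smul, ← pow_succ']
  congr 2
  simp at hr
  omega

theorem IsMonicSeq.commute_zero {n : ℕ} {t : Fin 2 → Fin 2 → ℕ → A} (ht : IsMonicSeq n t)
    (i j : Fin 2) (x : A) : Commute (t i j 0) x := by
  rw [ht.zero]
  split_ifs
  · exact Commute.one_left x
  · exact Commute.zero_left x

theorem evalMatrix_mul (n : ℕ) (t : Fin 2 → Fin 2 → ℕ → A) (u v : k) (i j m l : Fin 2) :
    evalMatrix n t u i j * evalMatrix n t v m l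
      = ∑ r ∈ Finset.range (n + 1), ∑ s ∈ Finset.range (n + 1),
        u ^ (n - r) • v ^ (n - s) • (t i j r * t m l s) := by
  simp only [evalMatrix, Finset.sum_mul_sum, smul_mul_assoc, mul_smul_comm]
  exact Finset.sum_congr rfl fun r _ => Finset.sum_congr rfl fun s _ => smul_comm _ _ _

theorem evalMatrix_mul' (n : ℕ) (t : Fin 2 → Fin 2 → ℕ → A) (u v : k) (i j m l : Fin 2) :
    evalMatrix n t v m l * evalMatrix n t u i j
      = ∑ r ∈ Finset.range (n + 1), ∑ s ∈ Finset.range (n + 1),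
        u ^ (n - r) • v ^ (n - s) • (t m l s * t i j r) := by
  rw [evalMatrix_mul, Finset.sum_comm]
  exact Finset.sum_congr rfl fun r _ => Finset.sum_congr rfl fun s _ => smul_comm _ _ _

/-- The failure of the `RTT` relation for the values at `u` and `v`, as a polynomial in `u` and `v`
whose coefficients are the failures of the relations `CoeffRTT`. -/
theorem IsMonicSeq.rtt_defect {n : ℕ} {t : Fin 2 → Fin 2 → ℕ → A} (ht : IsMonicSeq n t)
    (u v : k) (i j m l : Fin 2) :
    (u - v) • (evalMatrix n t u i j * evalMatrix n t v m l
        - evalMatrix n t v m l * evalMatrix n t u i j)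
      - (evalMatrix n t u m j * evalMatrix n t v i l
        - evalMatrix n t v m j * evalMatrix n t u i l)
      = ∑ r ∈ Finset.range (n + 1), u ^ (n - r) • ∑ s ∈ Finset.range (n + 1), v ^ (n - s) •
        (t i j (r + 1) * t m l s - t m l s * t i j (r + 1)
          - (t i j r * t m l (s + 1) - t m l (s + 1) * t i j r)
          - (t m j r * t i l s - t m j s * t i l r)) := by
  have hu : u • ∑ r ∈ Finset.range (n + 1), u ^ (n - r) • ∑ s ∈ Finset.range (n + 1),
        v ^ (n - s) • (t i j r * t m l s - t m l s * t i j r)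
      = ∑ r ∈ Finset.range (n + 1), u ^ (n - r) • ∑ s ∈ Finset.range (n + 1),
        v ^ (n - s) • (t i j (r + 1) * t m l s - t m l s * t i j (r + 1)) := by
    refine smul_sum_pow_shift n u (fun r => ∑ s ∈ Finset.range (n + 1),
        v ^ (n - s) • (t i j r * t m l s - t m l s * t i j r)) ?_ ?_
    · exact Finset.sum_eq_zero fun s _ => by
        rw [(ht.commute_zero i j _).eq, sub_self, smul_zero]
    · exact Finset.sum_eq_zero fun s _ => by simp [ht.of_lt i j (n + 1) (Nat.lt_succ_self n)]
  have hv : v • ∑ r ∈ Finset.range (n + 1), u ^ (n - r) • ∑ s ∈ Finset.range (n + 1),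
        v ^ (n - s) • (t i j r * t m l s - t m l s * t i j r)
      = ∑ r ∈ Finset.range (n + 1), u ^ (n - r) • ∑ s ∈ Finset.range (n + 1),
        v ^ (n - s) • (t i j r * t m l (s + 1) - t m l (s + 1) * t i j r) := by
    rw [Finset.smul_sum]
    refine Finset.sum_congr rfl fun r _ => ?_
    rw [smul_comm]
    congr 1
    refine smul_sum_pow_shift n v (fun s => t i j r * t m l s - t m l s * t i j r) ?_ ?_
    · exact sub_eq_zero.2 (ht.commute_zero m l _).eq.symm
    · simp [ht.of_lt m l (n + 1) (Nat.lt_succ_self n)]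
  have e₁ : evalMatrix n t u i j * evalMatrix n t v m l
        - evalMatrix n t v m l * evalMatrix n t u i j
      = ∑ r ∈ Finset.range (n + 1), u ^ (n - r) • ∑ s ∈ Finset.range (n + 1),
        v ^ (n - s) • (t i j r * t m l s - t m l s * t i j r) := by
    rw [evalMatrix_mul, evalMatrix_mul']
    simp only [Finset.smul_sum, smul_sub, Finset.sum_sub_distrib]
  have e₂ : evalMatrix n t u m j * evalMatrix n t v i l
        - evalMatrix n t v m j * evalMatrix n t u i l
      = ∑ r ∈ Finset.range (n + 1), u ^ (n - r) • ∑ s ∈ Finset.range (n + 1),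
        v ^ (n - s) • (t m j r * t i l s - t m j s * t i l r) := by
    rw [evalMatrix_mul, evalMatrix_mul']
    simp only [Finset.smul_sum, smul_sub, Finset.sum_sub_distrib]
  rw [sub_smul, e₁, hu, hv, e₂, ← Finset.sum_sub_distrib, ← Finset.sum_sub_distrib]
  refine Finset.sum_congr rfl fun r _ => ?_
  rw [← smul_sub, ← smul_sub, ← Finset.sum_sub_distrib, ← Finset.sum_sub_distrib]
  simp only [smul_sub]

theorem CoeffRTT.rtt {n : ℕ} {t : Fin 2 → Fin 2 → ℕ → A} (h : CoeffRTT t) (ht : IsMonicSeq n t)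
    (u v : k) : RTT (u - v) (evalMatrix n t u) (evalMatrix n t v) := by
  intro i j m l
  rw [← sub_eq_zero, ht.rtt_defect]
  exact Finset.sum_eq_zero fun r _ => by
    rw [Finset.sum_eq_zero fun s _ => by rw [h i j m l r s, smul_zero], smul_zero]

theorem IsMonicSeq.coeffRTT [Infinite k] {n : ℕ} {t : Fin 2 → Fin 2 → ℕ → A}
    (ht : IsMonicSeq n t)
    (h : ∀ u v : k, RTT (u - v) (evalMatrix n t u) (evalMatrix n t v)) : CoeffRTT t := by
  intro i j m l r s
  rcases lt_or_ge n r with hr | hr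
  · simp [ht.of_lt _ _ r hr, ht.of_lt _ _ (r + 1) (hr.trans (Nat.lt_succ_self r))]
  rcases lt_or_ge n s with hs | hs
  · simp [ht.of_lt _ _ s hs, ht.of_lt _ _ (s + 1) (hs.trans (Nat.lt_succ_self s))]
  refine eq_zero_of_sum_pow_smul_eq_zero (Set.infinite_univ (α := k))
    (c := fun s => t i j (r + 1) * t m l s - t m l s * t i j (r + 1)
          - (t i j r * t m l (s + 1) - t m l (s + 1) * t i j r)
          - (t m j r * t i l s - t m j s * t i l r)) (fun v _ => ?_) hs
  refine eq_zero_of_sum_pow_smul_eq_zero (Set.infinite_univ (α := k))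
    (c := fun r => ∑ s ∈ Finset.range (n + 1), v ^ (n - s) •
        (t i j (r + 1) * t m l s - t m l s * t i j (r + 1)
          - (t i j r * t m l (s + 1) - t m l (s + 1) * t i j r)
          - (t m j r * t i l s - t m j s * t i l r))) (fun u _ => ?_) hr
  rw [← ht.rtt_defect, sub_eq_zero]
  exact h u v i j m l

/-- The explicit form of the commutators. -/
theorem CoeffRTT.commutator {n : ℕ} {t : Fin 2 → Fin 2 → ℕ → A} (h : CoeffRTT t)
    (ht : IsMonicSeq n t) (i j m l : Fin 2) (r s : ℕ) :
    t i j r * t m l s - t m l s * t i j r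
      = ∑ a ∈ Finset.Icc 1 (min r s),
        (t m j (a - 1) * t i l (r + s - a) - t m j (r + s - a) * t i l (a - 1)) := by
  induction r generalizing s with
  | zero => simp [(ht.commute_zero i j (t m l s)).eq]
  | succ r ih =>
    have h1 := h i j m l r s
    rw [sub_sub, sub_eq_zero] at h1
    rw [h1, ih (s + 1)]
    have hrs : ∀ a, r + 1 + s - a = r + (s + 1) - a := fun a => by omega
    simp only [hrs]
    rcases lt_trichotomy r s with hlt | rfl | hgt
    · rw [min_eq_left (show r ≤ s + 1 by omega), min_eq_left (show r + 1 ≤ s by omega),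
        Finset.sum_Icc_succ_top (by omega)]
      congr 1
      rw [show r + 1 - 1 = r by omega, show r + (s + 1) - (r + 1) = s by omega]
    · simp
    · rw [min_eq_right (show s + 1 ≤ r by omega), min_eq_right (show s ≤ r + 1 by omega),
        Finset.sum_Icc_succ_top (by omega)]
      rw [show s + 1 - 1 = s by omega, show r + (s + 1) - (s + 1) = r by omega]
      abel

/-- Conversely, the explicit commutators imply the recursive form of the relations. -/
theorem coeffRTT_of_commutator {t : Fin 2 → Fin 2 → ℕ → A}
    (h : ∀ i j m l r s, t i j r * t m l s - t m l s * t i j r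
      = ∑ a ∈ Finset.Icc 1 (min r s),
        (t m j (a - 1) * t i l (r + s - a) - t m j (r + s - a) * t i l (a - 1))) :
    CoeffRTT t := by
  intro i j m l r s
  rw [h i j m l (r + 1) s, h i j m l r (s + 1)]
  have hrs : ∀ a, r + 1 + s - a = r + (s + 1) - a := fun a => by omega
  simp only [hrs]
  rcases lt_trichotomy r s with hlt | rfl | hgt
  · rw [min_eq_left (show r ≤ s + 1 by omega), min_eq_left (show r + 1 ≤ s by omega),
      Finset.sum_Icc_succ_top (by omega)]
    rw [show r + 1 - 1 = r by omega, show r + (s + 1) - (r + 1) = s by omega]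
    abel
  · simp
  · rw [min_eq_right (show s + 1 ≤ r by omega), min_eq_right (show s ≤ r + 1 by omega),
      Finset.sum_Icc_succ_top (by omega)]
    rw [show s + 1 - 1 = s by omega, show r + (s + 1) - (s + 1) = r by omega]
    abel

end Evaluation

/-! ### Evaluation of polynomials at scalars -/

section ScalarEval

variable {k : Type*} {A : Type*} [Field k] [Ring A] [Algebra k A]

/-- Evaluation of a polynomial with coefficients in a noncommutative algebra at a scalar. -/
def scalarEval (u : k) : A[X] →+* A :=
  eval₂RingHom' (RingHom.id A) (algebraMap k A u) fun a => (Algebra.commutes u a).symm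

theorem scalarEval_apply (u : k) (f : A[X]) : scalarEval u f = f.eval (algebraMap k A u) := rfl

theorem scalarEval_comp (u : k) (f : A[X]) :
    scalarEval u (f.comp (X - 1)) = scalarEval (u - 1) f := by
  have h1 : scalarEval u (X - 1 : A[X]) = algebraMap k A (u - 1) := by
    rw [map_sub, map_one, map_sub, map_one, scalarEval_apply, eval_X]
  have h2 : (scalarEval u : A[X] →+* A).comp C = RingHom.id A := by
    ext a
    simp [scalarEval_apply]
  rw [comp, hom_eval₂, h1, h2]
  rfl

theorem scalarEval_eq_sum {n : ℕ} (u : k) (f : A[X]) (hf : f.natDegree ≤ n) :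
    scalarEval u f = ∑ r ∈ Finset.range (n + 1), u ^ (n - r) • f.coeff (n - r) := by
  rw [scalarEval_apply, eval_eq_sum_range' (Nat.lt_succ_of_le hf),
    ← Finset.sum_range_reflect _ (n + 1)]
  refine Finset.sum_congr rfl fun r hr => ?_
  rw [← map_pow, ← Algebra.commutes, Algebra.smul_def]
  congr 3

/-- If infinitely many values of a polynomial commute with `x`, so do its coefficients. -/
theorem commute_coeff_of_infinite {f : A[X]} {x : A} {S : Set k} (hS : S.Infinite)
    (h : ∀ u ∈ S, Commute (scalarEval u f) x) (m : ℕ) : Commute (f.coeff m) x := by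
  rcases lt_or_ge f.natDegree m with hm | hm
  · rw [coeff_eq_zero_of_natDegree_lt hm]
    exact Commute.zero_left x
  have := eq_zero_of_sum_pow_smul_eq_zero (n := f.natDegree)
    (c := fun r => f.coeff (f.natDegree - r) * x - x * f.coeff (f.natDegree - r)) hS
    (fun u hu => by
      have h1 := h u hu
      rw [scalarEval_eq_sum u f le_rfl] at h1
      have h2 := sub_eq_zero.2 h1.eq
      rw [Finset.sum_mul, Finset.mul_sum, ← Finset.sum_sub_distrib] at h2
      simpa only [smul_mul_assoc, mul_smul_comm, ← smul_sub] using h2)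
    (Nat.sub_le f.natDegree m)
  simp only [Nat.sub_sub_self hm] at this
  exact sub_eq_zero.1 this

end ScalarEval

/-! ### Presentation of the Yangian and commutativity of Γ -/

section Yangian

variable (𝕜 : Type u) [Field 𝕜] (p : ℕ)

theorem yangianT_zero (i j : Fin 2) : yangianT 𝕜 p i j 0 = if i = j then 1 else 0 := by
  rw [yangianT, freeT]
  split_ifs <;> simp

theorem yangianT_of_lt (i j : Fin 2) (r : ℕ) (hr : p < r) : yangianT 𝕜 p i j r = 0 := by
  obtain ⟨r, rfl⟩ := Nat.exists_eq_succ_of_ne_zero (by omega : r ≠ 0)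
  rw [yangianT, freeT, dif_neg (by omega), map_zero]

theorem yangianT_isMonicSeq : IsMonicSeq p (yangianT 𝕜 p) :=
  ⟨yangianT_zero 𝕜 p, yangianT_of_lt 𝕜 p⟩

theorem yangianT_coeffRTT : CoeffRTT (yangianT 𝕜 p) := by
  refine coeffRTT_of_commutator fun i j m l r s => ?_
  rcases Nat.eq_zero_or_pos r with rfl | hr
  · simp [((yangianT_isMonicSeq 𝕜 p).commute_zero i j _).eq]
  rcases Nat.eq_zero_or_pos s with rfl | hs
  · simp [((yangianT_isMonicSeq 𝕜 p).commute_zero m l _).eq]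
  rcases lt_or_ge p r with hrp | hrp
  · rw [yangianT_of_lt 𝕜 p i j r hrp, zero_mul, mul_zero, sub_zero, Finset.sum_eq_zero]
    intro a ha
    simp only [Finset.mem_Icc, le_min_iff] at ha
    rw [yangianT_of_lt 𝕜 p i l (r + s - a) (by omega),
      yangianT_of_lt 𝕜 p m j (r + s - a) (by omega), mul_zero, zero_mul, sub_zero]
  rcases lt_or_ge p s with hsp | hsp
  · rw [yangianT_of_lt 𝕜 p m l s hsp, zero_mul, mul_zero, sub_zero, Finset.sum_eq_zero]
    intro a ha
    simp only [Finset.mem_Icc, le_min_iff] at ha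
    rw [yangianT_of_lt 𝕜 p i l (r + s - a) (by omega),
      yangianT_of_lt 𝕜 p m j (r + s - a) (by omega), mul_zero, zero_mul, sub_zero]
  have := RingQuot.mkAlgHom_rel 𝕜 (YangianRel.comm (𝕜 := 𝕜) (p := p) i j m l r s hr hrp hs hsp)
  change LevelYangian.mk 𝕜 p _ = LevelYangian.mk 𝕜 p _ at this
  simp only [map_sub, map_mul, map_sum] at this
  exact this

variable {𝕜 p} in
/-- The universal property of the Yangian of level `p`. -/
theorem exists_lift_of_coeffRTT {B : Type*} [Ring B] [Algebra 𝕜 B] {t : Fin 2 → Fin 2 → ℕ → B}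
    (ht : IsMonicSeq p t) (h : CoeffRTT t) :
    ∃ ρ : LevelYangian 𝕜 p →ₐ[𝕜] B, ∀ i j r, ρ (yangianT 𝕜 p i j r) = t i j r := by
  let f : FreeAlgebra 𝕜 (Fin 2 × Fin 2 × Fin p) →ₐ[𝕜] B :=
    FreeAlgebra.lift 𝕜 fun x => t x.1 x.2.1 (x.2.2 + 1)
  have hf : ∀ i j r, f (freeT 𝕜 p i j r) = t i j r := by
    intro i j r
    cases r with
    | zero =>
      rw [freeT, ht.zero]
      split_ifs <;> simp
    | succ r =>
      rw [freeT]
      split_ifs with hr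
      · simp [f]
      · rw [map_zero, ht.of_lt _ _ _ (by omega)]
  have hrel : ∀ ⦃x y⦄, YangianRel 𝕜 p x y → f x = f y := by
    rintro _ _ ⟨i, j, m, l, r, s, -, -, -, -⟩
    simp only [map_sub, map_mul, map_sum, hf]
    exact h.commutator ht i j m l r s
  refine ⟨RingQuot.liftAlgHom 𝕜 ⟨f, hrel⟩, fun i j r => ?_⟩
  rw [← hf]
  exact RingQuot.liftAlgHom_mkAlgHom_apply 𝕜 f hrel _

theorem yangianTPoly_coeff (i j : Fin 2) (m : ℕ) :
    (yangianTPoly 𝕜 p i j).coeff m = if m ≤ p then yangianT 𝕜 p i j (p - m) else 0 := by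
  have hsum : (∑ a ∈ Finset.Icc 1 p, C (yangianT 𝕜 p i j a) * X ^ (p - a)).coeff m
      = if m < p then yangianT 𝕜 p i j (p - m) else 0 := by
    simp only [finsetSum_coeff, coeff_C_mul, coeff_X_pow]
    split_ifs with hm
    · rw [Finset.sum_eq_single_of_mem (p - m) (by simp; omega)]
      · rw [if_pos (by omega), mul_one]
      · intro b hb hbm
        rw [if_neg, mul_zero]
        simp at hb
        omega
    · refine Finset.sum_eq_zero fun b hb => ?_
      rw [if_neg, mul_zero]
      simp at hb
      omega
  rw [yangianTPoly, coeff_add, hsum]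
  rcases lt_trichotomy m p with h | rfl | h
  · rw [if_pos h, if_pos h.le]
    split_ifs <;> simp [coeff_X_pow, h.ne]
  · rw [if_neg (lt_irrefl _), if_pos le_rfl, Nat.sub_self, yangianT_zero]
    split_ifs <;> simp
  · rw [if_neg h.not_gt, if_neg h.not_ge]
    split_ifs <;> simp [coeff_X_pow, h.ne']

theorem yangianTPoly_natDegree_le (i j : Fin 2) : (yangianTPoly 𝕜 p i j).natDegree ≤ p := by
  refine natDegree_le_iff_coeff_eq_zero.2 fun m hm => ?_
  rw [yangianTPoly_coeff, if_neg (by omega)]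

theorem scalarEval_yangianTPoly (u : 𝕜) (i j : Fin 2) :
    scalarEval u (yangianTPoly 𝕜 p i j) = evalMatrix p (yangianT 𝕜 p) u i j := by
  rw [scalarEval_eq_sum u _ (yangianTPoly_natDegree_le 𝕜 p i j), evalMatrix]
  refine Finset.sum_congr rfl fun r hr => ?_
  rw [yangianTPoly_coeff, if_pos (Nat.sub_le _ _), Nat.sub_sub_self]
  simp at hr
  omega

theorem scalarEval_quantumDet (u : 𝕜) :
    scalarEval u (quantumDet 𝕜 p)
      = evalMatrix p (yangianT 𝕜 p) u 0 0 * evalMatrix p (yangianT 𝕜 p) (u - 1) 1 1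
        - evalMatrix p (yangianT 𝕜 p) u 1 0 * evalMatrix p (yangianT 𝕜 p) (u - 1) 0 1 := by
  simp only [quantumDet, map_sub, map_mul, scalarEval_comp, scalarEval_yangianTPoly]

variable {𝕜 p} in
/-- An element commuting with the generators `t_{ij}^{(r)}` is central. -/
theorem commute_of_forall_yangianT {x : LevelYangian 𝕜 p}
    (h : ∀ i j r, Commute x (yangianT 𝕜 p i j r)) (y : LevelYangian 𝕜 p) : Commute x y := by
  obtain ⟨y, rfl⟩ := RingQuot.mkAlgHom_surjective 𝕜 (YangianRel 𝕜 p) y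
  change Commute x (LevelYangian.mk 𝕜 p y)
  induction y using FreeAlgebra.induction with
  | grade0 a =>
    rw [AlgHom.commutes]
    exact (Algebra.commutes a x).symm
  | grade1 a =>
    have := h a.1 a.2.1 (a.2.2 + 1)
    rwa [yangianT, freeT, dif_pos a.2.2.2] at this
  | mul a b ha hb => rw [map_mul]; exact ha.mul_right hb
  | add a b ha hb => rw [map_add]; exact ha.add_right hb

theorem commute_yangianT_of_scalarEval {x : LevelYangian 𝕜 p} {i j : Fin 2} {S : Set 𝕜}
    (hS : S.Infinite) (h : ∀ u ∈ S, Commute (evalMatrix p (yangianT 𝕜 p) u i j) x) (r : ℕ) :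
    Commute (yangianT 𝕜 p i j r) x := by
  rcases lt_or_ge p r with hr | hr
  · rw [yangianT_of_lt 𝕜 p i j r hr]
    exact Commute.zero_left x
  have := commute_coeff_of_infinite (f := yangianTPoly 𝕜 p i j) (x := x) hS
    (fun u hu => by rw [scalarEval_yangianTPoly]; exact h u hu) (p - r)
  rwa [yangianTPoly_coeff, if_pos (Nat.sub_le _ _), Nat.sub_sub_self hr] at this

variable [CharZero 𝕜]

theorem quantumDet_coeff_commute_yangianT (m : ℕ) (i j : Fin 2) (r : ℕ) :
    Commute ((quantumDet 𝕜 p).coeff m) (yangianT 𝕜 p i j r) := by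
  refine (commute_yangianT_of_scalarEval 𝕜 p (Set.infinite_univ (α := 𝕜)) (fun v _ => ?_) r).symm
  have hS : ({v, v + 2}ᶜ : Set 𝕜).Infinite := (Set.toFinite {v, v + 2}).infinite_compl
  refine (commute_coeff_of_infinite hS (fun u hu => ?_) m).symm
  have hT := yangianT_coeffRTT 𝕜 p
  have hM := yangianT_isMonicSeq 𝕜 p
  have h1 := hT.rtt hM u (u - 1)
  have h2 := hT.rtt hM (u - 1) v
  rw [show u - (u - 1) = 1 by ring] at h1
  rw [show u - 1 - v = u - v - 1 by ring] at h2
  have h3 := RTT.quantumDet_comm h1 (hT.rtt hM u v) h2 i j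
  rw [scalarEval_quantumDet]
  refine smul_right_injective _ (r := (u - v) * (u - v - 2)) (mul_ne_zero ?_ ?_) h3
  · intro h
    exact hu (Or.inl (sub_eq_zero.1 h))
  · intro h
    exact hu (Or.inr (by rw [Set.mem_singleton_iff]; linear_combination h))

theorem yangianT_commute_same (i j : Fin 2) (r s : ℕ) :
    Commute (yangianT 𝕜 p i j r) (yangianT 𝕜 p i j s) := by
  refine (commute_yangianT_of_scalarEval 𝕜 p (Set.infinite_univ (α := 𝕜)) (fun v _ => ?_) s).symm
  have hS : ({v + 1}ᶜ : Set 𝕜).Infinite := (Set.toFinite {v + 1}).infinite_compl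
  refine (commute_yangianT_of_scalarEval 𝕜 p hS (fun u hu => ?_) r).symm
  have h := (yangianT_coeffRTT 𝕜 p).rtt (yangianT_isMonicSeq 𝕜 p) u v i j i j
  refine sub_eq_zero.1 (smul_right_injective _ (r := u - v - 1) ?_ (?_ : _ • _ = _ • _))
  · intro h'
    exact hu (by rw [Set.mem_singleton_iff]; linear_combination h')
  · have h' : evalMatrix p (yangianT 𝕜 p) u i j * evalMatrix p (yangianT 𝕜 p) v i j
        - evalMatrix p (yangianT 𝕜 p) v i j * evalMatrix p (yangianT 𝕜 p) u i j
      = (u - v) • (evalMatrix p (yangianT 𝕜 p) u i j * evalMatrix p (yangianT 𝕜 p) v i j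
        - evalMatrix p (yangianT 𝕜 p) v i j * evalMatrix p (yangianT 𝕜 p) u i j) := h.symm
    rw [sub_smul _ (1 : 𝕜), ← h', one_smul, sub_self, smul_zero]

theorem quantumDet_coeff_central (m : ℕ) (y : LevelYangian 𝕜 p) :
    Commute ((quantumDet 𝕜 p).coeff m) y :=
  commute_of_forall_yangianT (fun i j r => quantumDet_coeff_commute_yangianT 𝕜 p m i j r) y

theorem yangianGamma_generators_commute :
    ∀ a ∈ Set.range (quantumDet 𝕜 p).coeff ∪ Set.range (yangianTPoly 𝕜 p 1 1).coeff,
    ∀ b ∈ Set.range (quantumDet 𝕜 p).coeff ∪ Set.range (yangianTPoly 𝕜 p 1 1).coeff,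
      a * b = b * a := by
  rintro _ (⟨m, rfl⟩ | ⟨m, rfl⟩) b hb
  · exact quantumDet_coeff_central 𝕜 p m b
  · rcases hb with ⟨n, rfl⟩ | ⟨n, rfl⟩
    · exact (quantumDet_coeff_central 𝕜 p n _).symm
    · simp only [yangianTPoly_coeff]
      split_ifs
      · exact yangianT_commute_same 𝕜 p 1 1 _ _
      all_goals simp

theorem yangianGamma_commutative :
    ∀ x ∈ yangianGamma 𝕜 p, ∀ y ∈ yangianGamma 𝕜 p, x * y = y * x := by
  intro x hx y hy
  have := Algebra.isMulCommutative_adjoin 𝕜 (yangianGamma_generators_commute 𝕜 p)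
  exact congrArg Subtype.val (this.is_comm.comm (⟨x, hx⟩ : Algebra.adjoin 𝕜 _) ⟨y, hy⟩)

end Yangian

/-! ### Tensor products of evaluation representations -/

section ProductOfSites

variable {k : Type*} {A : Type*} [Field k] [Ring A] [Algebra k A]

/-- The coefficients of the matrix polynomial `(u + E₀)(u + E₁)⋯(u + Eₙ₋₁)`. -/
def siteProduct (E : ℕ → Fin 2 → Fin 2 → A) : ℕ → Fin 2 → Fin 2 → ℕ → A
  | 0, i, j, 0 => if i = j then 1 else 0
  | 0, _, _, _ + 1 => 0
  | _ + 1, i, j, 0 => if i = j then 1 else 0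
  | n + 1, i, j, r + 1 =>
    siteProduct E n i j (r + 1) + ∑ m, siteProduct E n i m r * E n m j

theorem siteProduct_isMonicSeq (E : ℕ → Fin 2 → Fin 2 → A) (n : ℕ) :
    IsMonicSeq n (siteProduct E n) where
  zero i j := by cases n <;> rfl
  of_lt i j r hr := by
    induction n generalizing i j r with
    | zero =>
      obtain ⟨r, rfl⟩ := Nat.exists_eq_succ_of_ne_zero hr.ne'
      rfl
    | succ n ih =>
      obtain ⟨r, rfl⟩ := Nat.exists_eq_succ_of_ne_zero (by omega : r ≠ 0)
      rw [siteProduct, ih i j (r + 1) (by omega), zero_add]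
      exact Finset.sum_eq_zero fun m _ => by rw [ih i m r (by omega), zero_mul]

theorem evalMatrix_siteProduct_zero (E : ℕ → Fin 2 → Fin 2 → A) (u : k) (i j : Fin 2) :
    evalMatrix 0 (siteProduct E 0) u i j = if i = j then 1 else 0 := by
  simp [evalMatrix, siteProduct]

theorem evalMatrix_siteProduct_succ (E : ℕ → Fin 2 → Fin 2 → A) (n : ℕ) (u : k) (i j : Fin 2) :
    evalMatrix (n + 1) (siteProduct E (n + 1)) u i j
      = ∑ m, evalMatrix n (siteProduct E n) u i m * ((if m = j then u • 1 else 0) + E n m j) := by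
  have h1 : ∑ m, evalMatrix n (siteProduct E n) u i m * (if m = j then u • (1 : A) else 0)
      = u • evalMatrix n (siteProduct E n) u i j := by simp
  have h2 : ∑ m, evalMatrix n (siteProduct E n) u i m * E n m j
      = ∑ r ∈ Finset.range (n + 1), u ^ (n - r) • ∑ m, siteProduct E n i m r * E n m j := by
    simp only [evalMatrix, Finset.sum_mul, Finset.smul_sum, smul_mul_assoc]
    rw [Finset.sum_comm]
  simp only [mul_add, Finset.sum_add_distrib]
  rw [h1, h2, evalMatrix, Finset.sum_range_succ']
  simp only [siteProduct, Nat.add_sub_add_right, smul_add, Finset.sum_add_distrib]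
  rw [add_right_comm]
  congr 1
  conv_rhs => rw [evalMatrix, Finset.sum_range_succ', smul_add, Finset.smul_sum]
  rw [Finset.sum_range_succ,
    (siteProduct_isMonicSeq E n).of_lt i j (n + 1) (Nat.lt_succ_self n), smul_zero, add_zero,
    (siteProduct_isMonicSeq E n).zero, smul_smul]
  congr 1
  · refine Finset.sum_congr rfl fun r hr => ?_
    rw [smul_smul, ← pow_succ']
    congr 2
    simp at hr
    omega
  · rw [← pow_succ']
    congr 2

theorem siteProduct_commute {E : ℕ → Fin 2 → Fin 2 → A}
    (hc : ∀ a b, a ≠ b → ∀ i j m l, Commute (E a i j) (E b m l)) (n : ℕ) (i j : Fin 2) (r : ℕ)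
    {b : ℕ} (hb : n ≤ b) (m l : Fin 2) : Commute (siteProduct E n i j r) (E b m l) := by
  induction n generalizing i j r with
  | zero =>
    cases r with
    | zero => exact (siteProduct_isMonicSeq E 0).commute_zero i j _
    | succ r => exact Commute.zero_left _
  | succ n ih =>
    cases r with
    | zero => exact (siteProduct_isMonicSeq E (n + 1)).commute_zero i j _
    | succ r =>
      rw [siteProduct]
      refine (ih i j (r + 1) (by omega)).add_left (Commute.sum_left _ _ _ fun a _ => ?_)
      exact (ih i a r (by omega)).mul_left (hc n b (by omega) _ _ _ _)

/-- Products of commuting copies of the evaluation representation `T(u) = u + E` of the Yangian,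
where the `E_{ij}` satisfy the relations of `gl₂`. -/
theorem siteProduct_coeffRTT [Infinite k] {E : ℕ → Fin 2 → Fin 2 → A}
    (hc : ∀ a b, a ≠ b → ∀ i j m l, Commute (E a i j) (E b m l))
    (hE : ∀ a i j m l, E a i j * E a m l - E a m l * E a i j
      = (if m = j then E a i l else 0) - (if i = l then E a m j else 0)) (n : ℕ) :
    CoeffRTT (siteProduct E n) := by
  have hcomm : ∀ (n : ℕ) (u v : k) (i j m l : Fin 2),
      Commute ((if i = j then u • 1 else 0) + E n i j) (evalMatrix n (siteProduct E n) v m l) := by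
    intro n u v i j m l
    refine Commute.add_left ?_ ?_
    · split_ifs
      · exact (Commute.one_left _).smul_left u
      · exact Commute.zero_left _
    · exact Commute.sum_right _ _ _ fun r _ =>
        ((siteProduct_commute hc n m l r le_rfl i j).symm.smul_right _)
  refine (siteProduct_isMonicSeq E n).coeffRTT (k := k) fun u v => ?_
  induction n with
  | zero =>
    intro i j m l
    simp only [evalMatrix_siteProduct_zero]
    split_ifs <;> simp
  | succ n ih =>
    have h : ∀ u : k, evalMatrix (n + 1) (siteProduct E (n + 1)) u = fun i j =>
        ∑ m, evalMatrix n (siteProduct E n) u i m * ((if m = j then u • 1 else 0) + E n m j) :=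
      fun u => funext fun i => funext fun j => evalMatrix_siteProduct_succ E n u i j
    rw [h, h]
    refine ih.mul ?_ (fun i j m l => hcomm n u v i j m l) (fun i j m l => hcomm n v u i j m l)
    intro i j m l
    have e := hE n i j m l
    have e' : ((if i = j then u • 1 else 0) + E n i j) * ((if m = l then v • 1 else 0) + E n m l)
        - ((if m = l then v • 1 else 0) + E n m l) * ((if i = j then u • 1 else 0) + E n i j)
        = (if m = j then E n i l else 0) - (if i = l then E n m j else 0) := by
      rw [← e]
      split_ifs <;> simp only [add_mul, mul_add, smul_mul_assoc, mul_smul_comm, one_mul, mul_one,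
        zero_mul, mul_zero] <;> module
    rw [e']
    by_cases h₁ : m = j <;> by_cases h₂ : i = l <;>
      simp only [h₁, h₂, if_true, if_false, add_mul, mul_add, smul_mul_assoc, mul_smul_comm,
        one_mul, mul_one, zero_mul, mul_zero] <;> module

end ProductOfSites

/-! ### An oscillator realization with spectral shift -/

section Oscillators

open MvPolynomial

variable {k : Type*} [Field k]

/-- Multiplication by the variable `x_a` on `ℤ`-indexed families of polynomials. -/
def coordOp {τ : Type*} (a : τ) : Module.End k (ℤ → MvPolynomial τ k) where
  toFun v n := MvPolynomial.X a * v n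
  map_add' v w := by ext1 n; simp [mul_add]
  map_smul' c v := by ext1 n; simp

/-- The operator `∂_a + ξ_a λ^{N_a}`, where `λ` shifts the index of a `ℤ`-indexed family of
polynomials. -/
def momentumOp {τ : Type*} (ξ : τ → k) (N : τ → ℤ) (a : τ) :
    Module.End k (ℤ → MvPolynomial τ k) where
  toFun v n := pderiv a (v n) + ξ a • v (n - N a)
  map_add' v w := by ext1 n; simp only [Pi.add_apply, map_add, smul_add]; abel
  map_smul' c v := by
    ext1 n
    simp only [Pi.smul_apply, Derivation.map_smul, RingHom.id_apply, smul_add, smul_comm c]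

variable {τ : Type*} (ξ : τ → k) (N : τ → ℤ)

theorem coordOp_commute (a b : τ) : Commute (coordOp (k := k) a) (coordOp (k := k) b) := by
  refine LinearMap.ext fun v => funext fun n => ?_
  simp only [Module.End.mul_apply, coordOp, LinearMap.coe_mk, AddHom.coe_mk]
  ring

theorem momentumOp_commute (a b : τ) : Commute (momentumOp ξ N a) (momentumOp ξ N b) := by
  refine LinearMap.ext fun v => funext fun n => ?_
  simp only [Module.End.mul_apply, momentumOp, LinearMap.coe_mk, AddHom.coe_mk, map_add,
    Derivation.map_smul, smul_add]
  have h : pderiv a (pderiv b (v n)) = pderiv b (pderiv a (v n)) := by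
    classical
    have : ⁅(pderiv a : Derivation k (MvPolynomial τ k) _), (pderiv b : Derivation k _ _)⁆ = 0 := by
      refine MvPolynomial.derivation_ext fun i => ?_
      simp only [Derivation.commutator_apply, pderiv_X, Derivation.coe_zero, Pi.zero_apply,
        Pi.single_apply]
      split_ifs <;> simp
    have h := congrArg (fun d => d (v n)) this
    simpa [Derivation.commutator_apply, sub_eq_zero] using h
  rw [h, smul_comm (ξ a), sub_right_comm]
  abel

theorem momentumOp_mul_coordOp [DecidableEq τ] (a b : τ) :
    momentumOp ξ N a * coordOp b = coordOp b * momentumOp ξ N a + if a = b then 1 else 0 := by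
  refine LinearMap.ext fun v => funext fun n => ?_
  have h : ((if a = b then 1 else 0 : Module.End k (ℤ → MvPolynomial τ k)) v) n
      = if a = b then v n else 0 := by split_ifs <;> rfl
  rw [LinearMap.add_apply, Pi.add_apply, h]
  simp only [Module.End.mul_apply, coordOp, momentumOp, LinearMap.coe_mk, AddHom.coe_mk,
    Derivation.leibniz, pderiv_X, smul_eq_mul, Pi.single_apply, eq_comm (a := b)]
  split_ifs <;> simp [mul_add]; ring

/-- The operators `E_{ij} = ∑_m x_{im} D_{jm}` on site `s`, with `D` the momentum operators. -/
def siteOp (ξ : ℕ × Fin 2 × Fin 2 → k) (N : ℕ × Fin 2 × Fin 2 → ℤ) (s : ℕ) (i j : Fin 2) :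
    Module.End k (ℤ → MvPolynomial (ℕ × Fin 2 × Fin 2) k) :=
  ∑ m, coordOp (s, i, m) * momentumOp ξ N (s, j, m)

variable (ξ : ℕ × Fin 2 × Fin 2 → k) (N : ℕ × Fin 2 × Fin 2 → ℤ)

theorem siteOp_commute (a b : ℕ) (hab : a ≠ b) (i j m l : Fin 2) :
    Commute (siteOp ξ N a i j) (siteOp ξ N b m l) := by
  have h : ∀ a b : ℕ, a ≠ b → ∀ i m j l,
      Commute (momentumOp ξ N (a, i, m)) (coordOp (k := k) (b, j, l)) := by
    intro a b hab i m j l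
    have := momentumOp_mul_coordOp ξ N (a, i, m) (b, j, l)
    rwa [if_neg (by simp [hab]), add_zero] at this
  refine Commute.sum_left _ _ _ fun c _ => Commute.sum_right _ _ _ fun d _ => ?_
  exact ((coordOp_commute _ _).mul_right (h b a hab.symm _ _ _ _).symm).mul_left
    ((h a b hab _ _ _ _).mul_right (momentumOp_commute ξ N _ _))

theorem siteOp_commutator (a : ℕ) (i j m l : Fin 2) :
    siteOp ξ N a i j * siteOp ξ N a m l - siteOp ξ N a m l * siteOp ξ N a i j
      = (if m = j then siteOp ξ N a i l else 0) - (if i = l then siteOp ξ N a m j else 0) := by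
  have key : ∀ i j m l, siteOp ξ N a i j * siteOp ξ N a m l
      = (∑ c, ∑ d, coordOp (a, i, c) * coordOp (a, m, d) * momentumOp ξ N (a, j, c)
          * momentumOp ξ N (a, l, d)) + if m = j then siteOp ξ N a i l else 0 := by
    intro i j m l
    have h : ∀ c d, coordOp (a, i, c) * momentumOp ξ N (a, j, c)
          * (coordOp (a, m, d) * momentumOp ξ N (a, l, d))
        = coordOp (a, i, c) * coordOp (a, m, d) * momentumOp ξ N (a, j, c)
          * momentumOp ξ N (a, l, d)
          + if m = j ∧ c = d then coordOp (a, i, c) * momentumOp ξ N (a, l, d) else 0 := by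
      intro c d
      have e : ∀ x y z w : Module.End k (ℤ → MvPolynomial (ℕ × Fin 2 × Fin 2) k),
        x * y * (z * w) = x * (y * z) * w := fun x y z w => by simp only [mul_assoc]
      rw [e, momentumOp_mul_coordOp, mul_add, add_mul, ← mul_assoc]
      congr 1
      by_cases h : m = j ∧ c = d
      · rw [if_pos h, if_pos (by rw [h.1, h.2]), mul_one]
      · rw [if_neg h, if_neg (by simpa [eq_comm (a := j)] using h), mul_zero, zero_mul]
    simp only [siteOp, Finset.sum_mul_sum, h, Finset.sum_add_distrib]
    congr 1
    by_cases hmj : m = j <;> simp [hmj]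
  have hsymm : (∑ c, ∑ d, coordOp (a, i, c) * coordOp (a, m, d) * momentumOp ξ N (a, j, c)
          * momentumOp ξ N (a, l, d))
      = ∑ c, ∑ d, coordOp (a, m, c) * coordOp (a, i, d) * momentumOp ξ N (a, l, c)
          * momentumOp ξ N (a, j, d) := by
    rw [Finset.sum_comm]
    refine Finset.sum_congr rfl fun c _ => Finset.sum_congr rfl fun d _ => ?_
    rw [(coordOp_commute (k := k) (a, i, d) (a, m, c)).eq, mul_assoc _ (momentumOp ξ N (a, j, d)),
      (momentumOp_commute ξ N (a, j, d) (a, l, c)).eq, ← mul_assoc]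
  rw [key i j m l, key m l i j, hsymm]
  abel

end Oscillators

/-! ### Leading symbols of operators -/

section LeadingSymbol

variable {k : Type*} [Field k] {τ : Type*}

/-- The operator `T` on `ℤ`-indexed families of polynomials raises the degree by at most `d`, and
its component of degree `d` is multiplication by `g`. -/
def HasSymbol (T : Module.End k (ℤ → MvPolynomial τ k)) (d : ℤ) (g : MvPolynomial τ k) : Prop :=
  ∀ (v : ℤ → MvPolynomial τ k) (n : ℤ), (∀ m, n < m → v m = 0) →
    (∀ m, n + d < m → T v m = 0) ∧ T v (n + d) = g * v n

variable {T T' : Module.End k (ℤ → MvPolynomial τ k)} {d d' : ℤ} {g g' : MvPolynomial τ k}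

theorem HasSymbol.one : HasSymbol (1 : Module.End k (ℤ → MvPolynomial τ k)) 0 1 := by
  intro v n hv
  simpa using hv

theorem HasSymbol.zero (d : ℤ) : HasSymbol (0 : Module.End k (ℤ → MvPolynomial τ k)) d 0 := by
  intro v n _
  simp

theorem HasSymbol.mul (h : HasSymbol T d g) (h' : HasSymbol T' d' g') :
    HasSymbol (T * T') (d + d') (g * g') := by
  intro v n hv
  obtain ⟨h₁, h₂⟩ := h' v n hv
  obtain ⟨h₃, h₄⟩ := h (T' v) (n + d') h₁
  rw [add_comm d, ← add_assoc]
  exact ⟨h₃, by rw [Module.End.mul_apply, h₄, h₂, mul_assoc]⟩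

theorem HasSymbol.add (h : HasSymbol T d g) (h' : HasSymbol T' d g') :
    HasSymbol (T + T') d (g + g') := by
  intro v n hv
  obtain ⟨h₁, h₂⟩ := h v n hv
  obtain ⟨h₃, h₄⟩ := h' v n hv
  refine ⟨fun m hm => ?_, ?_⟩
  · rw [LinearMap.add_apply, Pi.add_apply, h₁ m hm, h₃ m hm, add_zero]
  · rw [LinearMap.add_apply, Pi.add_apply, h₂, h₄, add_mul]

theorem HasSymbol.of_lt (h : HasSymbol T d g) (hd : d < d') : HasSymbol T d' 0 := by
  intro v n hv
  obtain ⟨h₁, -⟩ := h v n hv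
  exact ⟨fun m hm => h₁ m (by omega), by rw [h₁ _ (by omega), zero_mul]⟩

theorem HasSymbol.sum {ι : Type*} (s : Finset ι) {T : ι → Module.End k (ℤ → MvPolynomial τ k)}
    {g : ι → MvPolynomial τ k} (h : ∀ i ∈ s, HasSymbol (T i) d (g i)) :
    HasSymbol (∑ i ∈ s, T i) d (∑ i ∈ s, g i) := by
  classical
  induction s using Finset.induction_on with
  | empty => exact HasSymbol.zero d
  | insert a s ha ih =>
    rw [Finset.sum_insert ha, Finset.sum_insert ha]
    exact (h a (Finset.mem_insert_self a s)).add
      (ih fun i hi => h i (Finset.mem_insert_of_mem hi))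

theorem HasSymbol.list_prod {ι : Type*} {T : ι → Module.End k (ℤ → MvPolynomial τ k)} {w : ι → ℕ}
    {g : ι → MvPolynomial τ k} (h : ∀ i, HasSymbol (T i) (w i) (g i)) (l : List ι) :
    HasSymbol (l.map T).prod ((l.map w).sum : ℕ) (l.map g).prod := by
  induction l with
  | nil => exact HasSymbol.one
  | cons a l ih =>
    simp only [List.map_cons, List.prod_cons, List.sum_cons, Nat.cast_add]
    exact (h a).mul ih

/-- The leading symbol of an operator is recovered from its value on the constant family `1` in
degree `0`. -/
theorem HasSymbol.apply_single (h : HasSymbol T d g) {n : ℤ} (hn : d ≤ n) :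
    T (Pi.single 0 1) n = if d = n then g else 0 := by
  have hs : ∀ m : ℤ, 0 < m → (Pi.single 0 1 : ℤ → MvPolynomial τ k) m = 0 :=
    fun m hm => Pi.single_eq_of_ne hm.ne' _
  obtain ⟨h₁, h₂⟩ := h _ 0 hs
  rw [zero_add] at h₁ h₂
  split_ifs with hd
  · rw [← hd, h₂, Pi.single_eq_same, mul_one]
  · exact h₁ n (by omega)

/-- The symbol of the operators `siteOp` on site `s`. -/
def siteSymbol (ξ : ℕ × Fin 2 × Fin 2 → k) (s : ℕ) :
    Matrix (Fin 2) (Fin 2) (MvPolynomial (ℕ × Fin 2 × Fin 2) k) :=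
  fun i j => ∑ m, MvPolynomial.X (s, i, m) * MvPolynomial.C (ξ (s, j, m))

theorem siteOp_hasSymbol (ξ : ℕ × Fin 2 × Fin 2 → k) (M : ℕ → ℤ) (s : ℕ) (hM : 0 < M s)
    (i j : Fin 2) :
    HasSymbol (siteOp ξ (fun a => M a.1) s i j) (M s) (siteSymbol ξ s i j) := by
  refine HasSymbol.sum _ fun m _ => fun v n hv => ⟨fun a ha => ?_, ?_⟩
  · simp only [Module.End.mul_apply, coordOp, momentumOp, LinearMap.coe_mk, AddHom.coe_mk]
    rw [hv a (by omega), hv (a - M s) (by omega)]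
    simp
  · simp only [Module.End.mul_apply, coordOp, momentumOp, LinearMap.coe_mk, AddHom.coe_mk]
    rw [hv (n + M s) (by omega), add_sub_cancel_right, map_zero, zero_add, mul_assoc,
      MvPolynomial.C_mul']

/-- When the degrees of the sites decrease, the leading part of the `r`-th coefficient of
`(u + E₀)(u + E₁)⋯` is the product `E₀E₁⋯E_{r-1}`. -/
theorem siteProduct_hasSymbol (ξ : ℕ × Fin 2 × Fin 2 → k) (M : ℕ → ℤ) (n : ℕ)
    (hM : ∀ a < n, 0 < M a) (hM' : StrictAnti M) (r : ℕ) (hr : r ≤ n) (i j : Fin 2) :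
    HasSymbol (siteProduct (siteOp ξ fun a => M a.1) n i j r) (∑ a ∈ Finset.range r, M a)
      (((List.range r).map (siteSymbol ξ)).prod i j) := by
  have hone : ∀ i j : Fin 2, HasSymbol
      (if i = j then 1 else 0 : Module.End k (ℤ → MvPolynomial (ℕ × Fin 2 × Fin 2) k))
      (∑ a ∈ Finset.range 0, M a) (((List.range 0).map (siteSymbol ξ)).prod i j) := by
    intro i j
    simp only [Finset.range_zero, Finset.sum_empty, List.range_zero, List.map_nil, List.prod_nil,
      Matrix.one_apply]
    split_ifs
    · exact HasSymbol.one
    · exact HasSymbol.zero 0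
  induction n generalizing r i j with
  | zero =>
    obtain rfl : r = 0 := by omega
    exact hone i j
  | succ n ih =>
    cases r with
    | zero => exact hone i j
    | succ r =>
      rw [siteProduct]
      have ih' := ih (fun a ha => hM a (by omega))
      have h2 : HasSymbol (∑ m, siteProduct (siteOp ξ fun a => M a.1) n i m r
          * siteOp ξ (fun a => M a.1) n m j) (∑ a ∈ Finset.range r, M a + M n)
          (∑ m, ((List.range r).map (siteSymbol ξ)).prod i m * siteSymbol ξ n m j) :=
        HasSymbol.sum _ fun m _ =>
          (ih' r (by omega) i m).mul (siteOp_hasSymbol ξ M n (hM n (by omega)) m j)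
      rcases (Nat.le_of_succ_le_succ hr).lt_or_eq with hlt | rfl
      · have h1 := ih' (r + 1) hlt i j
        have h3 := h2.of_lt (d' := ∑ a ∈ Finset.range (r + 1), M a) (by
          rw [Finset.sum_range_succ]
          have := hM' hlt
          omega)
        simpa using h1.add h3
      · rw [(siteProduct_isMonicSeq _ r).of_lt i j (r + 1) (Nat.lt_succ_self r), zero_add,
          Finset.sum_range_succ, List.range_succ, List.map_append, List.prod_append]
        simpa [Matrix.mul_apply] using h2

end LeadingSymbol

/-! ### Linear independence of ordered monomials -/

section OrderedMonomials

theorem prod_map_toMultiset {σ N : Type*} [CommMonoid N] (g : σ → N) (m : σ →₀ ℕ) :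
    ((Finsupp.toMultiset m).map g).prod = m.prod fun a n => g a ^ n := by
  induction m using Finsupp.induction_linear with
  | zero => simp
  | add f h hf hh =>
    rw [map_add, Multiset.map_add, Multiset.prod_add, hf, hh,
      Finsupp.prod_add_index' (fun a => pow_zero (g a)) (fun a => pow_add (g a))]
  | single a n =>
    rw [Finsupp.toMultiset_single, Multiset.map_nsmul, Multiset.prod_nsmul, Multiset.map_singleton,
      Multiset.prod_singleton, Finsupp.prod_single_index (h := fun a n => g a ^ n) (pow_zero _)]

theorem sum_map_toMultiset {σ : Type*} (w : σ → ℕ) (m : σ →₀ ℕ) :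
    ((Finsupp.toMultiset m).map w).sum = Finsupp.weight w m := by
  induction m using Finsupp.induction_linear with
  | zero => simp
  | add f h hf hh => rw [map_add, Multiset.map_add, Multiset.sum_add, hf, hh, map_add]
  | single a n =>
    rw [Finsupp.toMultiset_single, Multiset.map_nsmul, Multiset.sum_nsmul, Multiset.map_singleton,
      Multiset.sum_singleton, Finsupp.weight_single]

variable (𝕜 : Type u) [Field 𝕜] (p : ℕ)

/-- The letters `(i, j, r)`, standing for the generators `t_{ij}^{(r+1)}` of the Yangian. -/
abbrev Letter (p : ℕ) : Type := Fin 2 × Fin 2 × Fin p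

/-- The generator of the Yangian named by a letter. -/
def letterT (x : Letter p) : LevelYangian 𝕜 p := yangianT 𝕜 p x.1 x.2.1 (x.2.2 + 1)

/-- The product of the generators named by the letters of a word. -/
def wordT (l : List (Letter p)) : LevelYangian 𝕜 p := (l.map (letterT 𝕜 p)).prod

/-- The linear map from the polynomial ring on the letters to the Yangian which replaces each
monomial by an ordered product of generators (in some fixed, arbitrary order). -/
def orderedMonomialMap : MvPolynomial (Letter p) 𝕜 →ₗ[𝕜] LevelYangian 𝕜 p :=
  (MvPolynomial.basisMonomials (Letter p) 𝕜).constr 𝕜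
    fun m => wordT 𝕜 p (Finsupp.toMultiset m).toList

theorem orderedMonomialMap_monomial (m : Letter p →₀ ℕ) (c : 𝕜) :
    orderedMonomialMap 𝕜 p (MvPolynomial.monomial m c)
      = c • wordT 𝕜 p (Finsupp.toMultiset m).toList := by
  have := (MvPolynomial.basisMonomials (Letter p) 𝕜).constr_basis 𝕜
    (fun m => wordT 𝕜 p (Finsupp.toMultiset m).toList) m
  rw [MvPolynomial.coe_basisMonomials] at this
  rw [← mul_one c, ← smul_eq_mul, ← MvPolynomial.smul_monomial, map_smul, smul_eq_mul, mul_one]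
  exact congrArg _ this

theorem orderedMonomialMap_apply (F : MvPolynomial (Letter p) 𝕜) :
    orderedMonomialMap 𝕜 p F
      = ∑ m ∈ F.support, F.coeff m • wordT 𝕜 p (Finsupp.toMultiset m).toList := by
  conv_lhs => rw [F.as_sum, map_sum]
  exact Finset.sum_congr rfl fun m _ => orderedMonomialMap_monomial 𝕜 p m _

/-- A weight on the letters that is strictly concave in the upper index. It makes the product
`E₀E₁⋯E_{r-1}` the only leading term of the `r`-th coefficient of `(u + E₀)⋯(u + E_{p-1})`. -/
def concaveWeight (x : Letter p) : ℕ := ∑ a ∈ Finset.range (x.2.2 + 1), (p - a)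

variable {𝕜 p}

/-- The top component, for the concave weight, of a polynomial killed by `orderedMonomialMap`
vanishes at all tuples of products `Z₀Z₁⋯Z_r`. -/
theorem eval_weightedHomogeneousComponent_of_map_eq_zero [Infinite 𝕜]
    {F : MvPolynomial (Letter p) 𝕜} (hF : orderedMonomialMap 𝕜 p F = 0)
    (Z : ℕ → Matrix (Fin 2) (Fin 2) 𝕜) :
    MvPolynomial.eval (fun x : Letter p => ((List.range (x.2.2 + 1)).map Z).prod x.1 x.2.1)
      (MvPolynomial.weightedHomogeneousComponent (concaveWeight p)
        (MvPolynomial.weightedTotalDegree (concaveWeight p) F) F) = 0 := by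
  classical
  let ξ : ℕ × Fin 2 × Fin 2 → 𝕜 := fun a => Z a.1 a.2.2 a.2.1
  let M : ℕ → ℤ := fun a => (p : ℤ) - a
  have hM : ∀ a < p, 0 < M a := fun a ha => by simp only [M]; omega
  have hM' : StrictAnti M := fun a b hab => by simp only [M]; omega
  let E := siteOp ξ fun a => M a.1
  obtain ⟨ρ, hρ⟩ := exists_lift_of_coeffRTT (𝕜 := 𝕜) (siteProduct_isMonicSeq E p)
    (siteProduct_coeffRTT (k := 𝕜) (siteOp_commute ξ _) (siteOp_commutator ξ _) p)
  let g : Letter p → MvPolynomial (ℕ × Fin 2 × Fin 2) 𝕜 :=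
    fun x => ((List.range (x.2.2 + 1)).map (siteSymbol ξ)).prod x.1 x.2.1
  have hsym : ∀ x : Letter p, HasSymbol (ρ (letterT 𝕜 p x)) (concaveWeight p x : ℕ) (g x) := by
    intro x
    rw [letterT, hρ]
    have := siteProduct_hasSymbol ξ M p hM hM' (x.2.2 + 1) x.2.2.2 x.1 x.2.1
    convert! this using 1
    rw [concaveWeight, Nat.cast_sum]
    refine Finset.sum_congr rfl fun a ha => ?_
    have := x.2.2.2
    simp only [Finset.mem_range] at ha
    simp only [M]
    omega
  have hword : ∀ m : Letter p →₀ ℕ, HasSymbol (ρ (wordT 𝕜 p (Finsupp.toMultiset m).toList))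
      (Finsupp.weight (concaveWeight p) m : ℕ) (m.prod fun a n => g a ^ n) := by
    intro m
    have := HasSymbol.list_prod hsym (Finsupp.toMultiset m).toList
    rw [← sum_map_toMultiset, ← prod_map_toMultiset]
    rw [wordT, map_list_prod, List.map_map]
    rw [← Multiset.sum_toList, ← Multiset.prod_toList, Multiset.sum_toList, Multiset.prod_toList]
    conv => enter [2]; rw [← Multiset.coe_toList (Finsupp.toMultiset m), Multiset.map_coe,
      Multiset.sum_coe]
    conv => enter [3]; rw [← Multiset.coe_toList (Finsupp.toMultiset m), Multiset.map_coe,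
      Multiset.prod_coe]
    exact this
  set n := MvPolynomial.weightedTotalDegree (concaveWeight p) F with hn
  have h0 := congrArg (fun y => ρ y (Pi.single 0 1) (n : ℤ)) hF
  rw [orderedMonomialMap_apply] at h0
  simp only [map_sum, map_smul, map_zero, LinearMap.sum_apply, LinearMap.smul_apply,
    Finset.sum_apply, Pi.smul_apply, LinearMap.zero_apply, Pi.zero_apply] at h0
  have h1 : ∑ m ∈ F.support, F.coeff m • (if Finsupp.weight (concaveWeight p) m = n
      then m.prod fun a n => g a ^ n else 0) = 0 := by
    refine Eq.trans (Finset.sum_congr rfl fun m hm => ?_) h0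
    rw [(hword m).apply_single (by
      exact_mod_cast MvPolynomial.le_weightedTotalDegree (concaveWeight p) hm)]
    simp only [Nat.cast_inj]
  have hg : ∀ x, MvPolynomial.eval (fun a : ℕ × Fin 2 × Fin 2 => if a.2.1 = a.2.2 then 1 else 0)
      (g x) = ((List.range (x.2.2 + 1)).map Z).prod x.1 x.2.1 := by
    intro x
    let ev : MvPolynomial (ℕ × Fin 2 × Fin 2) 𝕜 →+* 𝕜 :=
      MvPolynomial.eval (fun a : ℕ × Fin 2 × Fin 2 => if a.2.1 = a.2.2 then 1 else 0)
    change ev.mapMatrix ((List.range (x.2.2 + 1)).map (siteSymbol ξ)).prod x.1 x.2.1 = _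
    rw [map_list_prod, List.map_map]
    have : ev.mapMatrix ∘ siteSymbol ξ = Z := by
      ext s i j
      fin_cases i <;> simp [siteSymbol, ev, ξ]
    rw [this]
  have h2 := congrArg (MvPolynomial.eval
    (fun a : ℕ × Fin 2 × Fin 2 => if a.2.1 = a.2.2 then (1 : 𝕜) else 0)) h1
  rw [MvPolynomial.weightedHomogeneousComponent_apply, map_sum, Finset.sum_filter]
  rw [map_sum, map_zero] at h2
  refine Eq.trans (Finset.sum_congr rfl fun m _ => ?_) h2
  split_ifs
  · rw [MvPolynomial.eval_monomial, MvPolynomial.smul_eval, Finsupp.prod, Finsupp.prod, map_prod]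
    simp only [map_pow, hg]
  · simp

/-- Invertible matrices are the partial products of a sequence of matrices. -/
theorem exists_partial_products {Q : ℕ → Matrix (Fin 2) (Fin 2) 𝕜} (n : ℕ)
    (hQ : ∀ r < n, IsUnit (Q r).det) :
    ∃ Z : ℕ → Matrix (Fin 2) (Fin 2) 𝕜, ∀ r < n, ((List.range (r + 1)).map Z).prod = Q r := by
  refine ⟨fun r => if r = 0 then Q 0 else (Q (r - 1))⁻¹ * Q r, fun r hr => ?_⟩
  induction r with
  | zero => simp
  | succ r ih =>
    rw [List.range_succ, List.map_append, List.prod_append, ih (by omega)]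
    simp only [List.map_cons, List.map_nil, List.prod_singleton, Nat.add_eq_zero_iff, one_ne_zero,
      and_false, if_false, Nat.add_sub_cancel]
    rw [Matrix.mul_nonsing_inv_cancel_left _ _ (hQ r (by omega))]

/-- The determinant of the matrix of letters with upper index `r + 1`. -/
def letterDet (r : Fin p) : MvPolynomial (Letter p) 𝕜 :=
  MvPolynomial.X (0, 0, r) * MvPolynomial.X (1, 1, r)
    - MvPolynomial.X (0, 1, r) * MvPolynomial.X (1, 0, r)

/-- Ordered monomials in the generators of the Yangian are linearly independent. -/
theorem orderedMonomialMap_injective [Infinite 𝕜] :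
    Function.Injective (orderedMonomialMap 𝕜 p) := by
  classical
  rw [← LinearMap.ker_eq_bot, LinearMap.ker_eq_bot']
  intro F hF
  by_contra hne
  set n := MvPolynomial.weightedTotalDegree (concaveWeight p) F with hn
  set G := MvPolynomial.weightedHomogeneousComponent (concaveWeight p) n F with hG
  have hG0 : G = 0 := by
    have hdet : (∏ r : Fin p, letterDet (𝕜 := 𝕜) r) ≠ 0 := by
      refine Finset.prod_ne_zero_iff.2 fun r _ h => ?_
      have := congrArg (MvPolynomial.eval fun x : Letter p => if x.1 = x.2.1 then (1 : 𝕜) else 0) h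
      simp [letterDet] at this
    refine (mul_eq_zero.1 (?_ : G * ∏ r : Fin p, letterDet r = 0)).resolve_right hdet
    refine MvPolynomial.funext fun q => ?_
    rw [map_mul, map_prod, map_zero]
    by_cases hq : ∃ r : Fin p, MvPolynomial.eval q (letterDet r) = 0
    · obtain ⟨r, hr⟩ := hq
      rw [Finset.prod_eq_zero (Finset.mem_univ r) hr, mul_zero]
    · push Not at hq
      let Q : ℕ → Matrix (Fin 2) (Fin 2) 𝕜 :=
        fun r => if h : r < p then fun i j => q (i, j, ⟨r, h⟩) else 0
      obtain ⟨Z, hZ⟩ := exists_partial_products (Q := Q) p fun r hr => by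
        have := hq ⟨r, hr⟩
        rw [isUnit_iff_ne_zero, Matrix.det_fin_two]
        simpa [Q, hr, letterDet] using this
      have h := eval_weightedHomogeneousComponent_of_map_eq_zero hF Z
      have hq' : (fun x : Letter p => ((List.range (x.2.2 + 1)).map Z).prod x.1 x.2.1) = q := by
        ext ⟨i, j, r⟩
        rw [hZ r r.2]
        simp [Q]
      rw [hq'] at h
      rw [hG, h, zero_mul]
  obtain ⟨m, hm, hmn⟩ : ∃ m ∈ F.support, Finsupp.weight (concaveWeight p) m = n := by
    obtain ⟨m, hm, h⟩ := Finset.exists_mem_eq_sup F.support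
      (MvPolynomial.support_nonempty.2 hne) (fun s => Finsupp.weight (concaveWeight p) s)
    exact ⟨m, hm, h.symm⟩
  have := congrArg (MvPolynomial.coeff m) hG0
  rw [hG, MvPolynomial.coeff_weightedHomogeneousComponent, if_pos hmn,
    MvPolynomial.coeff_zero] at this
  exact MvPolynomial.mem_support_iff.1 hm this

end OrderedMonomials

/-! ### The filtration by weight and its symbols -/

section Filtration

variable (𝕜 : Type u) [Field 𝕜] (p : ℕ)

/-- The weight of the generator `t_{ij}^{(r)}` is `r`. -/
def letterWeight (x : Letter p) : ℕ := x.2.2 + 1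

/-- The span of all products of generators of total weight less than `n`. -/
def weightFiltration (n : ℕ) : Submodule 𝕜 (LevelYangian 𝕜 p) :=
  Submodule.span 𝕜 {y | ∃ l : List (Letter p), (l.map (letterWeight p)).sum < n ∧ wordT 𝕜 p l = y}

variable {𝕜 p}

theorem wordT_mem_weightFiltration {l : List (Letter p)} {n : ℕ}
    (h : (l.map (letterWeight p)).sum < n) : wordT 𝕜 p l ∈ weightFiltration 𝕜 p n :=
  Submodule.subset_span ⟨l, h, rfl⟩

theorem weightFiltration_mono {m n : ℕ} (h : m ≤ n) :
    weightFiltration 𝕜 p m ≤ weightFiltration 𝕜 p n :=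
  Submodule.span_mono fun _ ⟨l, hl, e⟩ => ⟨l, hl.trans_le h, e⟩

theorem mul_mem_weightFiltration {a b c : ℕ} (hab : a + b ≤ c + 1) {x y : LevelYangian 𝕜 p}
    (hx : x ∈ weightFiltration 𝕜 p a) (hy : y ∈ weightFiltration 𝕜 p b) :
    x * y ∈ weightFiltration 𝕜 p c := by
  have := Submodule.mul_mem_mul hx hy
  rw [weightFiltration, weightFiltration, Submodule.span_mul_span] at this
  refine Submodule.span_le.2 ?_ this
  rintro _ ⟨_, ⟨l, hl, rfl⟩, _, ⟨l', hl', rfl⟩, rfl⟩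
  refine Submodule.subset_span ⟨l ++ l', ?_, ?_⟩
  · rw [List.map_append, List.sum_append]
    omega
  · simp [wordT]

theorem yangianT_mem_weightFiltration (i j : Fin 2) {r n : ℕ} (h : r < n) :
    yangianT 𝕜 p i j r ∈ weightFiltration 𝕜 p n := by
  have h1 : (1 : LevelYangian 𝕜 p) ∈ weightFiltration 𝕜 p n :=
    wordT_mem_weightFiltration (l := []) (by simp; omega)
  cases r with
  | zero =>
    rw [yangianT_zero]
    split_ifs
    · exact h1
    · exact zero_mem _
  | succ r =>
    rcases lt_or_ge r p with hr | hr
    · have := wordT_mem_weightFiltration (𝕜 := 𝕜) (l := [((i, j, ⟨r, hr⟩) : Letter p)]) (n := n)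
        (by simpa [letterWeight] using h)
      simpa [wordT, letterT] using this
    · rw [yangianT_of_lt 𝕜 p i j _ (by omega)]
      exact zero_mem _

theorem letterT_mem_weightFiltration (x : Letter p) :
    letterT 𝕜 p x ∈ weightFiltration 𝕜 p (letterWeight p x + 1) :=
  yangianT_mem_weightFiltration _ _ (Nat.lt_succ_self _)

/-- The associated graded algebra is commutative on generators. -/
theorem letterT_commutator_mem (x y : Letter p) :
    letterT 𝕜 p x * letterT 𝕜 p y - letterT 𝕜 p y * letterT 𝕜 p x
      ∈ weightFiltration 𝕜 p (letterWeight p x + letterWeight p y) := by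
  rw [letterT, letterT, (yangianT_coeffRTT 𝕜 p).commutator (yangianT_isMonicSeq 𝕜 p)]
  refine Submodule.sum_mem _ fun a ha => ?_
  simp only [Finset.mem_Icc, le_min_iff] at ha
  refine sub_mem ?_ ?_ <;>
  · refine mul_mem_weightFiltration (le_of_eq ?_)
      (yangianT_mem_weightFiltration _ _ (Nat.lt_succ_self _))
      (yangianT_mem_weightFiltration _ _ (Nat.lt_succ_self _))
    simp only [letterWeight]
    omega

theorem wordT_cons (x : Letter p) (l : List (Letter p)) :
    wordT 𝕜 p (x :: l) = letterT 𝕜 p x * wordT 𝕜 p l := by simp [wordT]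

/-- Reordering a product of generators changes it by terms of lower weight. -/
theorem wordT_sub_mem_of_perm {l l' : List (Letter p)} (h : l.Perm l') :
    wordT 𝕜 p l - wordT 𝕜 p l' ∈ weightFiltration 𝕜 p (l.map (letterWeight p)).sum := by
  induction h with
  | nil => simp
  | cons x h ih =>
    rw [wordT_cons, wordT_cons, ← mul_sub]
    refine mul_mem_weightFiltration (le_of_eq ?_) (letterT_mem_weightFiltration x) ih
    rw [List.map_cons, List.sum_cons]
    omega
  | swap x y l =>
    rw [wordT_cons, wordT_cons, wordT_cons, wordT_cons, ← mul_assoc, ← mul_assoc, ← sub_mul]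
    refine mul_mem_weightFiltration (le_of_eq ?_) (letterT_commutator_mem y x)
      (wordT_mem_weightFiltration (l := l) (Nat.lt_succ_self _))
    rw [List.map_cons, List.map_cons, List.sum_cons, List.sum_cons]
    omega
  | trans h₁ h₂ ih₁ ih₂ =>
    rw [← (h₁.map (letterWeight p)).sum_eq] at ih₂
    simpa using add_mem ih₁ ih₂

theorem sum_map_toList (m : Letter p →₀ ℕ) :
    ((Finsupp.toMultiset m).toList.map (letterWeight p)).sum
      = Finsupp.weight (letterWeight p) m := by
  rw [← sum_map_toMultiset, ← Multiset.sum_coe, ← Multiset.map_coe, Multiset.coe_toList]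

theorem orderedMonomialMap_mem {F : MvPolynomial (Letter p) 𝕜} {n : ℕ}
    (hF : F.IsWeightedHomogeneous (letterWeight p) n) :
    orderedMonomialMap 𝕜 p F ∈ weightFiltration 𝕜 p (n + 1) := by
  rw [orderedMonomialMap_apply]
  refine Submodule.sum_mem _ fun m hm => Submodule.smul_mem _ _ (wordT_mem_weightFiltration ?_)
  rw [sum_map_toList, hF (MvPolynomial.mem_support_iff.1 hm)]
  exact Nat.lt_succ_self n

theorem orderedMonomialMap_mul_sub_mem {F G : MvPolynomial (Letter p) 𝕜} {m n : ℕ}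
    (hF : F.IsWeightedHomogeneous (letterWeight p) m)
    (hG : G.IsWeightedHomogeneous (letterWeight p) n) :
    orderedMonomialMap 𝕜 p F * orderedMonomialMap 𝕜 p G - orderedMonomialMap 𝕜 p (F * G)
      ∈ weightFiltration 𝕜 p (m + n) := by
  have h : orderedMonomialMap 𝕜 p (F * G) = ∑ a ∈ F.support, ∑ b ∈ G.support,
      (F.coeff a * G.coeff b) • wordT 𝕜 p (Finsupp.toMultiset (a + b)).toList := by
    conv_lhs => rw [F.as_sum, G.as_sum, Finset.sum_mul_sum, map_sum]
    refine Finset.sum_congr rfl fun a _ => ?_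
    rw [map_sum]
    refine Finset.sum_congr rfl fun b _ => ?_
    rw [MvPolynomial.monomial_mul, orderedMonomialMap_monomial]
  rw [h, orderedMonomialMap_apply, orderedMonomialMap_apply, Finset.sum_mul_sum,
    ← Finset.sum_sub_distrib]
  refine Submodule.sum_mem _ fun a ha => ?_
  rw [← Finset.sum_sub_distrib]
  refine Submodule.sum_mem _ fun b hb => ?_
  rw [smul_mul_smul_comm, ← smul_sub]
  refine Submodule.smul_mem _ _ ?_
  have hperm : ((Finsupp.toMultiset a).toList ++ (Finsupp.toMultiset b).toList).Perm
      (Finsupp.toMultiset (a + b)).toList := by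
    rw [← Multiset.coe_eq_coe, ← Multiset.coe_add, Multiset.coe_toList, Multiset.coe_toList,
      Multiset.coe_toList, map_add]
  have := wordT_sub_mem_of_perm (𝕜 := 𝕜) hperm
  rw [List.map_append, List.sum_append, sum_map_toList, sum_map_toList,
    hF (MvPolynomial.mem_support_iff.1 ha), hG (MvPolynomial.mem_support_iff.1 hb)] at this
  rwa [wordT, List.map_append, List.prod_append] at this

/-- Spanning by ordered monomials, with control of the weights. -/
theorem weightFiltration_le_span (n : ℕ) :
    weightFiltration 𝕜 p n ≤ Submodule.span 𝕜 {y | ∃ m : Letter p →₀ ℕ,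
      Finsupp.weight (letterWeight p) m < n
        ∧ orderedMonomialMap 𝕜 p (MvPolynomial.monomial m 1) = y} := by
  classical
  induction n with
  | zero =>
    refine Submodule.span_le.2 ?_
    rintro _ ⟨l, hl, -⟩
    omega
  | succ n ih =>
    refine Submodule.span_le.2 ?_
    rintro _ ⟨l, hl, rfl⟩
    let m : Letter p →₀ ℕ := Multiset.toFinsupp (l : Multiset (Letter p))
    have hm : Finsupp.toMultiset m = l := Multiset.toFinsupp_toMultiset _
    have hw : Finsupp.weight (letterWeight p) m = (l.map (letterWeight p)).sum := by
      rw [← sum_map_toMultiset, hm, Multiset.map_coe, Multiset.sum_coe]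
    have hperm : l.Perm (Finsupp.toMultiset m).toList := by
      rw [← Multiset.coe_eq_coe, Multiset.coe_toList, hm]
    have h1 := ih (weightFiltration_mono (Nat.le_of_lt_succ hl)
      (wordT_sub_mem_of_perm (𝕜 := 𝕜) hperm))
    have h2 : wordT 𝕜 p (Finsupp.toMultiset m).toList
        = orderedMonomialMap 𝕜 p (MvPolynomial.monomial m 1) := by
      rw [orderedMonomialMap_monomial, one_smul]
    rw [SetLike.mem_coe, ← sub_add_cancel (wordT 𝕜 p l) (wordT 𝕜 p (Finsupp.toMultiset m).toList)]
    refine add_mem (Submodule.span_mono ?_ h1) (Submodule.subset_span ⟨m, by omega, h2.symm⟩)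
    rintro y ⟨m, hm, rfl⟩
    exact ⟨m, by omega, rfl⟩

theorem exists_mem_weightFiltration (y : LevelYangian 𝕜 p) :
    ∃ n, y ∈ weightFiltration 𝕜 p n := by
  obtain ⟨y, rfl⟩ := RingQuot.mkAlgHom_surjective 𝕜 (YangianRel 𝕜 p) y
  change ∃ n, LevelYangian.mk 𝕜 p y ∈ _
  induction y using FreeAlgebra.induction with
  | grade0 a =>
    refine ⟨1, ?_⟩
    rw [AlgHom.commutes, Algebra.algebraMap_eq_smul_one]
    exact Submodule.smul_mem _ _ (wordT_mem_weightFiltration (l := []) (by simp))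
  | grade1 a =>
    have := yangianT_mem_weightFiltration (𝕜 := 𝕜) (p := p) a.1 a.2.1 (Nat.lt_succ_self (a.2.2 + 1))
    rw [yangianT, freeT, dif_pos a.2.2.2] at this
    exact ⟨_, this⟩
  | mul a b ha hb =>
    obtain ⟨m, hm⟩ := ha
    obtain ⟨n, hn⟩ := hb
    exact ⟨m + n, by rw [map_mul]; exact mul_mem_weightFiltration (Nat.le_succ _) hm hn⟩
  | add a b ha hb =>
    obtain ⟨m, hm⟩ := ha
    obtain ⟨n, hn⟩ := hb
    exact ⟨m + n, by
      rw [map_add]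
      exact add_mem (weightFiltration_mono (Nat.le_add_right m n) hm)
        (weightFiltration_mono (Nat.le_add_left n m) hn)⟩

/-- The element `y` of the Yangian has filtration degree at most `n`, with symbol the weighted
homogeneous polynomial `F` of degree `n`. -/
structure HasPolySymbol (n : ℕ) (y : LevelYangian 𝕜 p) (F : MvPolynomial (Letter p) 𝕜) : Prop where
  homogeneous : F.IsWeightedHomogeneous (letterWeight p) n
  sub_mem : y - orderedMonomialMap 𝕜 p F ∈ weightFiltration 𝕜 p n

theorem HasPolySymbol.mem {n : ℕ} {y : LevelYangian 𝕜 p} {F : MvPolynomial (Letter p) 𝕜}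
    (h : HasPolySymbol n y F) : y ∈ weightFiltration 𝕜 p (n + 1) := by
  rw [← sub_add_cancel y (orderedMonomialMap 𝕜 p F)]
  exact add_mem (weightFiltration_mono n.le_succ h.sub_mem) (orderedMonomialMap_mem h.homogeneous)

theorem HasPolySymbol.mul {m n : ℕ} {x y : LevelYangian 𝕜 p} {F G : MvPolynomial (Letter p) 𝕜}
    (hx : HasPolySymbol m x F) (hy : HasPolySymbol n y G) : HasPolySymbol (m + n) (x * y) (F * G) where
  homogeneous := hx.homogeneous.mul hy.homogeneous
  sub_mem := by
    have h1 := mul_mem_weightFiltration (c := m + n) (by omega) hx.sub_mem hy.mem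
    have h2 := mul_mem_weightFiltration (c := m + n) (by omega)
      (orderedMonomialMap_mem hx.homogeneous) hy.sub_mem
    have h3 := orderedMonomialMap_mul_sub_mem hx.homogeneous hy.homogeneous
    have := add_mem (add_mem h1 h2) h3
    simpa only [sub_mul, mul_sub, sub_add_sub_cancel] using this

theorem HasPolySymbol.add {n : ℕ} {x y : LevelYangian 𝕜 p} {F G : MvPolynomial (Letter p) 𝕜}
    (hx : HasPolySymbol n x F) (hy : HasPolySymbol n y G) : HasPolySymbol n (x + y) (F + G) where
  homogeneous := hx.homogeneous.add hy.homogeneous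
  sub_mem := by
    rw [map_add, add_sub_add_comm]
    exact add_mem hx.sub_mem hy.sub_mem

theorem HasPolySymbol.sub {n : ℕ} {x y : LevelYangian 𝕜 p} {F G : MvPolynomial (Letter p) 𝕜}
    (hx : HasPolySymbol n x F) (hy : HasPolySymbol n y G) : HasPolySymbol n (x - y) (F - G) where
  homogeneous := hx.homogeneous.sub hy.homogeneous
  sub_mem := by
    rw [map_sub, sub_sub_sub_comm]
    exact _root_.sub_mem hx.sub_mem hy.sub_mem

theorem HasPolySymbol.of_mem {n : ℕ} {y : LevelYangian 𝕜 p} (h : y ∈ weightFiltration 𝕜 p n) :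
    HasPolySymbol n y 0 where
  homogeneous := MvPolynomial.isWeightedHomogeneous_zero _ _ _
  sub_mem := by rwa [map_zero, sub_zero]

theorem HasPolySymbol.sum {ι : Type*} (s : Finset ι) {n : ℕ} {y : ι → LevelYangian 𝕜 p}
    {F : ι → MvPolynomial (Letter p) 𝕜} (h : ∀ i ∈ s, HasPolySymbol n (y i) (F i)) :
    HasPolySymbol n (∑ i ∈ s, y i) (∑ i ∈ s, F i) := by
  classical
  induction s using Finset.induction_on with
  | empty => exact .of_mem (zero_mem _)
  | insert a s ha ih =>
    rw [Finset.sum_insert ha, Finset.sum_insert ha]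
    exact (h a (Finset.mem_insert_self a s)).add
      (ih fun i hi => h i (Finset.mem_insert_of_mem hi))

theorem HasPolySymbol.one : HasPolySymbol 0 (1 : LevelYangian 𝕜 p) 1 where
  homogeneous := MvPolynomial.isWeightedHomogeneous_one _ _
  sub_mem := by
    have : orderedMonomialMap 𝕜 p 1 = 1 := by
      change orderedMonomialMap 𝕜 p (MvPolynomial.monomial 0 1) = 1
      rw [orderedMonomialMap_monomial]
      simp [wordT]
    rw [this, sub_self]
    exact zero_mem _

theorem HasPolySymbol.pow {n : ℕ} {y : LevelYangian 𝕜 p} {F : MvPolynomial (Letter p) 𝕜}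
    (h : HasPolySymbol n y F) (a : ℕ) : HasPolySymbol (a * n) (y ^ a) (F ^ a) := by
  induction a with
  | zero => simpa using HasPolySymbol.one
  | succ a ih =>
    rw [pow_succ, pow_succ, Nat.succ_mul]
    exact ih.mul h

theorem HasPolySymbol.letter (x : Letter p) :
    HasPolySymbol (letterWeight p x) (letterT 𝕜 p x) (MvPolynomial.X x) where
  homogeneous := MvPolynomial.isWeightedHomogeneous_X _ _ x
  sub_mem := by
    have : orderedMonomialMap 𝕜 p (MvPolynomial.X x) = letterT 𝕜 p x := by
      rw [MvPolynomial.X, orderedMonomialMap_monomial]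
      simp [wordT]
    rw [this, sub_self]
    exact zero_mem _

theorem HasPolySymbol.monomial (m : Letter p →₀ ℕ) :
    HasPolySymbol (Finsupp.weight (letterWeight p) m)
      (orderedMonomialMap 𝕜 p (MvPolynomial.monomial m 1)) (MvPolynomial.monomial m 1) where
  homogeneous := MvPolynomial.isWeightedHomogeneous_monomial _ _ _ rfl
  sub_mem := by
    rw [sub_self]
    exact zero_mem _

end Filtration

/-! ### Weakly regular sequences -/

section RegularSequences

open RingTheory.Sequence
open scoped Pointwise

/-- If `f` is regular on `M` and the `e j` are independent modulo `f`, the elements `f ^ n • e j`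
are independent: the lowest power of `f` in a relation can be cancelled. -/
theorem linearIndependent_pow_smul {k R M J : Type*} [Field k] [CommRing R] [Algebra k R]
    [AddCommGroup M] [Module R M] [Module k M] [IsScalarTower k R M] {f : R}
    (hf : IsSMulRegular M f) {e : J → M}
    (he : LinearIndependent k fun j => (Submodule.Quotient.mk (e j) : QuotSMulTop f M)) :
    LinearIndependent k fun x : ℕ × J => f ^ x.1 • e x.2 := by
  have key : ∀ (n : ℕ) (c : ℕ → J →₀ k),
      ∑ m ∈ Finset.range n, f ^ m • Finsupp.linearCombination k e (c m) = 0 →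
      ∀ m < n, c m = 0 := by
    intro n
    induction n with
    | zero => exact fun c _ m hm => absurd hm (Nat.not_lt_zero m)
    | succ n ih =>
      intro c hc
      rw [Finset.sum_range_succ'] at hc
      have hsum : ∑ m ∈ Finset.range n, f ^ (m + 1) • Finsupp.linearCombination k e (c (m + 1))
          = f • ∑ m ∈ Finset.range n, f ^ m • Finsupp.linearCombination k e (c (m + 1)) := by
        rw [Finset.smul_sum]
        exact Finset.sum_congr rfl fun m _ => by rw [smul_smul, ← pow_succ']
      rw [hsum, pow_zero, one_smul] at hc
      have h0 : c 0 = 0 := by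
        refine linearIndependent_iff.1 he (c 0) ?_
        have h1 : (Submodule.Quotient.mk (Finsupp.linearCombination k e (c 0)) : QuotSMulTop f M)
            = 0 := by
          rw [Submodule.Quotient.mk_eq_zero, eq_neg_of_add_eq_zero_right hc]
          exact neg_mem (Submodule.smul_mem_pointwise_smul _ _ _ trivial)
        rw [← h1]
        have := Finsupp.apply_linearCombination k
          ((Submodule.mkQ (f • ⊤ : Submodule R M)).restrictScalars k) e (c 0)
        exact this.symm
      rw [h0, map_zero, add_zero] at hc
      have h1 := ih (fun m => c (m + 1)) (hf.right_eq_zero_of_smul hc)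
      intro m hm
      cases m with
      | zero => exact h0
      | succ m => exact h1 m (by omega)
  refine linearIndependent_iff.2 fun l hl => ?_
  have h1 : Finsupp.linearCombination k (fun x : ℕ × J => f ^ x.1 • e x.2) l
      = ∑ m ∈ Finset.range (l.curry.support.sup id + 1),
        f ^ m • Finsupp.linearCombination k e (l.curry m) := by
    rw [Finsupp.linearCombination_apply,
      ← Finsupp.sum_curry_index l fun a j c => c • f ^ a • e j, Finsupp.sum]
    refine Finset.sum_subset_zero_on_sdiff (fun m hm => ?_) (fun m hm => ?_) fun m _ => ?_
    · exact Finset.mem_range_succ_iff.2 (Finset.le_sup (f := id) hm)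
    · rw [Finset.mem_sdiff, Finsupp.notMem_support_iff] at hm
      rw [hm.2, map_zero, smul_zero]
    · rw [Finsupp.linearCombination_apply, Finsupp.smul_sum]
      exact Finset.sum_congr rfl fun j _ => smul_comm _ _ _
  rw [hl] at h1
  have h2 := key _ _ h1.symm
  have h3 : l.curry = 0 := by
    ext1 m
    by_cases hm : m ∈ l.curry.support
    · exact h2 m (Nat.lt_succ_of_le (Finset.le_sup (f := id) hm))
    · exact Finsupp.notMem_support_iff.1 hm
  ext ⟨m, j⟩
  rw [← Finsupp.curry_apply, h3]
  rfl

/-- If a weakly regular sequence `f` acts on `M`, then elements of `M` that are linearly independent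
modulo `f` remain independent after multiplication by all the monomials in `f`. -/
theorem linearIndependent_prod_pow_smul {k R : Type*} {ι : Type*} [Field k] [CommRing R]
    [Algebra k R] {N : ℕ} (f : Fin N → R) {M : Type*}
    [AddCommGroup M] [Module R M] [Module k M] [IsScalarTower k R M]
    (hf : IsWeaklyRegular M (List.ofFn f)) {b : ι → M}
    (hb : LinearIndependent k fun i => (Submodule.Quotient.mk (b i) :
      M ⧸ (Ideal.ofList (List.ofFn f) • ⊤ : Submodule R M))) :
    LinearIndependent k fun x : (Fin N → ℕ) × ι => (∏ i, f i ^ x.1 i) • b x.2 := by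
  induction N generalizing M with
  | zero =>
    have h1 : LinearIndependent k b := LinearIndependent.of_comp
      ((Submodule.mkQ (Ideal.ofList (List.ofFn f) • ⊤ : Submodule R M)).restrictScalars k) hb
    have h2 := h1.comp (fun x : (Fin 0 → ℕ) × ι => x.2) fun x y h =>
      Prod.ext (Subsingleton.elim _ _) h
    convert h2 using 1
    ext x
    simp
  | succ N ih =>
    rw [List.ofFn_succ, isWeaklyRegular_cons_iff] at hf
    have h1 := ih (fun i => f i.succ) hf.2 (b := fun i => Submodule.Quotient.mk (b i)) (by
      let e := Submodule.quotOfListConsSMulTopEquivQuotSMulTopInner M (f 0)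
        (List.ofFn fun i => f i.succ)
      have hb' : LinearIndependent k fun i => (Submodule.Quotient.mk (b i) :
          M ⧸ (Ideal.ofList (f 0 :: List.ofFn fun i => f i.succ) • ⊤ : Submodule R M)) := by
        rw [List.ofFn_succ] at hb
        exact hb
      exact hb'.map' (e.toLinearMap.restrictScalars k) (LinearMap.ker_eq_bot.2 e.injective))
    have h2 := linearIndependent_pow_smul (k := k) (M := M) hf.1
      (e := fun x : (Fin N → ℕ) × ι => (∏ i : Fin N, f i.succ ^ x.1 i) • b x.2) h1
    have h3 := h2.comp (fun x : (Fin (N + 1) → ℕ) × ι => (x.1 0, (fun i => x.1 i.succ), x.2))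
      fun x y h => by
        simp only [Prod.mk.injEq] at h
        refine Prod.ext (funext fun i => ?_) h.2.2
        refine Fin.cases h.1 (fun i => congrFun h.2.1 i) i
    convert h3 using 1
    ext x
    rw [Fin.prod_univ_succ, mul_smul]
    rfl

/-- A sequence that is weakly regular on the outer terms of a short exact sequence is weakly
regular on the middle term. -/
theorem isWeaklyRegular_of_shortExact {R : Type*} [CommRing R] (rs : List R) {M₁ M₂ M₃ : Type*}
    [AddCommGroup M₁] [AddCommGroup M₂] [AddCommGroup M₃] [Module R M₁] [Module R M₂] [Module R M₃]
    {f : M₁ →ₗ[R] M₂} {g : M₂ →ₗ[R] M₃} (hf : Function.Injective f) (hfg : Function.Exact f g)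
    (hg : Function.Surjective g) (h₁ : IsWeaklyRegular M₁ rs) (h₃ : IsWeaklyRegular M₃ rs) :
    IsWeaklyRegular M₂ rs := by
  induction rs generalizing M₁ M₂ M₃ with
  | nil => exact IsWeaklyRegular.nil R M₂
  | cons r rs ih =>
    rw [isWeaklyRegular_cons_iff] at h₁ h₃ ⊢
    refine ⟨isSMulRegular_of_range_eq_ker hf hfg.linearMap_ker_eq.symm h₁.1 h₃.1,
      ih (f := QuotSMulTop.map r f) (g := QuotSMulTop.map r g) ?_
        (QuotSMulTop.map_exact r hfg hg) (QuotSMulTop.map_surjective r hg) h₁.2 h₃.2⟩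
    have h0 : Function.Exact (0 : PUnit →ₗ[R] M₁) f := fun x =>
      ⟨fun hx => ⟨0, by rw [LinearMap.zero_apply, hf (hx.trans f.map_zero.symm)]⟩,
        fun ⟨y, hy⟩ => by rw [← hy, LinearMap.zero_apply, map_zero]⟩
    have := QuotSMulTop.map_first_exact_on_four_term_exact_of_isSMulRegular_last h0 hfg h₃.1
    rw [map_zero] at this
    exact (injective_iff_map_eq_zero _).2 fun x hx => by
      obtain ⟨y, hy⟩ := (this x).1 hx
      rw [← hy, LinearMap.zero_apply]

theorem isWeaklyRegular_map_congr {R M ι : Type*} [CommRing R] [AddCommGroup M] [Module R M]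
    {a b : ι → R} (l : List ι) (h : ∀ i ∈ l, ∀ x : M, a i • x = b i • x) :
    IsWeaklyRegular M (l.map a) ↔ IsWeaklyRegular M (l.map b) := by
  refine (AddEquiv.refl M).isWeaklyRegular_congr ?_
  rw [List.forall₂_map_left_iff, List.forall₂_map_right_iff, List.forall₂_same]
  exact fun i hi x => h i hi x

/-- The coefficient of `u^m` in the product of the power series `∑ aᵢ uⁱ` and `∑ bᵢ uⁱ`. -/
def convCoeff {R : Type*} [CommRing R] (a b : ℕ → R) (m : ℕ) : R :=
  ∑ i ∈ Finset.range (m + 1), a i * b (m - i)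

theorem smul_quotSMulTop_eq_zero {R M : Type*} [CommRing R] [AddCommGroup M] [Module R M]
    (r s : R) (x : QuotSMulTop r M) : (r * s) • x = 0 := by
  obtain ⟨x, rfl⟩ := Submodule.Quotient.mk_surjective _ x
  rw [← Submodule.Quotient.mk_smul, Submodule.Quotient.mk_eq_zero, mul_smul]
  exact Submodule.smul_mem_pointwise_smul _ _ _ trivial

/-- The equations `a(u) b(u) = 0 mod uⁿ` of the jet scheme of a node form a regular sequence, as
soon as the coefficients of `a` and `b` do, in any order: modulo `a₀` or `b₀` they become the
equations of the jet scheme of one degree less. -/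
theorem isWeaklyRegular_convCoeff {R M : Type*} [CommRing R] [AddCommGroup M] [Module R M]
    (n : ℕ) (a b : ℕ → R)
    (h : ∀ l : List (ℕ ⊕ ℕ), l.Nodup → (∀ x ∈ l, Sum.elim id id x < n) →
      IsWeaklyRegular M (l.map (Sum.elim a b))) :
    IsWeaklyRegular M ((List.range n).map (convCoeff a b)) := by
  induction n generalizing a b M with
  | zero => exact IsWeaklyRegular.nil R M
  | succ n ih =>
    have ha : IsSMulRegular M (a 0) := by
      have := h [.inl 0] (List.nodup_singleton _) (by simp)
      simpa using this
    have hb : IsSMulRegular M (b 0) := by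
      have := h [.inr 0] (List.nodup_singleton _) (by simp)
      simpa using this
    have h0 : convCoeff a b 0 = a 0 * b 0 := by simp [convCoeff]
    rw [List.range_succ_eq_map, List.map_cons, List.map_map, isWeaklyRegular_cons_iff, h0]
    refine ⟨ha.mul hb, ?_⟩
    have hA : IsWeaklyRegular (QuotSMulTop (a 0) M)
        ((List.range n).map (convCoeff a b ∘ Nat.succ)) := by
      rw [isWeaklyRegular_map_congr (b := convCoeff (fun i => a (i + 1)) b)]
      · refine ih _ _ fun l hl hln => ?_
        have hinj : Function.Injective (Sum.map Nat.succ id : ℕ ⊕ ℕ → ℕ ⊕ ℕ) :=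
          Nat.succ_injective.sumMap Function.injective_id
        have := h (.inl 0 :: l.map (Sum.map Nat.succ id)) ?_ ?_
        · rw [List.map_cons, isWeaklyRegular_cons_iff, List.map_map, Sum.elim_comp_map] at this
          exact this.2
        · refine List.nodup_cons.2 ⟨fun hmem => ?_, hl.map hinj⟩
          obtain ⟨x | x, -, hx⟩ := List.mem_map.1 hmem <;> simp at hx
        · intro x hx
          rcases List.mem_cons.1 hx with rfl | hx
          · simp
          · obtain ⟨y | y, hy, rfl⟩ := List.mem_map.1 hx
            · simpa using hln _ hy
            · exact (hln _ hy).trans (Nat.lt_succ_self n)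
      · intro m _ x
        simp only [Function.comp_apply, convCoeff]
        rw [Finset.sum_range_succ', add_smul, smul_quotSMulTop_eq_zero, add_zero]
        simp only [Nat.succ_eq_add_one, Nat.add_sub_add_right]
    have hB : IsWeaklyRegular (QuotSMulTop (b 0) M)
        ((List.range n).map (convCoeff a b ∘ Nat.succ)) := by
      rw [isWeaklyRegular_map_congr (b := convCoeff a fun i => b (i + 1))]
      · refine ih _ _ fun l hl hln => ?_
        have hinj : Function.Injective (Sum.map id Nat.succ : ℕ ⊕ ℕ → ℕ ⊕ ℕ) :=
          Function.injective_id.sumMap Nat.succ_injective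
        have := h (.inr 0 :: l.map (Sum.map id Nat.succ)) ?_ ?_
        · rw [List.map_cons, isWeaklyRegular_cons_iff, List.map_map, Sum.elim_comp_map] at this
          exact this.2
        · refine List.nodup_cons.2 ⟨fun hmem => ?_, hl.map hinj⟩
          obtain ⟨x | x, -, hx⟩ := List.mem_map.1 hmem <;> simp at hx
        · intro x hx
          rcases List.mem_cons.1 hx with rfl | hx
          · simp
          · obtain ⟨y | y, hy, rfl⟩ := List.mem_map.1 hx
            · exact (hln _ hy).trans (Nat.lt_succ_self n)
            · simpa using hln _ hy
      · intro m _ x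
        simp only [Function.comp_apply, convCoeff]
        rw [Finset.sum_range_succ, add_smul, Nat.succ_eq_add_one, Nat.sub_self, mul_comm (a (m + 1)),
          smul_quotSMulTop_eq_zero, add_zero]
        refine congrArg (· • x) (Finset.sum_congr rfl fun i hi => ?_)
        rw [Nat.succ_sub (Finset.mem_range_succ_iff.1 hi)]
    -- the exact sequence `0 → M/b₀ → M/a₀b₀ → M/a₀ → 0`, the first map being multiplication by `a₀`
    let f : QuotSMulTop (b 0) M →ₗ[R] QuotSMulTop (a 0 * b 0) M :=
      Submodule.mapQ _ _ (LinearMap.lsmul R M (a 0)) (by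
        rintro _ ⟨x, -, rfl⟩
        exact ⟨x, trivial, mul_smul _ _ _⟩)
    let g : QuotSMulTop (a 0 * b 0) M →ₗ[R] QuotSMulTop (a 0) M :=
      Submodule.mapQ _ _ LinearMap.id (by
        rintro _ ⟨x, -, rfl⟩
        exact ⟨b 0 • x, trivial, (mul_smul _ _ _).symm⟩)
    refine isWeaklyRegular_of_shortExact _ (f := f) (g := g) ?_ ?_ ?_ hB hA
    · refine (injective_iff_map_eq_zero _).2 fun x hx => ?_
      obtain ⟨x, rfl⟩ := Submodule.Quotient.mk_surjective _ x
      obtain ⟨y, -, hy⟩ := (Submodule.Quotient.mk_eq_zero _).1 hx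
      refine (Submodule.Quotient.mk_eq_zero _).2 ⟨y, trivial, ha ?_⟩
      simpa [mul_smul] using hy
    · intro x
      obtain ⟨x, rfl⟩ := Submodule.Quotient.mk_surjective _ x
      constructor
      · intro hx
        obtain ⟨y, -, hy⟩ := (Submodule.Quotient.mk_eq_zero _).1 hx
        exact ⟨Submodule.Quotient.mk y, congrArg Submodule.Quotient.mk hy⟩
      · rintro ⟨y, hy⟩
        obtain ⟨y, rfl⟩ := Submodule.Quotient.mk_surjective _ y
        rw [← hy]
        exact (Submodule.Quotient.mk_eq_zero _).2 ⟨y, trivial, rfl⟩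
    · intro x
      obtain ⟨x, rfl⟩ := Submodule.Quotient.mk_surjective _ x
      exact ⟨Submodule.Quotient.mk x, rfl⟩

/-- Distinct variables form a weakly regular sequence. -/
theorem MvPolynomial.isWeaklyRegular_map_X {σ k : Type*} [CommRing k] (l : List σ) (hl : l.Nodup) :
    IsWeaklyRegular (MvPolynomial σ k) (l.map MvPolynomial.X : List (MvPolynomial σ k)) := by
  classical
  refine ⟨fun i hi => ?_⟩
  have hi' : i < l.length := by simpa using hi
  rw [isSMulRegular_quotient_iff_mem_of_smul_mem, List.getElem_map, ← List.map_take]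
  have hI : (Ideal.ofList ((l.take i).map (MvPolynomial.X : σ → MvPolynomial σ k)) • ⊤ :
      Submodule (MvPolynomial σ k) (MvPolynomial σ k))
      = Ideal.span (MvPolynomial.X '' {x | x ∈ l.take i}) := by
    rw [smul_eq_mul, Ideal.mul_top, Ideal.ofList]
    exact congrArg Ideal.span (Set.ext fun y => List.mem_map)
  rw [hI]
  intro F hF
  rw [smul_eq_mul] at hF
  rw [MvPolynomial.mem_ideal_span_X_image] at hF ⊢
  intro m hm
  obtain ⟨j, hj, hmj⟩ := hF (Finsupp.single l[i] 1 + m) (by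
    rw [MvPolynomial.mem_support_iff, add_comm, mul_comm, MvPolynomial.coeff_mul_X]
    exact MvPolynomial.mem_support_iff.1 hm)
  refine ⟨j, hj, fun h => hmj ?_⟩
  have hne : l[i] ≠ j := by
    rintro rfl
    obtain ⟨a, ha, hai⟩ := List.mem_take_iff_getElem.1 hj
    have := (List.Nodup.getElem_inj_iff hl).1 hai
    omega
  rw [Finsupp.add_apply, h, Finsupp.single_eq_of_ne' hne]

end RegularSequences

/-! ### Polynomial rings as free modules over regular sequences -/

section HomogeneousSpanning

/-- Graded Nakayama lemma: monomials spanning the quotient by homogeneous elements of positive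
degrees generate the polynomial ring over these elements, compatibly with the degrees. -/
theorem homogeneous_mem_span_of_quotient_span {k σ : Type*} [Field k] {w : σ → ℕ} {N : ℕ}
    {f : Fin N → MvPolynomial σ k} {d : Fin N → ℕ} (hd : ∀ i, 0 < d i)
    (hf : ∀ i, (f i).IsWeightedHomogeneous w (d i)) {S : Set (σ →₀ ℕ)}
    (hS : ∀ F : MvPolynomial σ k, ∃ G ∈ Submodule.span k
      ((fun m => MvPolynomial.monomial m (1 : k)) '' S), F - G ∈ Ideal.span (Set.range f))
    {n : ℕ} {F : MvPolynomial σ k} (hF : F.IsWeightedHomogeneous w n) :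
    F ∈ Submodule.span k {y | ∃ (α : Fin N → ℕ) (m : S),
      ∑ i, α i * d i + Finsupp.weight w m.1 = n
        ∧ (∏ i, f i ^ α i) * MvPolynomial.monomial m.1 1 = y} := by
  classical
  induction n using Nat.strong_induction_on generalizing F with
  | _ n ih =>
    set W : ℕ → Submodule k (MvPolynomial σ k) := fun n =>
      Submodule.span k {y | ∃ (α : Fin N → ℕ) (m : S),
        ∑ i, α i * d i + Finsupp.weight w m.1 = n
          ∧ (∏ i, f i ^ α i) * MvPolynomial.monomial m.1 1 = y} with hW
    have hmul : ∀ (i : Fin N) (a : ℕ) (G : MvPolynomial σ k), G ∈ W a → G * f i ∈ W (a + d i) := by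
      intro i a G hG
      have : W a ≤ (W (a + d i)).comap (LinearMap.mulRight k (f i)) := by
        refine Submodule.span_le.2 ?_
        rintro _ ⟨α, m, hα, rfl⟩
        refine Submodule.subset_span ⟨α + Pi.single i 1, m, ?_, ?_⟩
        · rw [← hα]
          simp only [Pi.add_apply, add_mul, Finset.sum_add_distrib]
          rw [Finset.sum_eq_single_of_mem (f := fun j => (Pi.single i 1 : Fin N → ℕ) j * d j) i
            (Finset.mem_univ i) fun j _ hj => by rw [Pi.single_eq_of_ne hj, zero_mul]]
          rw [Pi.single_eq_same]
          ring
        · simp only [Pi.add_apply, pow_add, Finset.prod_mul_distrib, LinearMap.mulRight_apply]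
          rw [Finset.prod_eq_single_of_mem (f := fun j => f j ^ (Pi.single i 1 : Fin N → ℕ) j) i
            (Finset.mem_univ i) fun j _ hj => by rw [Pi.single_eq_of_ne hj, pow_zero]]
          rw [Pi.single_eq_same, pow_one]
          ring
      exact this hG
    obtain ⟨G, hG, hFG⟩ := hS F
    obtain ⟨c, hc⟩ := Ideal.mem_span_range_iff_exists_fun.1 hFG
    have hFn : F = MvPolynomial.weightedHomogeneousComponent w n G
        + ∑ i, MvPolynomial.weightedHomogeneousComponent w n (c i * f i) := by
      rw [← map_sum, hc, ← map_add, add_sub_cancel, hF.weightedHomogeneousComponent_same]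
    rw [hFn]
    refine add_mem ?_ (Submodule.sum_mem _ fun i _ => ?_)
    · have : Submodule.span k ((fun m => MvPolynomial.monomial m (1 : k)) '' S)
          ≤ (W n).comap (MvPolynomial.weightedHomogeneousComponent w n) := by
        refine Submodule.span_le.2 ?_
        rintro _ ⟨m, hm, rfl⟩
        rw [SetLike.mem_coe, Submodule.mem_comap, MvPolynomial.weightedHomogeneousComponent_of_mem
          (MvPolynomial.isWeightedHomogeneous_monomial w m 1 rfl)]
        split_ifs with h
        · exact Submodule.subset_span ⟨0, ⟨m, hm⟩, by simpa using h.symm, by simp⟩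
        · exact zero_mem _
      exact this hG
    · rw [(c i).as_sum, Finset.sum_mul, map_sum]
      refine Submodule.sum_mem _ fun m _ => ?_
      have hm := MvPolynomial.isWeightedHomogeneous_monomial w m ((c i).coeff m) rfl
      rw [MvPolynomial.weightedHomogeneousComponent_of_mem (hm.mul (hf i))]
      split_ifs with h
      · rw [h]
        exact hmul i _ _ (ih _ (by have := hd i; omega) hm)
      · exact zero_mem _

/-- A weakly regular sequence of homogeneous polynomials of positive degrees makes the polynomial
ring a free module over the polynomials in the sequence, with a basis of monomials containing `1`.
-/
theorem exists_monomial_basis_of_isWeaklyRegular {k σ : Type*} [Field k] {w : σ → ℕ} {N : ℕ}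
    {f : Fin N → MvPolynomial σ k} {d : Fin N → ℕ} (hd : ∀ i, 0 < d i)
    (hf : ∀ i, (f i).IsWeightedHomogeneous w (d i))
    (hreg : RingTheory.Sequence.IsWeaklyRegular (MvPolynomial σ k) (List.ofFn f)) :
    ∃ S : Set (σ →₀ ℕ), 0 ∈ S ∧
      LinearIndependent k (fun x : (Fin N → ℕ) × S =>
        (∏ i, f i ^ x.1 i) * MvPolynomial.monomial x.2.1 (1 : k)) ∧
      ∀ (n : ℕ) (F : MvPolynomial σ k), F.IsWeightedHomogeneous w n →
        F ∈ Submodule.span k {y | ∃ (α : Fin N → ℕ) (m : S),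
          ∑ i, α i * d i + Finsupp.weight w m.1 = n
            ∧ (∏ i, f i ^ α i) * MvPolynomial.monomial m.1 1 = y} := by
  let I : Submodule (MvPolynomial σ k) (MvPolynomial σ k) := Ideal.ofList (List.ofFn f) • ⊤
  have hI : I = Ideal.span (Set.range f) := by
    change Ideal.ofList (List.ofFn f) • ⊤ = _
    rw [smul_eq_mul, Ideal.mul_top, Ideal.ofList]
    exact congrArg Ideal.span (Set.ext fun y => List.mem_ofFn)
  let v : (σ →₀ ℕ) → MvPolynomial σ k ⧸ I := fun m => Submodule.Quotient.mk (MvPolynomial.monomial m 1)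
  have h1 : LinearIndepOn k v {0} := by
    refine (linearIndepOn_singleton_iff k).2 fun h => ?_
    have hle : Ideal.span (Set.range f) ≤ RingHom.ker (MvPolynomial.constantCoeff (σ := σ) (R := k)) := by
      refine Ideal.span_le.2 ?_
      rintro _ ⟨i, rfl⟩
      rw [SetLike.mem_coe, RingHom.mem_ker, MvPolynomial.constantCoeff_eq]
      by_contra h0
      have := hf i h0
      rw [map_zero] at this
      exact (hd i).ne this
    have h2 : MvPolynomial.monomial 0 (1 : k) ∈ I := (Submodule.Quotient.mk_eq_zero _).1 h
    rw [hI] at h2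
    have := hle h2
    simp [RingHom.mem_ker] at this
  obtain ⟨S, -, h0S, hspan, hli⟩ := exists_linearIndepOn_extension h1 (Set.subset_univ _)
  have hli' := linearIndependent_prod_pow_smul (k := k) f hreg
    (b := fun m : S => MvPolynomial.monomial m.1 (1 : k)) hli
  simp only [smul_eq_mul] at hli'
  refine ⟨S, h0S rfl, hli', fun n F hF => ?_⟩
  refine homogeneous_mem_span_of_quotient_span hd hf (fun F => ?_) hF
  have htop : ∀ F : MvPolynomial σ k, (Submodule.Quotient.mk F : MvPolynomial σ k ⧸ I)
      ∈ Submodule.span k (v '' S) := by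
    intro F
    rw [F.as_sum]
    have : (Submodule.Quotient.mk (∑ m ∈ F.support, MvPolynomial.monomial m (F.coeff m)) :
        MvPolynomial σ k ⧸ I) = ∑ m ∈ F.support, F.coeff m • v m := by
      rw [← Submodule.mkQ_apply, map_sum]
      refine Finset.sum_congr rfl fun m _ => ?_
      rw [Submodule.mkQ_apply, ← Submodule.Quotient.mk_smul, MvPolynomial.smul_monomial,
        smul_eq_mul, mul_one]
    rw [this]
    exact Submodule.sum_mem _ fun m _ => Submodule.smul_mem _ _ (hspan ⟨m, trivial, rfl⟩)
  have hmap : Submodule.span k (v '' S) = (Submodule.span k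
      ((fun m => MvPolynomial.monomial m (1 : k)) '' S)).map (I.mkQ.restrictScalars k) := by
    rw [Submodule.map_span, Set.image_image]
    rfl
  have := htop F
  rw [hmap] at this
  obtain ⟨G, hG, hGF⟩ := this
  refine ⟨G, hG, ?_⟩
  rw [← hI]
  exact (Submodule.Quotient.eq I).1 hGF.symm

end HomogeneousSpanning

/-! ### Symbols of the generators of Γ -/

section Symbols

variable (𝕜 : Type u) [Field 𝕜] (p : ℕ)

/-- The symbol of `t_{ij}^{(r)}`, for arbitrary `r ≥ 0`. -/
def symbolT (i j : Fin 2) : ℕ → MvPolynomial (Letter p) 𝕜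
  | 0 => if i = j then 1 else 0
  | r + 1 => if h : r < p then MvPolynomial.X (i, j, ⟨r, h⟩) else 0

/-- The symbol of the coefficient of `u^a` in `T_{ij}(u)`. -/
def symbolTCoeff (i j : Fin 2) (a : ℕ) : MvPolynomial (Letter p) 𝕜 :=
  if a ≤ p then symbolT 𝕜 p i j (p - a) else 0

/-- The symbol of the coefficient of `u^m` in the quantum determinant: the coefficient of the
ordinary determinant. -/
def symbolDetCoeff (m : ℕ) : MvPolynomial (Letter p) 𝕜 :=
  ∑ x ∈ Finset.HasAntidiagonal.antidiagonal m, (symbolTCoeff 𝕜 p 0 0 x.1 * symbolTCoeff 𝕜 p 1 1 x.2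
    - symbolTCoeff 𝕜 p 1 0 x.1 * symbolTCoeff 𝕜 p 0 1 x.2)

variable {𝕜 p}

theorem hasPolySymbol_yangianT (i j : Fin 2) (r : ℕ) :
    HasPolySymbol r (yangianT 𝕜 p i j r) (symbolT 𝕜 p i j r) := by
  cases r with
  | zero =>
    rw [yangianT_zero, symbolT]
    split_ifs
    · exact .one
    · exact .of_mem (zero_mem _)
  | succ r =>
    rw [symbolT]
    split_ifs with h
    · exact HasPolySymbol.letter ((i, j, ⟨r, h⟩) : Letter p)
    · rw [yangianT_of_lt 𝕜 p i j _ (by omega)]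
      exact .of_mem (zero_mem _)

theorem hasPolySymbol_yangianTPoly_coeff (i j : Fin 2) {a : ℕ} (ha : a ≤ p) :
    HasPolySymbol (p - a) ((yangianTPoly 𝕜 p i j).coeff a) (symbolTCoeff 𝕜 p i j a) := by
  rw [yangianTPoly_coeff, if_pos ha, symbolTCoeff, if_pos ha]
  exact hasPolySymbol_yangianT i j (p - a)

theorem coeff_comp_X_sub_one {A : Type*} [Ring A] (f : A[X]) {n : ℕ} (hf : f.natDegree ≤ n)
    (b : ℕ) : (f.comp (X - 1)).coeff b
      = ∑ a ∈ Finset.range (n + 1), (((X - 1) ^ a : ℤ[X]).coeff b) • f.coeff a := by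
  rw [comp, eval₂_eq_sum_range' C (Nat.lt_succ_of_le hf), finsetSum_coeff]
  refine Finset.sum_congr rfl fun a _ => ?_
  have h : ((X - 1) ^ a : A[X]) = ((X - 1) ^ a : ℤ[X]).map (Int.castRingHom A) := by simp
  rw [coeff_C_mul, h, coeff_map, eq_intCast, zsmul_eq_mul]
  exact (Int.cast_commute _ _).eq.symm

/-- The shift `u ↦ u - 1` does not change symbols. -/
theorem hasPolySymbol_yangianTPoly_comp_coeff (i j : Fin 2) {b : ℕ} (hb : b ≤ p) :
    HasPolySymbol (p - b) (((yangianTPoly 𝕜 p i j).comp (X - 1)).coeff b)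
      (symbolTCoeff 𝕜 p i j b) := by
  have hdeg : ∀ a, ((X - 1) ^ a : ℤ[X]).natDegree = a := fun a => by
    rw [natDegree_pow, ← C_1, natDegree_X_sub_C, mul_one]
  rw [coeff_comp_X_sub_one _ (yangianTPoly_natDegree_le 𝕜 p i j),
    ← Finset.add_sum_erase _ _ (Finset.mem_range_succ_iff.2 hb), ← add_zero (symbolTCoeff 𝕜 p i j b)]
  refine HasPolySymbol.add ?_ (.of_mem (Submodule.sum_mem _ fun a ha => ?_))
  · have : ((X - 1) ^ b : ℤ[X]).coeff b = 1 := by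
      have h := ((monic_X_sub_C (1 : ℤ)).pow b).coeff_natDegree
      rwa [C_1, hdeg] at h
    rw [this, one_smul]
    exact hasPolySymbol_yangianTPoly_coeff i j hb
  · rw [Finset.mem_erase, Finset.mem_range] at ha
    rcases lt_or_gt_of_ne ha.1 with h | h
    · rw [coeff_eq_zero_of_natDegree_lt (by rw [hdeg]; exact h), zero_smul]
      exact zero_mem _
    · refine zsmul_mem ?_ _
      rw [yangianTPoly_coeff, if_pos (by omega)]
      exact yangianT_mem_weightFiltration i j (by omega)

theorem yangianTPoly_comp_coeff_of_lt (i j : Fin 2) {b : ℕ} (hb : p < b) :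
    ((yangianTPoly 𝕜 p i j).comp (X - 1)).coeff b = 0 := by
  rw [coeff_comp_X_sub_one _ (yangianTPoly_natDegree_le 𝕜 p i j)]
  refine Finset.sum_eq_zero fun a ha => ?_
  rw [coeff_eq_zero_of_natDegree_lt, zero_smul]
  rw [natDegree_pow, ← C_1, natDegree_X_sub_C, mul_one]
  simp at ha
  omega

theorem hasPolySymbol_quantumDet_coeff (m : ℕ) :
    HasPolySymbol (2 * p - m) ((quantumDet 𝕜 p).coeff m) (symbolDetCoeff 𝕜 p m) := by
  have key : ∀ (i j a b : Fin 2) (x : ℕ × ℕ), x ∈ Finset.HasAntidiagonal.antidiagonal m →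
      HasPolySymbol (2 * p - m) ((yangianTPoly 𝕜 p i j).coeff x.1
          * ((yangianTPoly 𝕜 p a b).comp (X - 1)).coeff x.2)
        (symbolTCoeff 𝕜 p i j x.1 * symbolTCoeff 𝕜 p a b x.2) := by
    intro i j a b x hx
    rw [Finset.HasAntidiagonal.mem_antidiagonal] at hx
    rcases lt_or_ge p x.1 with h1 | h1
    · rw [yangianTPoly_coeff, if_neg (by omega), symbolTCoeff, if_neg (by omega), zero_mul, zero_mul]
      exact .of_mem (zero_mem _)
    rcases lt_or_ge p x.2 with h2 | h2
    · rw [yangianTPoly_comp_coeff_of_lt a b h2, symbolTCoeff, symbolTCoeff, if_neg (by omega : ¬ x.2 ≤ p),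
        mul_zero, mul_zero]
      exact .of_mem (zero_mem _)
    rw [show 2 * p - m = (p - x.1) + (p - x.2) by omega]
    exact (hasPolySymbol_yangianTPoly_coeff i j h1).mul (hasPolySymbol_yangianTPoly_comp_coeff a b h2)
  rw [quantumDet, coeff_sub, coeff_mul, coeff_mul, ← Finset.sum_sub_distrib, symbolDetCoeff]
  exact HasPolySymbol.sum _ fun x hx => (key 0 0 1 1 x hx).sub (key 1 0 0 1 x hx)

end Symbols

/-! ### Regularity of the symbols of the generators of Γ -/

section RegularSymbols

open RingTheory.Sequence

variable (𝕜 : Type u) [Field 𝕜] (p : ℕ)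

/-- A surjective endomorphism of a Noetherian ring is injective, by stabilization of the kernels of
its powers. -/
theorem injective_of_surjective_ringHom {R : Type*} [CommRing R] [IsNoetherianRing R] (f : R →+* R)
    (hf : Function.Surjective f) : Function.Injective f := by
  have hmono : Monotone fun n : ℕ => RingHom.ker (f ^ n) := monotone_nat_of_le_succ fun n x hx => by
    rw [RingHom.mem_ker] at hx ⊢
    rw [pow_succ', RingHom.mul_def, RingHom.comp_apply, hx, map_zero]
  obtain ⟨n, hn⟩ := monotone_stabilizes_iff_noetherian.2 ‹IsNoetherianRing R› ⟨_, hmono⟩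
  refine (injective_iff_map_eq_zero f).2 fun x hx => ?_
  have hfn : Function.Surjective (f ^ n) := by
    rw [RingHom.coe_pow]
    exact hf.iterate n
  obtain ⟨y, rfl⟩ := hfn x
  have hy : y ∈ RingHom.ker (f ^ (n + 1)) := by
    rw [RingHom.mem_ker, pow_succ', RingHom.mul_def, RingHom.comp_apply, hx]
  have h : RingHom.ker (f ^ n) = RingHom.ker (f ^ (n + 1)) := hn (n + 1) n.le_succ
  rwa [← h, RingHom.mem_ker] at hy

/-- The change of variables which replaces `t₁₁^{(r)}` by the symbol of the coefficient of
`u^{2p-r}` in the quantum determinant, and reverses the sign of `t₂₁^{(r)}`, so that the product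
`-t₂₁(u) t₁₂(u)` in the determinant becomes a plain product. -/
def detVariable (x : Letter p) : MvPolynomial (Letter p) 𝕜 :=
  if x.1 = 0 then
    if x.2.1 = 0 then symbolDetCoeff 𝕜 p (2 * p - (x.2.2 + 1)) else MvPolynomial.X x
  else if x.2.1 = 0 then -MvPolynomial.X x else MvPolynomial.X x

variable {𝕜 p}

/-- The symbols `t₁₁^{(r)}` are recovered by induction on `r`: since `T₂₂(u)` is monic, the
coefficient of `u^{2p-r}` in the determinant is `t₁₁^{(r)}` plus an expression in `t₁₁^{(s)}` with
`s < r` and in the other variables. -/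
theorem aeval_detVariable_surjective :
    Function.Surjective (MvPolynomial.aeval (R := 𝕜) (detVariable 𝕜 p)) := by
  let A := (MvPolynomial.aeval (R := 𝕜) (detVariable 𝕜 p)).range
  have hy : ∀ x, detVariable 𝕜 p x ∈ A := fun x => ⟨MvPolynomial.X x, MvPolynomial.aeval_X _ x⟩
  have hoff : ∀ i j, (i, j) ≠ ((0 : Fin 2), (0 : Fin 2)) → ∀ r, symbolT 𝕜 p i j r ∈ A := by
    intro i j hij r
    cases r with
    | zero =>
      rw [symbolT]
      split_ifs
      · exact one_mem A
      · exact zero_mem A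
    | succ r =>
      rw [symbolT]
      split_ifs with h
      · have := hy (i, j, ⟨r, h⟩)
        simp only [detVariable] at this
        split_ifs at this with h1 h2 h2
        · exact absurd (by rw [h1, h2]) hij
        · exact this
        · simpa using neg_mem this
        · exact this
      · exact zero_mem A
  have hoff' : ∀ i j, (i, j) ≠ ((0 : Fin 2), (0 : Fin 2)) → ∀ a, symbolTCoeff 𝕜 p i j a ∈ A := by
    intro i j hij a
    rw [symbolTCoeff]
    split_ifs
    · exact hoff i j hij _
    · exact zero_mem A
  have hon : ∀ r, symbolT 𝕜 p 0 0 r ∈ A := by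
    intro r
    induction r using Nat.strong_induction_on with
    | _ r ih =>
      rcases Nat.eq_zero_or_pos r with rfl | hr
      · exact one_mem A
      rcases lt_or_ge p r with hrp | hrp
      · obtain ⟨r, rfl⟩ := Nat.exists_eq_succ_of_ne_zero hr.ne'
        rw [symbolT, dif_neg (by omega)]
        exact zero_mem A
      have hdet : symbolDetCoeff 𝕜 p (2 * p - r) ∈ A := by
        have := hy (0, 0, ⟨r - 1, by omega⟩)
        simp only [detVariable, if_true] at this
        rwa [Nat.sub_add_cancel hr] at this
      have hmem : (p - r, p) ∈ Finset.HasAntidiagonal.antidiagonal (2 * p - r) := by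
        rw [Finset.HasAntidiagonal.mem_antidiagonal]
        omega
      have h11 : symbolTCoeff 𝕜 p 1 1 p = 1 := by simp [symbolTCoeff, symbolT]
      have h00 : symbolTCoeff 𝕜 p 0 0 (p - r) = symbolT 𝕜 p 0 0 r := by
        rw [symbolTCoeff, if_pos (Nat.sub_le _ _), Nat.sub_sub_self hrp]
      rw [symbolDetCoeff, Finset.sum_sub_distrib, ← Finset.add_sum_erase _ _ hmem, h11, mul_one, h00,
        add_sub_assoc] at hdet
      refine (add_mem_cancel_right (sub_mem (sum_mem fun x hx => ?_) (sum_mem fun x _ => ?_))).1 hdet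
      · rw [Finset.mem_erase, Finset.HasAntidiagonal.mem_antidiagonal] at hx
        rcases lt_or_ge p x.2 with h0 | h0
        · have h : symbolTCoeff 𝕜 p 1 1 x.2 = 0 := if_neg (by omega)
          rw [h, mul_zero]
          exact zero_mem A
        refine mul_mem ?_ (hoff' 1 1 (by decide) _)
        rw [symbolTCoeff]
        split_ifs with h1
        · rcases lt_or_ge (p - x.1) r with h2 | h2
          · exact ih _ h2
          · exact absurd (Prod.ext (by simp only; omega) (by simp only; omega)) hx.1
        · exact zero_mem A
      · exact mul_mem (hoff' 1 0 (by decide) _) (hoff' 0 1 (by decide) _)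
  refine AlgHom.range_eq_top _ |>.1 (top_le_iff.1 ?_)
  rw [← MvPolynomial.adjoin_range_X]
  refine Algebra.adjoin_le ?_
  rintro _ ⟨⟨i, j, r⟩, rfl⟩
  have h : symbolT 𝕜 p i j (r + 1) = MvPolynomial.X (i, j, r) := by simp [symbolT]
  rw [SetLike.mem_coe, ← h]
  by_cases hij : (i, j) = ((0 : Fin 2), (0 : Fin 2))
  · obtain ⟨rfl, rfl⟩ := Prod.mk.inj hij
    exact hon _
  · exact hoff i j hij _

/-- The elements `detVariable` are polynomial generators, hence form a weakly regular sequence in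
any order. -/
theorem isWeaklyRegular_map_detVariable (l : List (Letter p)) (hl : l.Nodup) :
    IsWeaklyRegular (MvPolynomial (Letter p) 𝕜) (l.map (detVariable 𝕜 p)) := by
  have hbij : Function.Bijective (MvPolynomial.aeval (R := 𝕜) (detVariable 𝕜 p)) :=
    ⟨injective_of_surjective_ringHom
      (MvPolynomial.aeval (R := 𝕜) (detVariable 𝕜 p)).toRingHom aeval_detVariable_surjective,
      aeval_detVariable_surjective⟩
  let e := AlgEquiv.ofBijective _ hbij
  refine (AddEquiv.isWeaklyRegular_congr (e := e.toAddEquiv)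
    (as := l.map MvPolynomial.X) ?_).1 (MvPolynomial.isWeaklyRegular_map_X l hl)
  rw [List.forall₂_map_left_iff, List.forall₂_map_right_iff, List.forall₂_same]
  intro x _ F
  change e (MvPolynomial.X x * F) = _
  rw [map_mul]
  congr 1
  exact MvPolynomial.aeval_X _ x

/-- The letter naming the coefficient of `u^a` in `T_{ij}(u)`, for `a < p`. -/
def coeffLetter (hp : 0 < p) (i j : Fin 2) (a : ℕ) : Letter p := (i, j, ⟨p - 1 - a, by omega⟩)

theorem symbolTCoeff_of_lt (hp : 0 < p) (i j : Fin 2) {a : ℕ} (ha : a < p) :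
    symbolTCoeff 𝕜 p i j a = MvPolynomial.X (coeffLetter hp i j a) := by
  rw [symbolTCoeff, if_pos ha.le, show p - a = p - 1 - a + 1 by omega, symbolT, dif_pos (by omega)]
  rfl

theorem symbolDetCoeff_eq_detVariable (hp : 0 < p) {a : ℕ} (ha : a < p) :
    symbolDetCoeff 𝕜 p (p + a) = detVariable 𝕜 p (coeffLetter hp 0 0 a) := by
  simp only [detVariable, coeffLetter, if_true]
  congr 1
  omega

theorem coeffLetter_inj (hp : 0 < p) {i j i' j' : Fin 2} {a b : ℕ} (ha : a < p) (hb : b < p)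
    (h : coeffLetter hp i j a = coeffLetter hp i' j' b) : i = i' ∧ j = j' ∧ a = b := by
  simp only [coeffLetter, Prod.mk.injEq, Fin.mk.injEq] at h
  exact ⟨h.1, h.2.1, by omega⟩

/-- Names for the generators of `Γ`: `inl a` stands for the coefficient of `u^a` in `T₂₂(u)`, and
`inr m` for the coefficient of `u^m` in the quantum determinant. -/
def gammaIndices (p : ℕ) : List (ℕ ⊕ ℕ) :=
  (List.range p).map Sum.inl ++ ((List.range p).map fun a => Sum.inr (p + a))
    ++ (List.range p).map Sum.inr

/-- The symbols of the generators of `Γ` form a weakly regular sequence. -/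
theorem isWeaklyRegular_gammaIndices (hp : 0 < p) :
    IsWeaklyRegular (MvPolynomial (Letter p) 𝕜)
      ((gammaIndices p).map (Sum.elim (symbolTCoeff 𝕜 p 1 1) (symbolDetCoeff 𝕜 p))) := by
  classical
  let l₁ : List (Letter p) := (List.range p).map (coeffLetter hp 1 1)
    ++ (List.range p).map (coeffLetter hp 0 0)
  have hnd : ∀ i j, ((List.range p).map (coeffLetter hp i j)).Nodup := fun i j =>
    List.Nodup.map_on (fun a ha b hb h =>
      (coeffLetter_inj hp (List.mem_range.1 ha) (List.mem_range.1 hb) h).2.2) List.nodup_range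
  have hl₁ : l₁.Nodup := by
    refine (List.nodup_append'.2 ⟨hnd 1 1, hnd 0 0, fun x hx hx' => ?_⟩)
    obtain ⟨a, ha, rfl⟩ := List.mem_map.1 hx
    obtain ⟨b, hb, h⟩ := List.mem_map.1 hx'
    have := coeffLetter_inj hp (List.mem_range.1 hb) (List.mem_range.1 ha) h
    exact absurd this.1 (by decide)
  have h11 : ∀ a < p, symbolTCoeff 𝕜 p 1 1 a = detVariable 𝕜 p (coeffLetter hp 1 1 a) :=
    fun a ha => by
      rw [symbolTCoeff_of_lt hp 1 1 ha]
      simp [detVariable, coeffLetter]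
  have hmap : ((gammaIndices p).map (Sum.elim (symbolTCoeff 𝕜 p 1 1) (symbolDetCoeff 𝕜 p)))
      = l₁.map (detVariable 𝕜 p) ++ (List.range p).map (symbolDetCoeff 𝕜 p) := by
    simp only [gammaIndices, l₁, List.map_append, List.map_map]
    congr 2
    · exact List.map_congr_left fun a ha => h11 a (List.mem_range.1 ha)
    · exact List.map_congr_left fun a ha => symbolDetCoeff_eq_detVariable hp (List.mem_range.1 ha)
  rw [hmap, isWeaklyRegular_append_iff]
  refine ⟨isWeaklyRegular_map_detVariable l₁ hl₁, ?_⟩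
  have hzero : ∀ a < p, ∀ (F : MvPolynomial (Letter p) 𝕜) (x : MvPolynomial (Letter p) 𝕜 ⧸
      (Ideal.ofList (l₁.map (detVariable 𝕜 p)) • ⊤ :
        Submodule (MvPolynomial (Letter p) 𝕜) (MvPolynomial (Letter p) 𝕜))),
      (F * symbolTCoeff 𝕜 p 1 1 a) • x = 0 := by
    intro a ha F x
    obtain ⟨x, rfl⟩ := Submodule.Quotient.mk_surjective _ x
    rw [← Submodule.Quotient.mk_smul, Submodule.Quotient.mk_eq_zero]
    refine Submodule.smul_mem_smul (Ideal.mul_mem_left _ _ (Ideal.subset_span ?_)) trivial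
    rw [h11 a ha]
    exact List.mem_map_of_mem (List.mem_append_left _ (List.mem_map_of_mem (List.mem_range.2 ha)))
  rw [isWeaklyRegular_map_congr (b := convCoeff (fun a => detVariable 𝕜 p (coeffLetter hp 1 0 a))
    fun a => detVariable 𝕜 p (coeffLetter hp 0 1 a))]
  · refine isWeaklyRegular_convCoeff p _ _ fun l hl hlp => ?_
    let g : ℕ ⊕ ℕ → Letter p := Sum.elim (coeffLetter hp 1 0) (coeffLetter hp 0 1)
    have hg : l.map (Sum.elim (fun a => detVariable 𝕜 p (coeffLetter hp 1 0 a))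
        fun a => detVariable 𝕜 p (coeffLetter hp 0 1 a)) = (l.map g).map (detVariable 𝕜 p) := by
      rw [List.map_map]
      congr 1
      ext1 x
      cases x <;> rfl
    rw [hg]
    refine (isWeaklyRegular_append_iff _ _ _).1 ?_ |>.2
    rw [← List.map_append]
    refine isWeaklyRegular_map_detVariable _ (List.nodup_append'.2 ⟨hl₁, ?_, fun x hx hx' => ?_⟩)
    · refine List.Nodup.map_on (fun a ha b hb h => ?_) hl
      have h1 := hlp a ha
      have h2 := hlp b hb
      rcases a with a | a <;> rcases b with b | b <;>
        simp only [g, Sum.elim_inl, Sum.elim_inr, id] at h h1 h2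
      · rw [(coeffLetter_inj hp h1 h2 h).2.2]
      · exact absurd (coeffLetter_inj hp h1 h2 h).1 (by decide)
      · exact absurd (coeffLetter_inj hp h1 h2 h).1 (by decide)
      · rw [(coeffLetter_inj hp h1 h2 h).2.2]
    · have e1 : x.1 = x.2.1 := by
        rcases List.mem_append.1 hx with h | h <;> obtain ⟨a, -, rfl⟩ := List.mem_map.1 h <;> rfl
      obtain ⟨a | a, -, rfl⟩ := List.mem_map.1 hx' <;> exact absurd e1 (by simp [g, coeffLetter])
  · intro m hm x
    rw [List.mem_range] at hm
    rw [symbolDetCoeff, convCoeff, Finset.Nat.sum_antidiagonal_eq_sum_range_succ_mk,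
      Finset.sum_smul, Finset.sum_smul]
    refine Finset.sum_congr rfl fun i hi => ?_
    have hi' := Finset.mem_range_succ_iff.1 hi
    rw [sub_smul, hzero (m - i) (by omega), zero_sub, ← neg_smul,
      symbolTCoeff_of_lt hp 1 0 (by omega : i < p), symbolTCoeff_of_lt hp 0 1 (by omega : m - i < p)]
    simp [detVariable, coeffLetter]

end RegularSymbols

/-! ### Perturbation of bases and extension of scalars -/

section BasisLemmas

/-- A family that differs from a basis by terms of lower degree is again linearly independent and
spanning. -/
theorem linearIndependent_and_span_of_sub_mem {k U J : Type*} [Ring k] [AddCommGroup U]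
    [Module k U] (b : Module.Basis J k U) (deg : J → ℕ) (v : J → U)
    (h : ∀ j, v j - b j ∈ Submodule.span k (b '' {i | deg i < deg j})) :
    LinearIndependent k v ∧ Submodule.span k (Set.range v) = ⊤ := by
  let G : ℕ → Submodule k U := fun n => Submodule.span k (b '' {i | deg i < n})
  let D : (J →₀ k) →ₗ[k] U := Finsupp.linearCombination k fun j => v j - b j
  have hD : ∀ n x, b.repr.symm x ∈ G (n + 1) → D x ∈ G n := by
    intro n x hx
    rw [Module.Basis.repr_symm_apply, Module.Basis.mem_span_image, ← b.repr_symm_apply,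
      LinearEquiv.apply_symm_apply] at hx
    rw [Finsupp.linearCombination_apply, Finsupp.sum]
    refine Submodule.sum_mem _ fun j hj => Submodule.smul_mem _ _ (Submodule.span_mono ?_ (h j))
    exact Set.image_mono fun i hi => lt_of_lt_of_le hi (Nat.le_of_lt_succ (hx hj))
  have hK : ∀ x, Finsupp.linearCombination k v x = b.repr.symm x + D x := by
    intro x
    rw [Module.Basis.repr_symm_apply, Finsupp.linearCombination_apply,
      Finsupp.linearCombination_apply, Finsupp.linearCombination_apply, Finsupp.sum, Finsupp.sum,
      Finsupp.sum, ← Finset.sum_add_distrib]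
    refine Finset.sum_congr rfl fun j _ => ?_
    rw [← smul_add, add_sub_cancel]
  have hG0 : G 0 = ⊥ := by simp [G]
  have hG : ∀ y, ∃ n, y ∈ G n := by
    intro y
    refine ⟨(b.repr y).support.sup deg + 1, b.mem_span_image.2 fun j hj => ?_⟩
    exact Nat.lt_succ_of_le (Finset.le_sup hj)
  constructor
  · refine (injective_iff_map_eq_zero (Finsupp.linearCombination k v)).2 fun x hx => ?_
    have key : ∀ n, b.repr.symm x ∈ G n → b.repr.symm x = 0 := by
      intro n
      induction n with
      | zero => rw [hG0]; exact id
      | succ n ih =>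
        intro hn
        refine ih ?_
        rw [hK] at hx
        rw [eq_neg_of_add_eq_zero_left hx]
        exact neg_mem (hD n x hn)
    obtain ⟨n, hn⟩ := hG (b.repr.symm x)
    exact b.repr.symm.map_eq_zero_iff.1 (key n hn)
  · rw [← Finsupp.range_linearCombination, eq_top_iff]
    have key : ∀ n, G n ≤ LinearMap.range (Finsupp.linearCombination k v) := by
      intro n
      induction n with
      | zero => rw [hG0]; exact bot_le
      | succ n ih =>
        intro y hy
        have h1 := hK (b.repr y)
        rw [LinearEquiv.symm_apply_apply] at h1
        rw [eq_sub_of_add_eq h1.symm]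
        exact sub_mem ⟨_, rfl⟩ (ih (hD n _ (by rwa [LinearEquiv.symm_apply_apply])))
    intro y _
    obtain ⟨n, hn⟩ := hG y
    exact key n hn

/-- If `g` spans the `k`-algebra `R` and the products `g a • e s` form a basis over `k` of an
`R`-module `V`, then the `e s` form a basis of `V` over `R`. -/
theorem linearIndependent_of_smul_prod {k R V A S : Type*} [CommRing k] [Ring R] [Algebra k R]
    [AddCommGroup V] [Module k V] [Module R V] [IsScalarTower k R V] (g : A → R) (e : S → V)
    (hg : Submodule.span k (Set.range g) = ⊤)
    (h : LinearIndependent k (fun x : A × S => g x.1 • e x.2)) : LinearIndependent R e := by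
  have hsurj : Function.Surjective (Finsupp.linearCombination k g) := by
    rw [← LinearMap.range_eq_top, Finsupp.range_linearCombination, hg]
  have h' := h.comp Prod.swap Prod.swap_injective
  have hcomp : ∀ z : S →₀ A →₀ k, Finsupp.linearCombination R e
      (Finsupp.mapRange (Finsupp.linearCombination k g) (map_zero _) z)
        = Finsupp.linearCombination k ((fun x : A × S => g x.1 • e x.2) ∘ Prod.swap) z.uncurry := by
    intro z
    rw [Finsupp.linearCombination_apply, Finsupp.linearCombination_apply]
    change _ = z.uncurry.sum fun x c => c • (g x.2 • e x.1)
    rw [Finsupp.sum_uncurry_index' _ fun s a c => c • (g a • e s),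
      Finsupp.sum_mapRange_index fun s => zero_smul R (e s)]
    refine Finsupp.sum_congr fun s _ => ?_
    rw [Finsupp.linearCombination_apply, Finsupp.sum, Finset.sum_smul]
    exact Finset.sum_congr rfl fun a _ => smul_assoc _ _ _
  intro x y hxy
  have hm := Finsupp.mapRange_surjective (α := S) _ (map_zero (Finsupp.linearCombination k g)) hsurj
  obtain ⟨x, rfl⟩ := hm x
  obtain ⟨y, rfl⟩ := hm y
  rw [hcomp, hcomp] at hxy
  rw [← Finsupp.curry_uncurry x, h' hxy, Finsupp.curry_uncurry]

/-- Spanning counterpart of `linearIndependent_of_smul_prod`. -/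
theorem span_eq_top_of_smul_prod {k R V A S : Type*} [CommRing k] [Ring R] [Algebra k R]
    [AddCommGroup V] [Module k V] [Module R V] [IsScalarTower k R V] (g : A → R) (e : S → V)
    (h : Submodule.span k (Set.range fun x : A × S => g x.1 • e x.2) = ⊤) :
    Submodule.span R (Set.range e) = ⊤ := by
  have : Submodule.span k (Set.range fun x : A × S => g x.1 • e x.2)
      ≤ (Submodule.span R (Set.range e)).restrictScalars k := by
    refine Submodule.span_le.2 ?_
    rintro _ ⟨x, rfl⟩
    exact Submodule.smul_mem (Submodule.span R (Set.range e)) _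
      (Submodule.subset_span (Set.mem_range_self x.2))
  rw [h] at this
  exact eq_top_iff.2 fun y _ => this trivial

theorem Module.Basis.isCompl_span_singleton {R V S : Type*} [Ring R] [AddCommGroup V] [Module R V]
    (b : Module.Basis S R V) (s : S) :
    IsCompl (Submodule.span R {b s}) (Submodule.span R (b '' {s}ᶜ)) := by
  rw [← Set.image_singleton]
  constructor
  · exact b.linearIndependent.disjoint_span_image disjoint_compl_right
  · rw [codisjoint_iff, ← Submodule.span_union, ← Set.image_union, Set.union_compl_self,
      Set.image_univ, b.span_eq]

theorem span_prod_pow_eq_top {k R ι : Type*} [CommRing k] [CommRing R] [Algebra k R] [Fintype ι]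
    (γ : ι → R) (h : Algebra.adjoin k (Set.range γ) = ⊤) :
    Submodule.span k (Set.range fun α : ι → ℕ => ∏ i, γ i ^ α i) = ⊤ := by
  rw [eq_top_iff]
  intro x _
  have hx : x ∈ Algebra.adjoin k (Set.range γ) := h ▸ trivial
  rw [Algebra.adjoin_range_eq_range_aeval] at hx
  obtain ⟨F, rfl⟩ := hx
  change MvPolynomial.aeval γ F ∈ _
  rw [MvPolynomial.aeval_def, MvPolynomial.eval₂_eq']
  refine Submodule.sum_mem _ fun m _ => ?_
  rw [← Algebra.smul_def]
  exact Submodule.smul_mem _ _ (Submodule.subset_span ⟨m, rfl⟩)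

end BasisLemmas

/-! ### Bases of the Yangian lifted from symbols -/

section GammaBasis

variable {𝕜 : Type u} [Field 𝕜] {p : ℕ}

theorem HasPolySymbol.list_prod {N : ℕ} {d : Fin N → ℕ} {y : Fin N → LevelYangian 𝕜 p}
    {F : Fin N → MvPolynomial (Letter p) 𝕜} (h : ∀ i, HasPolySymbol (d i) (y i) (F i)) :
    HasPolySymbol (∑ i, d i) (List.ofFn y).prod (∏ i, F i) := by
  induction N with
  | zero => simpa using HasPolySymbol.one
  | succ N ih =>
    rw [Fin.sum_univ_succ, Fin.prod_univ_succ, List.ofFn_succ, List.prod_cons]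
    exact (h 0).mul (ih fun i => h i.succ)

/-- A family of elements of the Yangian with the symbols `f^α X^m`, where the `f i` form a weakly
regular sequence and the monomials `X^m` come from `exists_monomial_basis_of_isWeaklyRegular`, is
a basis. -/
theorem linearIndependent_and_span_of_hasPolySymbol [Infinite 𝕜] {N : ℕ}
    {f : Fin N → MvPolynomial (Letter p) 𝕜} {d : Fin N → ℕ} {S : Set (Letter p →₀ ℕ)}
    (hli : LinearIndependent 𝕜 (fun x : (Fin N → ℕ) × S =>
      (∏ i, f i ^ x.1 i) * MvPolynomial.monomial x.2.1 (1 : 𝕜)))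
    (hspan : ∀ (n : ℕ) (F : MvPolynomial (Letter p) 𝕜), F.IsWeightedHomogeneous (letterWeight p) n →
      F ∈ Submodule.span 𝕜 {y | ∃ (α : Fin N → ℕ) (m : S),
        ∑ i, α i * d i + Finsupp.weight (letterWeight p) m.1 = n
          ∧ (∏ i, f i ^ α i) * MvPolynomial.monomial m.1 1 = y})
    (v : (Fin N → ℕ) × S → LevelYangian 𝕜 p)
    (hv : ∀ x, HasPolySymbol (∑ i, x.1 i * d i + Finsupp.weight (letterWeight p) x.2.1) (v x)
      ((∏ i, f i ^ x.1 i) * MvPolynomial.monomial x.2.1 (1 : 𝕜))) :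
    LinearIndependent 𝕜 v ∧ Submodule.span 𝕜 (Set.range v) = ⊤ := by
  let w : (Fin N → ℕ) × S → MvPolynomial (Letter p) 𝕜 :=
    fun x => (∏ i, f i ^ x.1 i) * MvPolynomial.monomial x.2.1 (1 : 𝕜)
  let deg : (Fin N → ℕ) × S → ℕ :=
    fun x => ∑ i, x.1 i * d i + Finsupp.weight (letterWeight p) x.2.1
  have hli' : LinearIndependent 𝕜 (orderedMonomialMap 𝕜 p ∘ w) :=
    hli.map' _ (LinearMap.ker_eq_bot.2 orderedMonomialMap_injective)
  have hmono : ∀ m : Letter p →₀ ℕ, orderedMonomialMap 𝕜 p (MvPolynomial.monomial m 1)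
      ∈ Submodule.span 𝕜 ((orderedMonomialMap 𝕜 p ∘ w) ''
        {x | deg x = Finsupp.weight (letterWeight p) m}) := by
    intro m
    have h1 := hspan _ _ (MvPolynomial.isWeightedHomogeneous_monomial (letterWeight p) m (1 : 𝕜) rfl)
    rw [Set.image_comp, ← Submodule.map_span]
    refine Submodule.mem_map_of_mem (Submodule.span_mono ?_ h1)
    rintro _ ⟨α, s, h2, rfl⟩
    exact ⟨(α, s), h2, rfl⟩
  have hfil : ∀ n, weightFiltration 𝕜 p n
      ≤ Submodule.span 𝕜 ((orderedMonomialMap 𝕜 p ∘ w) '' {x | deg x < n}) := by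
    intro n
    refine (weightFiltration_le_span n).trans (Submodule.span_le.2 ?_)
    rintro _ ⟨m, hm, rfl⟩
    refine Submodule.span_mono (Set.image_mono fun x hx => ?_) (hmono m)
    rw [Set.mem_ofPred_eq] at hx ⊢
    omega
  have htop : ⊤ ≤ Submodule.span 𝕜 (Set.range (orderedMonomialMap 𝕜 p ∘ w)) := by
    intro y _
    obtain ⟨n, hn⟩ := exists_mem_weightFiltration y
    exact Submodule.span_mono (Set.image_subset_range _ _) (hfil n hn)
  let b := Module.Basis.mk hli' htop
  have hb : ⇑b = orderedMonomialMap 𝕜 p ∘ w := Module.Basis.coe_mk hli' htop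
  refine linearIndependent_and_span_of_sub_mem b deg v fun x => ?_
  rw [hb]
  exact hfil _ (hv x).sub_mem

variable (𝕜 p) in
/-- The generators of `Γ` named by `gammaIndices`. -/
def gammaGenerator : ℕ ⊕ ℕ → LevelYangian 𝕜 p :=
  Sum.elim (yangianTPoly 𝕜 p 1 1).coeff (quantumDet 𝕜 p).coeff

theorem gammaGenerator_mem (x : ℕ ⊕ ℕ) : gammaGenerator 𝕜 p x ∈ yangianGamma 𝕜 p := by
  refine Algebra.subset_adjoin ?_
  cases x with
  | inl a => exact Or.inr ⟨a, rfl⟩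
  | inr m => exact Or.inl ⟨m, rfl⟩

theorem mem_gammaIndices (x : ℕ ⊕ ℕ) :
    x ∈ gammaIndices p ↔ Sum.elim (· < p) (· < 2 * p) x := by
  cases x with
  | inl a => simp [gammaIndices]
  | inr m =>
    simp only [gammaIndices, List.mem_append, List.mem_map, List.mem_range, Sum.elim_inr]
    constructor
    · rintro ((⟨a, -, h⟩ | ⟨a, h, e⟩) | ⟨a, h, e⟩)
      · cases h
      · cases e
        omega
      · cases e
        omega
    · intro h
      rcases lt_or_ge m p with h1 | h1
      · exact Or.inr ⟨m, h1, rfl⟩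
      · exact Or.inl (Or.inr ⟨m - p, by omega, by rw [Nat.add_sub_cancel' h1]⟩)

theorem mem_bot_of_mem_weightFiltration_one {y : LevelYangian 𝕜 p}
    (h : y ∈ weightFiltration 𝕜 p 1) : y ∈ (⊥ : Subalgebra 𝕜 (LevelYangian 𝕜 p)) := by
  refine (Submodule.span_le (p := Subalgebra.toSubmodule ⊥)).2 ?_ h
  rintro _ ⟨l, hl, rfl⟩
  cases l with
  | nil => exact one_mem (⊥ : Subalgebra 𝕜 (LevelYangian 𝕜 p))
  | cons x l =>
    rw [List.map_cons, List.sum_cons, letterWeight] at hl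
    omega

/-- The coefficients not named by `gammaIndices` are scalars, so they are not needed to generate
`Γ`. -/
theorem yangianGamma_eq_adjoin : yangianGamma 𝕜 p
    = Algebra.adjoin 𝕜 (gammaGenerator 𝕜 p '' {x | x ∈ gammaIndices p}) := by
  refine le_antisymm (Algebra.adjoin_le ?_) (Algebra.adjoin_le ?_)
  · have key : ∀ x, x ∉ gammaIndices p → gammaGenerator 𝕜 p x ∈ (⊥ : Subalgebra 𝕜 _) := by
      rintro (a | m) hx
      · rw [mem_gammaIndices, Sum.elim_inl, not_lt] at hx
        rw [gammaGenerator, Sum.elim_inl, yangianTPoly_coeff]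
        split_ifs with h
        · rw [Nat.sub_eq_zero_of_le hx, yangianT_zero, if_pos rfl]
          exact one_mem _
        · exact zero_mem _
      · rw [mem_gammaIndices, Sum.elim_inr, not_lt] at hx
        have := (hasPolySymbol_quantumDet_coeff (𝕜 := 𝕜) (p := p) m).mem
        rw [Nat.sub_eq_zero_of_le hx] at this
        exact mem_bot_of_mem_weightFiltration_one this
    have key' : ∀ x, gammaGenerator 𝕜 p x
        ∈ Algebra.adjoin 𝕜 (gammaGenerator 𝕜 p '' {x | x ∈ gammaIndices p}) := by
      intro x
      by_cases hx : x ∈ gammaIndices p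
      · exact Algebra.subset_adjoin ⟨x, hx, rfl⟩
      · exact bot_le (a := Algebra.adjoin 𝕜 _) (key x hx)
    rintro _ (⟨m, rfl⟩ | ⟨a, rfl⟩)
    · exact key' (Sum.inr m)
    · exact key' (Sum.inl a)
  · rintro _ ⟨x, -, rfl⟩
    exact gammaGenerator_mem x

end GammaBasis

/-! ### Bases over a subalgebra acting on the left and on the right -/

section GenericBases

variable {𝕜 : Type u} [Field 𝕜] {U : Type u} [Ring U] [Algebra 𝕜 U] (Γ : Subalgebra 𝕜 U)
  {A S : Type*} (g : A → Γ) (e : S → U)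

theorem Subalgebra.exists_left_basis (hg : Submodule.span 𝕜 (Set.range g) = ⊤)
    (h : LinearIndependent 𝕜 (fun x : A × S => (g x.1 : U) * e x.2) ∧
      Submodule.span 𝕜 (Set.range fun x : A × S => (g x.1 : U) * e x.2) = ⊤) :
    ∃ b : Module.Basis S Γ U, ⇑b = e :=
  ⟨Module.Basis.mk (linearIndependent_of_smul_prod g e hg h.1)
    (span_eq_top_of_smul_prod g e h.2).ge, Module.Basis.coe_mk _ _⟩

theorem Subalgebra.exists_right_basis (hg : Submodule.span 𝕜 (Set.range g) = ⊤)
    (h : LinearIndependent 𝕜 (fun x : A × S => e x.2 * (g x.1 : U)) ∧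
      Submodule.span 𝕜 (Set.range fun x : A × S => e x.2 * (g x.1 : U)) = ⊤) :
    ∃ b : Module.Basis S Γ.op U, ⇑b = e := by
  let g' : A → Γ.op := fun a => Γ.linearEquivOp (g a)
  have hg' : Submodule.span 𝕜 (Set.range g') = ⊤ := by
    refine eq_top_iff.2 fun y _ => ?_
    have hle : Submodule.span 𝕜 (Set.range g)
        ≤ (Submodule.span 𝕜 (Set.range g')).comap (Γ.linearEquivOp : Γ →ₗ[𝕜] Γ.op) := by
      refine Submodule.span_le.2 ?_
      rintro _ ⟨a, rfl⟩
      exact Submodule.subset_span ⟨a, rfl⟩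
    rw [hg] at hle
    exact hle (Submodule.mem_top (x := (⟨MulOpposite.unop (y : Uᵐᵒᵖ), y.2⟩ : Γ)))
  have hsmul : (fun x : A × S => e x.2 * (g x.1 : U)) = fun x => g' x.1 • e x.2 := rfl
  rw [hsmul] at h
  have : IsScalarTower 𝕜 Γ.op U := ⟨fun c a x => by
    change x * (c • MulOpposite.unop (a : Uᵐᵒᵖ)) = c • (x * MulOpposite.unop (a : Uᵐᵒᵖ))
    rw [mul_smul_comm]⟩
  have h1 : LinearIndependent Γ.op e := linearIndependent_of_smul_prod g' e hg' h.1
  have h2 : Submodule.span Γ.op (Set.range e) = ⊤ := span_eq_top_of_smul_prod g' e h.2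
  exact ⟨Module.Basis.mk h1 h2.ge, Module.Basis.coe_mk _ _⟩

end GenericBases

/-! ### Freeness over Γ -/

section Freeness

open scoped IsMulCommutative

variable (𝕜 : Type u) [Field 𝕜] (p : ℕ)

variable {𝕜 p} in
/-- The algebra `Γ` is generated by elements of positive degrees whose symbols form a weakly regular
sequence. -/
theorem exists_yangianGamma_generators (hp : 0 < p) :
    ∃ (N : ℕ) (f : Fin N → MvPolynomial (Letter p) 𝕜) (d : Fin N → ℕ)
      (γ : Fin N → yangianGamma 𝕜 p), (∀ i, 0 < d i) ∧
      (∀ i, HasPolySymbol (d i) (γ i : LevelYangian 𝕜 p) (f i)) ∧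
      RingTheory.Sequence.IsWeaklyRegular (MvPolynomial (Letter p) 𝕜) (List.ofFn f) ∧
      Algebra.adjoin 𝕜 (Set.range γ) = ⊤ := by
  let L := gammaIndices p
  let N := L.length
  let f : Fin N → MvPolynomial (Letter p) 𝕜 := fun i =>
    Sum.elim (symbolTCoeff 𝕜 p 1 1) (symbolDetCoeff 𝕜 p) (L.get i)
  let d : Fin N → ℕ := fun i => Sum.elim (fun a => p - a) (fun m => 2 * p - m) (L.get i)
  let γ : Fin N → yangianGamma 𝕜 p := fun i => ⟨gammaGenerator 𝕜 p (L.get i), gammaGenerator_mem _⟩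
  have hL : ∀ i : Fin N, Sum.elim (· < p) (· < 2 * p) (L.get i) := fun i =>
    (mem_gammaIndices _).1 (L.get_mem i)
  have hd : ∀ i, 0 < d i := by
    intro i
    have h := hL i
    simp only [d]
    generalize L.get i = x at h ⊢
    cases x <;> exact Nat.sub_pos_of_lt h
  have hγ : ∀ i, HasPolySymbol (d i) (γ i : LevelYangian 𝕜 p) (f i) := by
    intro i
    have h := hL i
    simp only [d, γ, f]
    generalize L.get i = x at h ⊢
    cases x with
    | inl a => exact hasPolySymbol_yangianTPoly_coeff 1 1 (le_of_lt h)
    | inr m => exact hasPolySymbol_quantumDet_coeff m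
  have hreg : RingTheory.Sequence.IsWeaklyRegular (MvPolynomial (Letter p) 𝕜) (List.ofFn f) := by
    have h := isWeaklyRegular_gammaIndices (𝕜 := 𝕜) hp
    rwa [← List.ofFn_get (gammaIndices p), List.map_ofFn] at h
  have hgen : Algebra.adjoin 𝕜 (Set.range γ) = ⊤ := by
    apply Subalgebra.map_injective (f := (yangianGamma 𝕜 p).val) Subtype.val_injective
    rw [AlgHom.map_adjoin, Algebra.map_top, Subalgebra.range_val]
    refine Eq.trans (congrArg (Algebra.adjoin 𝕜) ?_) yangianGamma_eq_adjoin.symm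
    ext y
    constructor
    · rintro ⟨_, ⟨i, rfl⟩, rfl⟩
      exact ⟨L.get i, L.get_mem i, rfl⟩
    · rintro ⟨x, hx, rfl⟩
      obtain ⟨i, rfl⟩ := List.get_of_mem hx
      exact ⟨_, ⟨i, rfl⟩, rfl⟩
  exact ⟨N, f, d, γ, hd, hγ, hreg, hgen⟩

variable [CharZero 𝕜]

instance yangianGamma_isMulCommutative : IsMulCommutative (yangianGamma 𝕜 p) :=
  ⟨⟨fun x y => Subtype.ext (yangianGamma_commutative 𝕜 p x x.2 y y.2)⟩⟩

variable {𝕜 p}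

theorem HasPolySymbol.prod_pow {N : ℕ} {f : Fin N → MvPolynomial (Letter p) 𝕜} {d : Fin N → ℕ}
    {γ : Fin N → yangianGamma 𝕜 p}
    (hγ : ∀ i, HasPolySymbol (d i) (γ i : LevelYangian 𝕜 p) (f i)) (α : Fin N → ℕ) :
    HasPolySymbol (∑ i, α i * d i) ((∏ i, γ i ^ α i : yangianGamma 𝕜 p) : LevelYangian 𝕜 p)
      (∏ i, f i ^ α i) := by
  have h : ((∏ i, γ i ^ α i : yangianGamma 𝕜 p) : LevelYangian 𝕜 p)
      = (List.ofFn fun i => (γ i : LevelYangian 𝕜 p) ^ α i).prod := by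
    rw [← List.prod_ofFn]
    change (yangianGamma 𝕜 p).val _ = _
    rw [map_list_prod, List.map_ofFn]
    rfl
  rw [h]
  exact HasPolySymbol.list_prod fun i => (hγ i).pow (α i)

/-- The Yangian has bases containing `1` over `Γ`, acting on the left and on the right. -/
theorem exists_basis_over_yangianGamma (hp : 0 < p) :
    ∃ (S : Set (Letter p →₀ ℕ)) (s : S) (b : Module.Basis S (yangianGamma 𝕜 p) (LevelYangian 𝕜 p))
      (b' : Module.Basis S (yangianGamma 𝕜 p).op (LevelYangian 𝕜 p)), b s = 1 ∧ b' s = 1 := by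
  obtain ⟨N, f, d, γ, hd, hγ, hreg, hgen⟩ := exists_yangianGamma_generators (𝕜 := 𝕜) hp
  obtain ⟨S, h0, hli, hspan⟩ :=
    exists_monomial_basis_of_isWeaklyRegular hd (fun i => (hγ i).homogeneous) hreg
  let g : (Fin N → ℕ) → yangianGamma 𝕜 p := fun α => ∏ i, γ i ^ α i
  let e : S → LevelYangian 𝕜 p := fun m => orderedMonomialMap 𝕜 p (MvPolynomial.monomial m.1 1)
  have hg : ∀ α, HasPolySymbol (∑ i, α i * d i) (g α : LevelYangian 𝕜 p) (∏ i, f i ^ α i) :=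
    HasPolySymbol.prod_pow hγ
  have hgspan : Submodule.span 𝕜 (Set.range g) = ⊤ := span_prod_pow_eq_top γ hgen
  have he : e ⟨0, h0⟩ = 1 := by
    change orderedMonomialMap 𝕜 p (MvPolynomial.monomial 0 1) = 1
    rw [orderedMonomialMap_monomial]
    simp [wordT]
  obtain ⟨b, hb⟩ := Subalgebra.exists_left_basis _ g e hgspan
    (linearIndependent_and_span_of_hasPolySymbol hli hspan _ fun x =>
      (hg x.1).mul (.monomial x.2.1))
  obtain ⟨b', hb'⟩ := Subalgebra.exists_right_basis _ g e hgspan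
    (linearIndependent_and_span_of_hasPolySymbol hli hspan _ fun x => by
      rw [add_comm, mul_comm]
      exact (HasPolySymbol.monomial x.2.1).mul (hg x.1))
  exact ⟨S, ⟨0, h0⟩, b, b', by rw [hb, he], by rw [hb', he]⟩

end Freeness

/-! ### The subalgebra as a direct summand -/

section Summands

variable {𝕜 : Type u} [Field 𝕜] {U : Type u} [Ring U] [Algebra 𝕜 U] (Γ : Subalgebra 𝕜 U)

theorem Subalgebra.asLeftSubmodule_eq_span : Γ.asLeftSubmodule = Submodule.span Γ {(1 : U)} := by
  ext x
  rw [Submodule.mem_span_singleton]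
  constructor
  · intro hx
    exact ⟨⟨x, hx⟩, mul_one x⟩
  · rintro ⟨a, rfl⟩
    change (a : U) * 1 ∈ Γ
    rw [mul_one]
    exact a.2

theorem Subalgebra.asRightSubmodule_eq_span :
    Γ.asRightSubmodule = Submodule.span Γ.op {(1 : U)} := by
  ext x
  rw [Submodule.mem_span_singleton]
  constructor
  · intro hx
    exact ⟨⟨MulOpposite.op x, hx⟩, one_mul x⟩
  · rintro ⟨a, rfl⟩
    change 1 * MulOpposite.unop (a : Uᵐᵒᵖ) ∈ Γ
    rw [one_mul]
    exact a.2

variable {Γ}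

theorem Subalgebra.exists_isCompl_asLeftSubmodule {S : Type*} (b : Module.Basis S Γ U) {s : S}
    (hs : b s = 1) : ∃ N : Submodule Γ U, IsCompl Γ.asLeftSubmodule N := by
  rw [Γ.asLeftSubmodule_eq_span, ← hs]
  exact ⟨_, b.isCompl_span_singleton s⟩

theorem Subalgebra.exists_isCompl_asRightSubmodule {S : Type*} (b : Module.Basis S Γ.op U) {s : S}
    (hs : b s = 1) : ∃ N : Submodule Γ.op U, IsCompl Γ.asRightSubmodule N := by
  have h := b.isCompl_span_singleton s
  rw [Γ.asRightSubmodule_eq_span, ← hs]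
  exact ⟨_, h⟩

end Summands

/-! ### Generalized weight decompositions -/

section WeightDecomposition

variable {R M : Type*} [CommRing R] [AddCommGroup M] [Module R M]

/-- An ideal with Artinian quotient contains a product of powers of distinct maximal ideals. -/
theorem Ideal.exists_prod_pow_le_of_isArtinianRing (I : Ideal R) [IsArtinianRing (R ⧸ I)] :
    ∃ (S : Finset {m : Ideal R // m.IsMaximal}) (n : {m : Ideal R // m.IsMaximal} → ℕ),
      ∏ m ∈ S, m.1 ^ n m ≤ I := by
  classical
  have hs := Ideal.Quotient.mk_surjective (I := I)
  obtain ⟨Z, hZ⟩ := PrimeSpectrum.exists_primeSpectrum_prod_le (R ⧸ I) ⊥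
  let q : PrimeSpectrum (R ⧸ I) → {m : Ideal R // m.IsMaximal} := fun a =>
    ⟨a.asIdeal.comap (Ideal.Quotient.mk I), Ideal.comap_isMaximal_of_surjective _ hs⟩
  refine ⟨(Z.map q).toFinset, fun m => (Z.map q).count m, ?_⟩
  rw [← Finset.prod_multiset_map_count, Multiset.map_map]
  have h : ((Z.map (Subtype.val ∘ q)).prod).map (Ideal.Quotient.mk I) ≤ ⊥ := by
    refine le_of_eq_of_le ?_ hZ
    change Ideal.mapHom (Ideal.Quotient.mk I) _ = _
    rw [map_multiset_prod, Multiset.map_map]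
    congr 1
    exact Multiset.map_congr rfl fun a _ => Ideal.map_comap_of_surjective _ hs _
  rwa [Ideal.map_le_iff_le_comap, ← RingHom.ker_eq_comap_bot, Ideal.mk_ker] at h

theorem Ideal.pairwise_pow_sup_pow_eq_top (S : Set {m : Ideal R // m.IsMaximal})
    (n : {m : Ideal R // m.IsMaximal} → ℕ) :
    S.Pairwise fun i j => i.1 ^ n i ⊔ j.1 ^ n j = ⊤ := by
  intro i _ j _ hij
  have := i.2
  have := j.2
  exact Ideal.pow_sup_pow_eq_top (i.2.coprime_of_ne j.2 fun h => hij (Subtype.ext h))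

/-- A module all of whose cyclic submodules have Artinian quotients by their annihilators is the
direct sum of its generalized weight spaces. -/
theorem isInternal_of_isArtinianRing_quotient
    (W : {m : Ideal R // m.IsMaximal} → AddSubgroup M)
    (hW : ∀ m x, x ∈ W m ↔ ∃ n : ℕ, ∀ a ∈ m.1 ^ n, a • x = 0)
    [DecidableEq {m : Ideal R // m.IsMaximal}]
    (h : ∀ x : M, IsArtinianRing (R ⧸ Ideal.torsionOf R M x)) : DirectSum.IsInternal W := by
  classical
  constructor
  · refine (injective_iff_map_eq_zero _).2 fun v hv => ?_
    choose n hn using fun m => (hW m (v m)).1 (v m).2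
    ext m
    by_contra hm
    have hmS : m ∈ v.support := by
      rw [DFinsupp.mem_support_iff]
      intro h0
      exact hm (by rw [h0]; rfl)
    have hmem : ∀ i, (v i : M) ∈ Submodule.torsionBySet R M (i.1 ^ n i : Ideal R) := fun i =>
      (Submodule.mem_torsionBySet_iff _ _).2 fun a => hn i a a.2
    have hdis := Submodule.supIndep_torsionBySet_ideal (M := M)
      (Ideal.pairwise_pow_sup_pow_eq_top (v.support : Set _) n)
      (Finset.erase_subset m v.support) hmS (Finset.notMem_erase m _)
    have hsum : (v m : M) + ∑ i ∈ v.support.erase m, (v i : M) = 0 := by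
      rw [Finset.add_sum_erase _ (fun i => (v i : M)) hmS, ← hv, DirectSum.coeAddMonoidHom_eq_dfinsuppSum]
      rfl
    refine hm ((Submodule.disjoint_def.1 hdis) _ (hmem m) ?_)
    rw [eq_neg_of_add_eq_zero_left hsum]
    refine neg_mem (Submodule.sum_mem _ fun i hi => ?_)
    exact Finset.le_sup (f := fun i : {m : Ideal R // m.IsMaximal} =>
      Submodule.torsionBySet R M (i.1 ^ n i : Ideal R)) hi (hmem i)
  · intro x
    have := h x
    obtain ⟨S, n, hS⟩ := Ideal.exists_prod_pow_le_of_isArtinianRing (Ideal.torsionOf R M x)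
    have hp := Ideal.pairwise_pow_sup_pow_eq_top (S : Set _) n
    have hx : x ∈ Submodule.torsionBySet R M
        (⨅ m ∈ S, (m.1 ^ n m : Ideal R) : Ideal R) := by
      rw [← Ideal.prod_eq_iInf_of_pairwise_isCoprime fun i hi j hj hij =>
        Ideal.isCoprime_iff_sup_eq.2 (hp hi hj hij), Submodule.mem_torsionBySet_iff]
      exact fun a => (Ideal.mem_torsionOf_iff x _).1 (hS a.2)
    rw [← Submodule.iSup_torsionBySet_ideal_eq_torsionBySet_iInf hp,
      Submodule.mem_iSup_finset_iff_exists_sum] at hx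
    obtain ⟨y, rfl⟩ := hx
    refine AddSubgroup.sum_mem (DirectSum.coeAddMonoidHom W).range fun m _ => ?_
    have hy : (y m : M) ∈ W m := (hW m _).2 ⟨n m, fun a ha =>
      (Submodule.mem_torsionBySet_iff _ _).1 (y m).2 ⟨a, ha⟩⟩
    exact ⟨DirectSum.of (fun i => W i) m ⟨(y m : M), hy⟩, DirectSum.coeAddMonoidHom_of W m ⟨(y m : M), hy⟩⟩

end WeightDecomposition

/-! ### A criterion for extending maximal ideals to Harish-Chandra modules -/

section HarishChandraCriterion

open scoped IsMulCommutative

variable {𝕜 : Type u} [Field 𝕜] {U : Type u} [Ring U] [Algebra 𝕜 U]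

/-- The vector `x` lies in a finite-dimensional `Γ`-stable subspace. -/
def IsLocallyFiniteVector (Γ : Subalgebra 𝕜 U) {M : Type u} [AddCommGroup M] [Module U M]
    [Module 𝕜 M] (x : M) : Prop :=
  ∃ V : Submodule 𝕜 M, FiniteDimensional 𝕜 V ∧ x ∈ V ∧ ∀ a ∈ Γ, ∀ y ∈ V, a • y ∈ V

variable {Γ : Subalgebra 𝕜 U} {M : Type u} [AddCommGroup M] [Module U M] [Module 𝕜 M]

theorem IsLocallyFiniteVector.add {x y : M} (hx : IsLocallyFiniteVector Γ x)
    (hy : IsLocallyFiniteVector Γ y) : IsLocallyFiniteVector Γ (x + y) := by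
  obtain ⟨V, hV, hxV, hΓ⟩ := hx
  obtain ⟨W, hW, hyW, hΓ'⟩ := hy
  refine ⟨V ⊔ W, inferInstance, Submodule.add_mem_sup hxV hyW, fun a ha z hz => ?_⟩
  obtain ⟨v, hv, w, hw, rfl⟩ := Submodule.mem_sup.1 hz
  rw [smul_add]
  exact Submodule.add_mem_sup (hΓ a ha v hv) (hΓ' a ha w hw)

theorem IsLocallyFiniteVector.smul_of_mem {x : M} (hx : IsLocallyFiniteVector Γ x) {a : U}
    (ha : a ∈ Γ) : IsLocallyFiniteVector Γ (a • x) := by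
  obtain ⟨V, hV, hxV, hΓ⟩ := hx
  exact ⟨V, hV, hΓ a ha x hxV, hΓ⟩

/-- If a finite family `t` satisfies `Γ t ⊆ ∑ t Γ`, it preserves the locally finite vectors. -/
theorem IsLocallyFiniteVector.smul_of_mul_mem [IsScalarTower 𝕜 U M] {ι : Type*} [Finite ι]
    {t : ι → U} {G : Set U} (hG : Algebra.adjoin 𝕜 G = Γ)
    (ht : ∀ a ∈ G, ∀ i, a * t i ∈ AddSubmonoid.closure {y | ∃ j, ∃ b ∈ Γ, t j * b = y})
    {x : M} (hx : IsLocallyFiniteVector Γ x) (i : ι) : IsLocallyFiniteVector Γ (t i • x) := by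
  obtain ⟨V, hV, hxV, hΓ⟩ := hx
  let L : ι → M →ₗ[𝕜] M := fun i => LinearMap.restrictScalars 𝕜 (S := 𝕜)
    { toFun := fun y => t i • y
      map_add' := smul_add (t i)
      map_smul' := fun c y => by
        rw [RingHom.id_apply, ← algebraMap_smul U c y, smul_smul, ← algebraMap_smul U c (t i • y),
          smul_smul, Algebra.commutes] }
  have hL : ∀ j y, y ∈ V → t j • y ∈ ⨆ i, V.map (L i) := fun j y hy =>
    Submodule.mem_iSup_of_mem (p := fun i => V.map (L i)) j ⟨y, hy, rfl⟩
  refine ⟨⨆ i, V.map (L i), inferInstance, hL i x hxV, fun a ha => ?_⟩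
  rw [← hG] at ha
  induction ha using Algebra.adjoin_induction with
  | mem a ha =>
    intro y hy
    induction hy using Submodule.iSup_induction' with
    | mem i y hy =>
      obtain ⟨y, hy, rfl⟩ := hy
      change a • t i • y ∈ _
      rw [smul_smul]
      have h := ht a ha i
      generalize a * t i = z at h ⊢
      induction h using AddSubmonoid.closure_induction with
      | mem z hz =>
        obtain ⟨j, b, hb, rfl⟩ := hz
        rw [mul_smul]
        exact hL j _ (hΓ b hb y hy)
      | zero => rw [zero_smul]; exact zero_mem _
      | add z w _ _ hz hw => rw [add_smul]; exact add_mem hz hw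
    | zero => rw [smul_zero]; exact zero_mem _
    | add y z _ _ hy hz => rw [smul_add]; exact add_mem hy hz
  | algebraMap c =>
    intro y hy
    rw [algebraMap_smul]
    exact Submodule.smul_mem _ c hy
  | add a b _ _ ha hb => exact fun y hy => by rw [add_smul]; exact add_mem (ha y hy) (hb y hy)
  | mul a b _ _ ha hb => exact fun y hy => by rw [mul_smul]; exact ha _ (hb y hy)

/-- The quotient of `Γ` by the annihilator of a locally finite vector is finite-dimensional. -/
theorem IsLocallyFiniteVector.isArtinianRing [IsScalarTower 𝕜 U M] [IsMulCommutative Γ] {x : M}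
    (hx : IsLocallyFiniteVector Γ x) : IsArtinianRing (Γ ⧸ Ideal.torsionOf Γ M x) := by
  obtain ⟨V, hV, hxV, hΓ⟩ := hx
  have : IsScalarTower 𝕜 Γ M := ⟨fun c a y => smul_assoc c (a : U) y⟩
  let f : (Γ ⧸ Ideal.torsionOf Γ M x) →ₗ[𝕜] M :=
    ((Submodule.subtype _).comp
      (Ideal.quotTorsionOfEquivSpanSingleton Γ M x).toLinearMap).restrictScalars 𝕜
  have hf : Function.Injective f :=
    Subtype.val_injective.comp (Ideal.quotTorsionOfEquivSpanSingleton Γ M x).injective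
  have hfV : ∀ a, f a ∈ V := by
    intro a
    obtain ⟨a, rfl⟩ := Submodule.Quotient.mk_surjective _ a
    exact hΓ a a.2 x hxV
  have : Module.Finite 𝕜 (Γ ⧸ Ideal.torsionOf Γ M x) :=
    Module.Finite.of_injective (f.codRestrict V hfV) fun a b h =>
      hf (congrArg (fun v : V => (v : M)) h)
  exact IsArtinianRing.of_finite 𝕜 _

theorem isHarishChandraModule_of_isLocallyFiniteVector [IsScalarTower 𝕜 U M] [IsMulCommutative Γ]
    [Module.Finite U M] (h : ∀ x : M, IsLocallyFiniteVector Γ x) : IsHarishChandraModule Γ M :=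
  ⟨inferInstance, isInternal_of_isArtinianRing_quotient _ (fun _ _ => Iff.rfl)
    fun x => (h x).isArtinianRing⟩

/-- A vector killed by a maximal ideal `m` is locally finite, as `Γ ⧸ m` is finite-dimensional by
the Nullstellensatz. -/
theorem isLocallyFiniteVector_of_maximal [IsScalarTower 𝕜 U M] [IsMulCommutative Γ]
    [Algebra.FiniteType 𝕜 Γ] {m : Ideal Γ} (hm : m.IsMaximal) {x : M} (hx : ∀ a ∈ m, a • x = 0) :
    IsLocallyFiniteVector Γ x := by
  have : IsScalarTower 𝕜 Γ M := ⟨fun c a y => smul_assoc c (a : U) y⟩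
  let _ := Ideal.Quotient.field m
  have : Module.Finite 𝕜 (Γ ⧸ m) := finite_of_finite_type_of_isJacobsonRing 𝕜 (Γ ⧸ m)
  let f : (Γ ⧸ m) →ₗ[Γ] M := m.liftQ (LinearMap.toSpanSingleton Γ M x) hx
  refine ⟨LinearMap.range (f.restrictScalars 𝕜), inferInstance, ⟨Submodule.Quotient.mk 1, ?_⟩, ?_⟩
  · change (1 : Γ) • x = x
    exact one_smul _ _
  · rintro a ha _ ⟨y, rfl⟩
    exact ⟨(⟨a, ha⟩ : Γ) • y, f.map_smul _ y⟩

/-- A maximal ideal of `Γ` that generates a proper left ideal of `U` annihilates a nonzero vector of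
some simple `U`-module, namely of a simple quotient of `U ⧸ U m`. -/
theorem exists_isExtendedFrom [IsMulCommutative Γ] [Algebra.FiniteType 𝕜 Γ] {m : Ideal Γ}
    (hm : m.IsMaximal) (hproper : (1 : U) ∉ Ideal.span (Subtype.val '' (m : Set Γ)))
    (hloc : ∀ (M : Type u) [AddCommGroup M] [Module U M] [Module 𝕜 M] [IsScalarTower 𝕜 U M]
      (a : U) (x : M), IsLocallyFiniteVector Γ x → IsLocallyFiniteVector Γ (a • x)) :
    ∃ (M : Type u) (_ : AddCommGroup M) (_ : Module U M), IsExtendedFrom Γ m M := by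
  obtain ⟨I, hI, hmI⟩ := Ideal.exists_le_maximal _ ((Ideal.ne_top_iff_one _).2 hproper)
  let x : U ⧸ I := Submodule.Quotient.mk 1
  have hx : ∀ a ∈ m, a • x = 0 := by
    intro a ha
    refine (Submodule.Quotient.mk_eq_zero I).2 ?_
    change (a : U) * 1 ∈ I
    rw [mul_one]
    exact hmI (Ideal.subset_span ⟨a, ha, rfl⟩)
  have hx0 : x ≠ 0 := fun h =>
    (Ideal.ne_top_iff_one _).1 hI.ne_top ((Submodule.Quotient.mk_eq_zero I).1 h)
  have hsimple : IsSimpleModule U (U ⧸ I) := isSimpleModule_iff_isCoatom.2 hI.out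
  refine ⟨U ⧸ I, inferInstance, inferInstance, hsimple, ?_, fun hbot => hx0 ?_⟩
  · refine isHarishChandraModule_of_isLocallyFiniteVector fun y => ?_
    obtain ⟨a, rfl⟩ := Submodule.Quotient.mk_surjective I y
    have : (Submodule.Quotient.mk a : U ⧸ I) = a • x := by
      rw [← Submodule.Quotient.mk_smul, smul_eq_mul, mul_one]
    rw [this]
    exact hloc _ a x (isLocallyFiniteVector_of_maximal hm hx)
  · have : x ∈ genWeightSpace Γ m (U ⧸ I) := ⟨1, fun a ha => hx a (by rwa [pow_one] at ha)⟩
    rwa [hbot] at this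

/-- If `Γ` is a direct factor of the right `Γ`-module `U` through a projection fixing `1`, proper
ideals of `Γ` generate proper left ideals of `U`. -/
theorem one_notMem_span_of_projection [IsMulCommutative Γ] {m : Ideal Γ} (hm : m ≠ ⊤) (π : U →+ Γ)
    (hπ : ∀ (y : U) (a : Γ), π (y * a) = π y * a) (h1 : π 1 = 1) :
    (1 : U) ∉ Ideal.span (Subtype.val '' (m : Set Γ)) := by
  intro h
  refine (Ideal.ne_top_iff_one m).1 hm ?_
  rw [← h1]
  rw [Ideal.span, Submodule.mem_span_set'] at h
  obtain ⟨n, f, g, h⟩ := h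
  rw [← h, map_sum]
  refine Ideal.sum_mem _ fun i _ => ?_
  obtain ⟨a, ha, hag⟩ := (g i).2
  rw [← hag, smul_eq_mul, hπ]
  exact m.mul_mem_left _ ha

/-- The coordinate at a basis element equal to `1` is a projection onto `Γ` of right `Γ`-modules. -/
theorem Module.Basis.exists_projection {S : Type*} (b : Module.Basis S Γ.op U) {s : S}
    (hs : b s = 1) : ∃ π : U →+ Γ, (∀ (y : U) (a : Γ), π (y * a) = π y * a) ∧ π 1 = 1 := by
  let π : U →+ Γ :=
    (Γ.linearEquivOp.symm.toLinearMap.toAddMonoidHom).comp (b.coord s).toAddMonoidHom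
  refine ⟨π, fun y a => Subtype.ext ?_, Subtype.ext ?_⟩
  · have h : b.coord s (y * (a : U)) = Γ.linearEquivOp a * b.coord s y :=
      (b.coord s).map_smul (Γ.linearEquivOp a) y
    change MulOpposite.unop (b.coord s (y * (a : U)) : Uᵐᵒᵖ) = _
    rw [h]
    rfl
  · have h : b.coord s (b s) = 1 := by
      rw [Module.Basis.coord_apply, Module.Basis.repr_self, Finsupp.single_eq_same]
    rw [hs] at h
    change MulOpposite.unop (b.coord s 1 : Uᵐᵒᵖ) = 1
    rw [h]
    rfl

end HarishChandraCriterion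

/-! ### Locally finite vectors of modules over the Yangian -/

section YangianHarishChandra

open scoped IsMulCommutative

variable {𝕜 : Type u} [Field 𝕜] {p : ℕ}

theorem yangianT_mem_yangianGamma (r : ℕ) : yangianT 𝕜 p 1 1 r ∈ yangianGamma 𝕜 p := by
  rcases lt_or_ge p r with h | h
  · rw [yangianT_of_lt 𝕜 p 1 1 r h]
    exact zero_mem _
  · refine Algebra.subset_adjoin (Or.inr ⟨p - r, ?_⟩)
    rw [yangianTPoly_coeff, if_pos (Nat.sub_le p r), Nat.sub_sub_self h]

/-- The finite sums `∑ t_{ij}^{(r)} b_r` with `b_r` in `Γ`. -/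
def sumsMulGamma (𝕜 : Type u) [Field 𝕜] (p : ℕ) (i j : Fin 2) : AddSubmonoid (LevelYangian 𝕜 p) :=
  AddSubmonoid.closure {y | ∃ r : Fin (p + 1), ∃ b ∈ yangianGamma 𝕜 p, yangianT 𝕜 p i j r * b = y}

theorem mul_mem_sumsMulGamma (i j : Fin 2) (r : ℕ) {b : LevelYangian 𝕜 p}
    (hb : b ∈ yangianGamma 𝕜 p) : yangianT 𝕜 p i j r * b ∈ sumsMulGamma 𝕜 p i j := by
  rcases lt_or_ge p r with h | h
  · rw [yangianT_of_lt 𝕜 p i j r h, zero_mul]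
    exact zero_mem _
  · exact AddSubmonoid.subset_closure ⟨⟨r, by omega⟩, b, hb, rfl⟩

theorem sum_sub_mem_sumsMulGamma (i j : Fin 2) (s : Finset ℕ) (f g f' g' : ℕ → ℕ) :
    ∑ a ∈ s, (yangianT 𝕜 p i j (f a) * yangianT 𝕜 p 1 1 (g a)
      - yangianT 𝕜 p i j (f' a) * yangianT 𝕜 p 1 1 (g' a)) ∈ sumsMulGamma 𝕜 p i j := by
  refine sum_mem fun a _ => ?_
  rw [sub_eq_add_neg, ← mul_neg]
  exact add_mem (mul_mem_sumsMulGamma _ _ _ (yangianT_mem_yangianGamma _))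
    (mul_mem_sumsMulGamma _ _ _ (neg_mem (yangianT_mem_yangianGamma _)))

/-- The commutation relations move `t₂₂^{(q)}` to the right of `t₁₂^{(r)}` and of `t₂₁^{(r)}`. -/
theorem yangianT_mul_mem_sumsMulGamma (q r : ℕ) :
    yangianT 𝕜 p 1 1 q * yangianT 𝕜 p 0 1 r ∈ sumsMulGamma 𝕜 p 0 1 ∧
      yangianT 𝕜 p 1 1 q * yangianT 𝕜 p 1 0 r ∈ sumsMulGamma 𝕜 p 1 0 := by
  have hc := (yangianT_coeffRTT 𝕜 p).commutator (yangianT_isMonicSeq 𝕜 p)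
  constructor
  · rw [sub_eq_iff_eq_add.1 (hc 1 1 0 1 q r)]
    exact add_mem (sum_sub_mem_sumsMulGamma 0 1 _ _ _ _ _)
      (mul_mem_sumsMulGamma _ _ _ (yangianT_mem_yangianGamma q))
  · have h : yangianT 𝕜 p 1 1 q * yangianT 𝕜 p 1 0 r = yangianT 𝕜 p 1 0 r * yangianT 𝕜 p 1 1 q
        + -(yangianT 𝕜 p 1 0 r * yangianT 𝕜 p 1 1 q - yangianT 𝕜 p 1 1 q * yangianT 𝕜 p 1 0 r) := by
      abel
    rw [h, hc 1 0 1 1 r q, ← Finset.sum_neg_distrib]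
    simp only [neg_sub]
    exact add_mem (mul_mem_sumsMulGamma _ _ _ (yangianT_mem_yangianGamma q))
      (sum_sub_mem_sumsMulGamma 1 0 _ _ _ _ _)

/-- The Yangian is generated by `Γ` and the coefficients of `T₁₂(u)` and `T₂₁(u)`, since
`[t₁₂^{(1)}, t₂₁^{(r)}] = t₁₁^{(r)} - t₂₂^{(r)}`. -/
theorem mem_of_yangianT_mem {A : Subalgebra 𝕜 (LevelYangian 𝕜 p)}
    (h01 : ∀ r, yangianT 𝕜 p 0 1 r ∈ A) (h10 : ∀ r, yangianT 𝕜 p 1 0 r ∈ A)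
    (h11 : ∀ r, yangianT 𝕜 p 1 1 r ∈ A) (y : LevelYangian 𝕜 p) : y ∈ A := by
  have h00 : ∀ r, yangianT 𝕜 p 0 0 r ∈ A := by
    intro r
    rcases Nat.eq_zero_or_pos r with rfl | hr
    · rw [yangianT_zero, if_pos rfl]
      exact one_mem A
    have h := (yangianT_coeffRTT 𝕜 p).commutator (yangianT_isMonicSeq 𝕜 p) 0 1 1 0 1 r
    rw [min_eq_left hr, Finset.Icc_self, Finset.sum_singleton, Nat.sub_self, Nat.add_sub_cancel_left,
      yangianT_zero, yangianT_zero, if_pos rfl, if_pos rfl, one_mul, mul_one] at h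
    rw [eq_add_of_sub_eq h.symm]
    exact add_mem (sub_mem (mul_mem (h01 1) (h10 r)) (mul_mem (h10 r) (h01 1))) (h11 r)
  obtain ⟨y, rfl⟩ := RingQuot.mkAlgHom_surjective 𝕜 (YangianRel 𝕜 p) y
  change LevelYangian.mk 𝕜 p y ∈ A
  induction y using FreeAlgebra.induction with
  | grade0 a =>
    rw [AlgHom.commutes]
    exact A.algebraMap_mem a
  | grade1 a =>
    have h : ∀ i j r, yangianT 𝕜 p i j r ∈ A := fun i j r => by
      fin_cases i <;> fin_cases j
      exacts [h00 r, h01 r, h10 r, h11 r]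
    have := h a.1 a.2.1 (a.2.2 + 1)
    rwa [yangianT, freeT, dif_pos a.2.2.2] at this
  | mul a b ha hb => rw [map_mul]; exact mul_mem ha hb
  | add a b ha hb => rw [map_add]; exact add_mem ha hb

theorem yangianGamma_finiteType (hp : 0 < p) : Algebra.FiniteType 𝕜 (yangianGamma 𝕜 p) := by
  obtain ⟨N, f, d, γ, -, -, -, hgen⟩ := exists_yangianGamma_generators (𝕜 := 𝕜) hp
  exact ⟨Subalgebra.fg_def.2 ⟨_, Set.finite_range γ, hgen⟩⟩

variable [CharZero 𝕜]

/-- The locally finite vectors of a module over the Yangian form a submodule. -/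
theorem IsLocallyFiniteVector.yangian_smul (M : Type u) [AddCommGroup M]
    [Module (LevelYangian 𝕜 p) M] [Module 𝕜 M] [IsScalarTower 𝕜 (LevelYangian 𝕜 p) M]
    (a : LevelYangian 𝕜 p) (x : M) (hx : IsLocallyFiniteVector (yangianGamma 𝕜 p) x) :
    IsLocallyFiniteVector (yangianGamma 𝕜 p) (a • x) := by
  let A : Subalgebra 𝕜 (LevelYangian 𝕜 p) :=
    { carrier := {a | ∀ x : M, IsLocallyFiniteVector (yangianGamma 𝕜 p) x →
        IsLocallyFiniteVector (yangianGamma 𝕜 p) (a • x)}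
      mul_mem' := fun ha hb x hx => by rw [mul_smul]; exact ha _ (hb x hx)
      add_mem' := fun ha hb x hx => by rw [add_smul]; exact (ha x hx).add (hb x hx)
      algebraMap_mem' := fun c x hx => hx.smul_of_mem (Subalgebra.algebraMap_mem _ c) }
  have hoff : ∀ i j : Fin 2, (∀ q r, yangianT 𝕜 p 1 1 q * yangianT 𝕜 p i j r
      ∈ sumsMulGamma 𝕜 p i j) → ∀ r, yangianT 𝕜 p i j r ∈ A := by
    intro i j hij r
    rcases lt_or_ge p r with h | h
    · rw [yangianT_of_lt 𝕜 p i j r h]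
      exact zero_mem A
    intro x hx
    refine hx.smul_of_mul_mem (t := fun r : Fin (p + 1) => yangianT 𝕜 p i j r) rfl ?_
      ⟨r, Nat.lt_succ_of_le h⟩
    rintro _ (⟨m, rfl⟩ | ⟨m, rfl⟩) s
    · rw [(quantumDet_coeff_central 𝕜 p m _).eq]
      exact mul_mem_sumsMulGamma i j s (Algebra.subset_adjoin (Or.inl ⟨m, rfl⟩))
    · rw [yangianTPoly_coeff]
      split_ifs
      · exact hij _ _
      · rw [zero_mul]
        exact zero_mem _
  exact mem_of_yangianT_mem (A := A) (hoff 0 1 fun q r => (yangianT_mul_mem_sumsMulGamma q r).1)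
    (hoff 1 0 fun q r => (yangianT_mul_mem_sumsMulGamma q r).2)
    (fun r x hx => hx.smul_of_mem (yangianT_mem_yangianGamma r)) a x hx

end YangianHarishChandra

end

theorem theorem3p4 (𝕜 : Type u) [Field 𝕜] [IsAlgClosed 𝕜] [CharZero 𝕜] (p : ℕ) (hp : 0 < p) :
    (∀ x ∈ yangianGamma 𝕜 p, ∀ y ∈ yangianGamma 𝕜 p, x * y = y * x) ∧
    Module.Free (yangianGamma 𝕜 p) (LevelYangian 𝕜 p) ∧
    Module.Free (yangianGamma 𝕜 p).op (LevelYangian 𝕜 p) ∧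
    (∃ N : Submodule (yangianGamma 𝕜 p) (LevelYangian 𝕜 p),
      IsCompl (yangianGamma 𝕜 p).asLeftSubmodule N) ∧
    (∃ N : Submodule (yangianGamma 𝕜 p).op (LevelYangian 𝕜 p),
      IsCompl (yangianGamma 𝕜 p).asRightSubmodule N) ∧
    (∀ m : Ideal (yangianGamma 𝕜 p), m.IsMaximal →
      ∃ (M : Type u) (_ : AddCommGroup M) (_ : Module (LevelYangian 𝕜 p) M),
        IsExtendedFrom (yangianGamma 𝕜 p) m M) := by
  obtain ⟨S, s, b, b', hb, hb'⟩ := exists_basis_over_yangianGamma (𝕜 := 𝕜) hp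
  refine ⟨yangianGamma_commutative 𝕜 p, Module.Free.of_basis b, Module.Free.of_basis b',
    Subalgebra.exists_isCompl_asLeftSubmodule b hb,
    Subalgebra.exists_isCompl_asRightSubmodule b' hb', fun m hm => ?_⟩
  have := yangianGamma_finiteType (𝕜 := 𝕜) hp
  obtain ⟨π, hπ, hπ1⟩ := Module.Basis.exists_projection b' hb'
  exact exists_isExtendedFrom hm (one_notMem_span_of_projection hm.ne_top π hπ hπ1)
    IsLocallyFiniteVector.yangian_smul
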